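/- **Setting.** Let $\mathbf v_0=(1,0)$, $\mathbf v_1=(-\frac12,\frac{\sqrt3}2)$, $\mathbf v_2=(-\frac12,-\frac{\sqrt3}2)$ (indices mod $3$) and $\Lambda=\mathbb Z\mathbf v_0+\mathbb Z\mathbf v_1$. *The surface $S$.* For $i\in\mathbb Z/3$ and $\mathbf c\in2\Lambda$ let $R^i_{\mathbf c}$ be the rhombus with vertices $\mathbf c,\ \mathbf c-\mathbf v_{i+1},\ \mathbf c+\mathbf v_i,\ \mathbf c-\mathbf v_{i-1}$, with edges labeled $1,2,3,4$ in this (counterclockwise) order, edge $1$ leaving $\mathbf c$. Remove the vertices from the disjoint union of these rhombi, and glue edge $1$ of $R^i_{\mathbf c}$ to edge $3$ of $R^{i+1}_{\mathbf c-2\mathbf v_{i+1}}$ and edge $2$ of $R^i_{\mathbf c}$ to edge $4$ of $R^{i+1}_{\mathbf c+2\mathbf v_i}$, each time by the rotation by $\frac{2\pi}3$ about the common vertex of the two rhombi. In the coordinate on $R^i_{\mathbf c}$ obtained by moving $\mathbf c$ to $\mathbf 0$ and rotating $\mathbf v_i$ to $\mathbf v_0$, the gluings are translations, so the quotient $S$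 is a translation surface. $F_\theta$ is its straight-line flow $F^s_\theta(p)=p+s(\cos\theta,\sin\theta)$. *The refractive flow.* Consider the trihexagonal tiling with edges of length one and hexagon centers $2\Lambda$. The refractive flow $T$ moves unit tangent vectors at unit speed along straight lines inside the tiles; when a trajectory crosses an interior point of an edge, the component of its direction along the edge is reversed and the normal component is kept. It is not continued through the vertices of the tiling. Its phase space $X$ is the unit tangent bundle of the plane minus the vertices, with the topology in which, at an edge, the vectors just before and just after refraction are identified. $T_{\theta,+}$ is the restriction of $T$ to the trajectories which, when in a hexagon, travel in a direction in $\{\theta,\theta+\frac{2\pi}3,\theta+\frac{4\pi}3\}$ and counter-clockwise around the center of this hexagon. The domains of the flows consist of the points whose trajectory is defined for all time: write $S_\theta\subset S$ for the set of those points for $F_\theta$, and $X_{\theta,+}\subset X$ for the set of those unit tangent vectors for $T_{\theta,+}$, both with the subspace topology. The Lebesgue transverse measures are given by Lebesgue measure in the coordinate orthogonal to the direction of the flow, in each rhombus of $S$ and, for each direction, in each tile. A cross-section is a Borel set of points such that the times between successive visits of a trajectory to it are bounded below by a positive constant. **Theorem.** Let $\frac\pi3\le\theta\le\frac{2\pi}3$.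 There is a homeomorphism $\mathbf x:S_\theta\to X_{\theta,+}$ such that 1. $\mathbf x$ carries each trajectory of $F_\theta$ onto a trajectory of $T_{\theta,+}$, respecting the orientations of the trajectories given by the flows; 2. $\mathbf x$ carries the Lebesgue transverse measure to the Lebesgue transverse measure: for each cross-section $A\subset S_\theta$ of $F_\theta$, the transverse measure of $\mathbf x(A)$ equals that of $A$; 3. there is a constant $L$ such that the restriction of $\mathbf x$ to any trajectory $\{F^s_\theta(p):s\in\mathbb R\}$, $p\in S_\theta$, is an $L$-bilipschitz map onto the trajectory $\{T^t(\mathbf x(p)):t\in\mathbb R\}$, where the trajectories carry the metrics for which the flows have unit speed (the distance of two points is the least time in which the flow leads from one to the other). -/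

import Mathlib

noncomputable section

namespace Trihex

open scoped ENNReal

/-! The plane is `ℂ`. Lattice indices `(m, n) : ℤ × ℤ` stand for the point `2m v₀ + 2n v₁` of the
lattice `2Λ` of hexagon centers. All indices of the vectors `v` are taken modulo three. -/

/-- The three unit vectors `v₀, v₁, v₂` at angles `0`, `2π/3`, `4π/3`; they sum to zero. -/
def v : Fin 3 → ℂ := ![1, ⟨-1 / 2, √3 / 2⟩, ⟨-1 / 2, -(√3 / 2)⟩]

/-- The lattice point `2m v₀ + 2n v₁`. -/
def ctr (c : ℤ × ℤ) : ℂ := 2 * (c.1 : ℂ) * v 0 + 2 * (c.2 : ℂ) * v 1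

/-- The index of the lattice vector `2 vᵢ` (recall `v₂ = -v₀ - v₁`). -/
def e : Fin 3 → ℤ × ℤ := ![(1, 0), (0, 1), (-1, -1)]

/-- The cross product `z ∧ w` of two plane vectors. -/
def cross (z w : ℂ) : ℝ := z.re * w.im - z.im * w.re

/-- The unit vector at angle `θ`. -/
def dir (θ : ℝ) : ℂ := Complex.exp (θ * Complex.I)

/-! ### The translation surface `S`

The rhombus `Rⁱ_c` of the hexagon centered at `c` is `c + vᵢ • R`, with `R` the standard rhombus
below (so that the outward short diagonal of `Rⁱ_c` is `vᵢ`). A point of `Rⁱ_c` is recorded by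
`(i, c)` and its coordinate `w ∈ R`; its position in the plane is `c + vᵢ w`. In these coordinates
the rotations by `±2π/3` which glue the rhombi become translations, and the coordinates `w`
are the coordinates of the translation structure. -/

/-- The closed rhombus with vertices `0, -v₁, v₀, -v₂`, with the vertices removed. -/
def rhombus : Set ℂ :=
  convexHull ℝ {0, -v 1, v 0, -v 2} \ {0, -v 1, v 0, -v 2}

/-- Points of the disjoint union of the rhombi `Rⁱ_c` (vertices removed). -/
abbrev PreS : Type := {q : (Fin 3 × (ℤ × ℤ)) × ℂ // q.2 ∈ rhombus}

/-- The edge gluings. Edge 1 runs from `0` to `-v₁`, edge 2 from `-v₁` to `v₀`, edge 3 from `v₀`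
to `-v₂`, edge 4 from `-v₂` to `0`. Edge 1 of `Rⁱ_c` is glued to edge 3 of `Rⁱ⁺¹_{c - 2 vᵢ₊₁}`, and
edge 2 of `Rⁱ_c` to edge 4 of `Rⁱ⁺¹_{c + 2 vᵢ}`. -/
inductive GlueS : PreS → PreS → Prop
  | edge13 (p q : PreS) (hp : p.1.2 ∈ openSegment ℝ 0 (-v 1))
      (hi : q.1.1 = (p.1.1.1 + 1, p.1.1.2 - e (p.1.1.1 + 1)))
      (hw : q.1.2 = p.1.2 - v 2) : GlueS p q
  | edge24 (p q : PreS) (hp : p.1.2 ∈ openSegment ℝ (-v 1) (v 0))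
      (hi : q.1.1 = (p.1.1.1 + 1, p.1.1.2 + e p.1.1.1))
      (hw : q.1.2 = p.1.2 + v 1) : GlueS p q

/-- The surface `S`, with the quotient topology. -/
abbrev S : Type := Quot GlueS

/-- The curve `γ`, defined for all time, is a trajectory of the straight-line flow `F_θ`: after and
before each time `t` it moves for some time inside one closed rhombus with constant velocity
`(cos θ, sin θ)` in the coordinates of the translation structure. -/
def IsStraightTrajectory (θ : ℝ) (γ : ℝ → S) : Prop :=
  ∀ t : ℝ, ∃ ε > (0 : ℝ),
    (∃ (k : Fin 3 × (ℤ × ℤ)) (w : ℂ), ∀ s ∈ Set.Icc (0 : ℝ) ε,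
      ∃ h : w + s * dir θ ∈ rhombus, γ (t + s) = Quot.mk GlueS ⟨(k, w + s * dir θ), h⟩) ∧
    (∃ (k : Fin 3 × (ℤ × ℤ)) (w : ℂ), ∀ s ∈ Set.Icc (0 : ℝ) ε,
      ∃ h : w - s * dir θ ∈ rhombus, γ (t - s) = Quot.mk GlueS ⟨(k, w - s * dir θ), h⟩)

/-- The domain of the flow `F_θ`: the points of `S` whose trajectory is defined for all time. -/
def domS (θ : ℝ) : Set S := {p | ∃ γ : ℝ → S, IsStraightTrajectory θ γ ∧ γ 0 = p}

/-- The Lebesgue transverse measure, given by `|sin θ dx - cos θ dy|`, of a set `A` in `S`: the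
number of points of `A` on the line of direction `θ` with signed distance `y` from the origin, integrated
over `y` and summed over the rhombi. So that each point is counted once, the edges 3 and 4 of each
rhombus are left out. -/
def transverseS (θ : ℝ) (A : Set S) : ℝ≥0∞ :=
  ∑' k : Fin 3 × (ℤ × ℤ), ∫⁻ y : ℝ,
    ({w : ℂ | w ∉ segment ℝ (v 0) (-v 2) ∧ w ∉ segment ℝ (-v 2) 0 ∧ cross (dir θ) w = y ∧
      ∃ h : w ∈ rhombus, Quot.mk GlueS ⟨(k, w), h⟩ ∈ A}.encard : ℝ≥0∞)

/-! ### The trihexagonal tiling and its refractive flow -/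

/-- The tiles: for each `c ∈ 2Λ` the hexagon centered at `c`, the upward-pointing triangle on its
top edge and the downward-pointing triangle on its bottom edge. -/
inductive Tile : Type
  | hex (c : ℤ × ℤ)
  | up (c : ℤ × ℤ)
  | down (c : ℤ × ℤ)

instance : TopologicalSpace Tile := ⊥

/-- The vertices of a tile. -/
def Tile.corners : Tile → Set ℂ
  | .hex c => {z | ∃ i, z = ctr c + v i ∨ z = ctr c - v i}
  | .up c => {ctr c - v 2, ctr c + v 1, ctr c + v 1 - v 2}
  | .down c => {ctr c - v 1, ctr c + v 2, ctr c + v 2 - v 1}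

/-- The closed tile, with its vertices removed. -/
def Tile.region (τ : Tile) : Set ℂ := convexHull ℝ τ.corners \ τ.corners

/-- Unit tangent vectors, based at the point `z` of a closed tile `τ` and with direction `d`,
recorded as `(τ, z, d)`. -/
abbrev PreX : Type := {q : Tile × ℂ × Circle // q.2.1 ∈ q.1.region}

/-- Refraction: let two tiles share the edge from `a` to `b` (which has length one). A unit vector
based at an interior point of the edge and transverse to it, as seen in the first tile, is identified
with the vector as seen in the second tile which has the same base point and the same component normal
to the edge, while the component along the edge is reversed; as `|b - a| = 1`, the direction `d`
becomes `-(b - a)² * conj d`. -/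
inductive GlueX : PreX → PreX → Prop
  | refract (p q : PreX) (a b : ℂ) (hne : p.1.1 ≠ q.1.1) (hab : a ≠ b)
      (ha : a ∈ p.1.1.corners ∩ q.1.1.corners) (hb : b ∈ p.1.1.corners ∩ q.1.1.corners)
      (hz : p.1.2.1 ∈ openSegment ℝ a b) (htrans : cross (b - a) p.1.2.2 ≠ 0)
      (hz2 : q.1.2.1 = p.1.2.1)
      (hd : (q.1.2.2 : ℂ) = -(b - a) ^ 2 * (starRingEnd ℂ) (p.1.2.2 : ℂ)) : GlueX p q

/-- The phase space `X` of the refractive flow: the unit tangent bundle of the plane minus the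
vertices of the tiling, with the topology in which vectors that become equal by refraction at an
edge are identified. -/
abbrev X : Type := Quot GlueX

/-- The curve `γ`, defined for all time, is a trajectory of the refractive flow: after and
before each time `t` it moves for some time inside one closed tile along a straight line at unit
speed, in the direction in which it points. -/
def IsRefractiveTrajectory (γ : ℝ → X) : Prop :=
  ∀ t : ℝ, ∃ ε > (0 : ℝ),
    (∃ (τ : Tile) (z : ℂ) (d : Circle), ∀ s ∈ Set.Icc (0 : ℝ) ε,
      ∃ h : z + s * d ∈ τ.region, γ (t + s) = Quot.mk GlueX ⟨(τ, z + s * d, d), h⟩) ∧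
    (∃ (τ : Tile) (z : ℂ) (d : Circle), ∀ s ∈ Set.Icc (0 : ℝ) ε,
      ∃ h : z - s * d ∈ τ.region, γ (t - s) = Quot.mk GlueX ⟨(τ, z - s * d, d), h⟩)

/-- The curve `γ` is a trajectory of the flow `T_{θ,+}`: a trajectory of the refractive flow which,
whenever it is in a hexagon, travels in one of the directions `θ`, `θ + 2π/3`, `θ + 4π/3`, and
counter-clockwise around the center of this hexagon. -/
def IsRefractiveTrajectoryPlus (θ : ℝ) (γ : ℝ → X) : Prop :=
  IsRefractiveTrajectory γ ∧
    ∀ (t : ℝ) (c : ℤ × ℤ) (z : ℂ) (d : Circle) (h : z ∈ (Tile.hex c).region),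
      γ t = Quot.mk GlueX ⟨(Tile.hex c, z, d), h⟩ →
        (∃ i, (d : ℂ) = dir θ * v i) ∧ 0 < cross (z - ctr c) d

/-- The domain `X_{θ,+}` of the flow `T_{θ,+}`. -/
def domX (θ : ℝ) : Set X := {p | ∃ γ : ℝ → X, IsRefractiveTrajectoryPlus θ γ ∧ γ 0 = p}

/-- The part of the plane which is attributed to a tile when each point has to be attributed to one
tile only: the edges belong to the hexagons. -/
def Tile.own : Tile → Set ℂ
  | .hex c => (Tile.hex c).region
  | .up c => interior (Tile.up c).region
  | .down c => interior (Tile.down c).region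

/-- The Lebesgue transverse measure of a set `A` of unit tangent vectors: the number of vectors in `A`
of direction `d` whose base point has signed distance `y` from the line of direction `d` through the origin,
integrated over `y` and summed over the tiles and the directions `d`. -/
def transverseX (A : Set X) : ℝ≥0∞ :=
  ∑' (τ : Tile) (d : Circle), ∫⁻ y : ℝ,
    ({z : ℂ | z ∈ τ.own ∧ cross d z = y ∧
      ∃ h : z ∈ τ.region, Quot.mk GlueX ⟨(τ, z, d), h⟩ ∈ A}.encard : ℝ≥0∞)

/-! ### Notions for a flow given by its trajectories -/

/-- The distance of two points of one trajectory, in the metric on the trajectory for which the flow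
has unit speed: the least time which the flow needs from one of them to the other. -/
def orbitDist {M : Type*} (IsTraj : (ℝ → M) → Prop) (p q : M) : ℝ :=
  sInf {r : ℝ | ∃ γ : ℝ → M, IsTraj γ ∧ ∃ s t : ℝ, γ s = p ∧ γ t = q ∧ r = |t - s|}

/-- A cross-section of a flow: along each trajectory, the times between successive visits to `A` are
bounded below by a positive constant. -/
def IsCrossSection {M : Type*} (IsTraj : (ℝ → M) → Prop) (A : Set M) : Prop :=
  ∃ ε > (0 : ℝ), ∀ γ : ℝ → M, IsTraj γ → ∀ s t : ℝ, γ s ∈ A → γ t ∈ A → s < t → ε ≤ t - s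

end Trihex

end

/-!
Both flows are suspension flows over one and the same base map, and the homeomorphism matches the
points of the two suspensions over the same point of the base.

*The base.* The short diagonal of the rhombus `Rⁱ_c` is the segment from the center `c` of a hexagon
to its vertex `c + vᵢ`. It is at the same time a radius of the hexagon, called the axis of the frame
`(i, c)`. For `π/3 ≤ θ ≤ 2π/3` every trajectory of either flow crosses these segments again and
again: on `S` in the direction `θ` of the coordinates of the rhombus, and in the hexagon in the
direction `θ + 2πi/3`, with the center on its left. A crossing is given by the index `(i, c)` and the
place `a ∈ (0, 1)` on the segment. Let `β = 1/2 - κ` with `κ = (√3/2) cot θ`. On `S` the trajectory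
from the place `a` leaves the rhombus through one of its two upper edges, according to `a < β` or
`a > β`, and comes to the place `a + 1 - β`, respectively `a - β`, of the rhombus glued there: the
`returnMap` is a rotation together with a change of the rhombus (`nx`, `pv`). The trajectories that
are defined for all time are those whose places avoid the orbit of the endpoints (`Bset`).

*The refractive flow has the same return map.* For `a < β` the trajectory from the place `a` of an
axis leaves the hexagon through the edge parallel to this axis, passes a triangle and enters the next
hexagon through an edge that is slanted with respect to the next axis; for `a > β` it leaves the
hexagon through a slanted edge, passes a triangle and enters the next hexagon through the edge
parallel to the next axis. In both cases it has crossed just one triangle, and it reaches the axis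
with the index and the place given by `returnMap` (`refractive_step`). So the chart `chartX` has the
same base map as `chartS`. In units of `climb θ`, the time in which the flows rise by `√3/2` over the
axis, the return times are constantly `1` on `S`, and lie between `1` and `3` for the refractive
flow.

*The homeomorphism.* Normalize the time along the trajectories so that they return to the section at
the integers. Matching points with the same base point and the same normalized time is well defined
and bijective, it is a homeomorphism since the swept part of either space carries the quotient
topology of the suspension (`lift` in `SuspensionChart`, `exists_homeomorph`), and it respects
trajectories and changes distances along them at most by the factor `3`
(`exists_orbit_equivalence`). That the charts contain all trajectories, and nothing else, is shown in
`chartS_describes` and `chartX_describes`.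

*The measures.* In both flows the transverse measure of a cross-section `A` is `sin θ` times the
integral, over the section with the Lebesgue measure of the places, of the number of visits to `A` up
to the first return. The definitions count points in rhombi and tiles, which do not begin and end at
the section (`transverseS_eq`, `transverseX_eq_hits`). The parts before and after the section are put
together by the invariance of the measure under the return map, an exchange of intervals
(`total_comp_returnMap`, `total_hits`). That the number of visits is measurable follows from the
Lusin–Souslin theorem (`measurable_encard_fibre`). The number of visits is the same for `A` and for
its image, since they correspond to the same normalized times.
-/

noncomputable section

namespace Trihex

open scoped ENNReal
open Set Filter Topology MeasureTheory

/-! ### Quotients by a matching, and curves that locally follow lines -/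

/-- If the symmetrization of `r` relates every point to at most one other point, then the classes
of the quotient by `r` have at most two elements. -/
theorem quot_mk_eq_iff {α : Type*} {r : α → α → Prop}
    (h : ∀ p q q', (r p q ∨ r q p) → (r p q' ∨ r q' p) → q = q') {p q : α} :
    Quot.mk r p = Quot.mk r q ↔ p = q ∨ r p q ∨ r q p := by
  constructor
  · intro hpq
    have hs : Equivalence fun p q => p = q ∨ r p q ∨ r q p :=
      { refl := fun _ => Or.inl rfl
        symm := by
          rintro a b (rfl | h1 | h1)
          exacts [Or.inl rfl, Or.inr (Or.inr h1), Or.inr (Or.inl h1)]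
        trans := by
          rintro a b c (rfl | h1) (rfl | h2)
          exacts [Or.inl rfl, Or.inr h2, Or.inr h1, Or.inl (h b a c h1.symm h2)] }
    have h1 := Relation.EqvGen.mono (p := fun p q => p = q ∨ r p q ∨ r q p)
      (fun a b hab => Or.inr (Or.inl hab)) _ _ (Quot.eqvGen_exact hpq)
    rwa [hs.eqvGen_eq] at h1
  · rintro (rfl | h1 | h1)
    exacts [rfl, Quot.sound h1, (Quot.sound h1).symm]

/-- A system of lines in `M` is a relation `R ℓ t p`, read "the line `ℓ` is at `p` at time `t`". The
curve `γ` follows the lines if after and before each time it moves along some line for a while. -/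
def FollowsLines {M Λ : Type*} (R : Λ → ℝ → M → Prop) (γ : ℝ → M) : Prop :=
  ∀ t : ℝ, ∃ ε > (0 : ℝ), (∃ ℓ, ∀ s ∈ Icc (0 : ℝ) ε, R ℓ s (γ (t + s))) ∧
    (∃ ℓ, ∀ s ∈ Icc (0 : ℝ) ε, R ℓ (-s) (γ (t - s)))

/-- A curve that follows lines and is once on `ℓ` stays on `ℓ` as long as `ℓ` absorbs every line
that meets it; it is still on `ℓ` at the limit times, so that these belong to `ℓ`. -/
theorem FollowsLines.onLine {M Λ : Type*} {R : Λ → ℝ → M → Prop} {γ : ℝ → M}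
    (hγ : FollowsLines R γ) {ℓ : Λ} {O : Set ℝ} (hO : IsPreconnected O) (t₀ : ℝ)
    (sep : ∀ t ∈ O, R ℓ t (γ (t₀ + t)) → ∀ ℓ' u, R ℓ' u (γ (t₀ + t)) →
      ∀ v p, R ℓ' (u + v) p → R ℓ (t + v) p)
    {t : ℝ} (ht : t ∈ O) (h : R ℓ t (γ (t₀ + t))) {t' : ℝ} (ht' : t' ∈ closure O) :
    R ℓ t' (γ (t₀ + t')) := by
  classical
  have key1 : ∀ t', ∃ ε > (0 : ℝ), ∀ t'' ∈ O, |t'' - t'| ≤ ε → R ℓ t'' (γ (t₀ + t'')) →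
      R ℓ t' (γ (t₀ + t')) := by
    intro t'
    obtain ⟨ε, hε, ⟨ℓ₁, h₁⟩, ⟨ℓ₂, h₂⟩⟩ := hγ (t₀ + t')
    refine ⟨ε, hε, fun t'' ht'' hd hR => ?_⟩
    rw [abs_le] at hd
    rcases le_total t' t'' with hle | hle
    · have e := h₁ (t'' - t') ⟨by linarith, by linarith⟩
      rw [show t₀ + t' + (t'' - t') = t₀ + t'' by ring] at e
      have e0 := h₁ 0 ⟨le_rfl, hε.le⟩
      rw [add_zero] at e0
      have := sep t'' ht'' hR _ _ e (t' - t'') (γ (t₀ + t'))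
        (by rwa [show t'' - t' + (t' - t'') = 0 by ring])
      rwa [show t'' + (t' - t'') = t' by ring] at this
    · have e := h₂ (t' - t'') ⟨by linarith, by linarith⟩
      rw [show t₀ + t' - (t' - t'') = t₀ + t'' by ring] at e
      have e0 := h₂ 0 ⟨le_rfl, hε.le⟩
      rw [sub_zero, neg_zero] at e0
      have := sep t'' ht'' hR _ _ e (t' - t'') (γ (t₀ + t'))
        (by rwa [show -(t' - t'') + (t' - t'') = 0 by ring])
      rwa [show t'' + (t' - t'') = t' by ring] at this
  have key2 : ∀ t' ∈ O, R ℓ t' (γ (t₀ + t')) → ∃ ε > (0 : ℝ), ∀ t'', |t'' - t'| ≤ ε →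
      R ℓ t'' (γ (t₀ + t'')) := by
    intro t' ht' hR
    obtain ⟨ε, hε, ⟨ℓ₁, h₁⟩, ⟨ℓ₂, h₂⟩⟩ := hγ (t₀ + t')
    refine ⟨ε, hε, fun t'' hd => ?_⟩
    rw [abs_le] at hd
    rcases le_total t' t'' with hle | hle
    · have e := h₁ (t'' - t') ⟨by linarith, by linarith⟩
      rw [show t₀ + t' + (t'' - t') = t₀ + t'' by ring] at e
      have e0 := h₁ 0 ⟨le_rfl, hε.le⟩
      rw [add_zero] at e0
      have := sep t' ht' hR _ _ e0 (t'' - t') (γ (t₀ + t'')) (by rwa [zero_add])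
      rwa [show t' + (t'' - t') = t'' by ring] at this
    · have e := h₂ (t' - t'') ⟨by linarith, by linarith⟩
      rw [show t₀ + t' - (t' - t'') = t₀ + t'' by ring] at e
      have e0 := h₂ 0 ⟨le_rfl, hε.le⟩
      rw [sub_zero, neg_zero] at e0
      have := sep t' ht' hR _ _ e0 (t'' - t') (γ (t₀ + t''))
        (by rwa [zero_add, show t'' - t' = -(t' - t'') by ring])
      rwa [show t' + (t'' - t') = t'' by ring] at this
  have all : ∀ t' ∈ O, R ℓ t' (γ (t₀ + t')) := by
    have hc : ContinuousOn (fun t' => decide (R ℓ t' (γ (t₀ + t')))) O := by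
      intro t' ht'
      have : ∀ᶠ t'' in 𝓝[O] t', decide (R ℓ t'' (γ (t₀ + t''))) = decide (R ℓ t' (γ (t₀ + t'))) := by
        obtain ⟨ε, hε, h1⟩ := key1 t'
        by_cases hR : R ℓ t' (γ (t₀ + t'))
        · obtain ⟨ε', hε', h2⟩ := key2 t' ht' hR
          filter_upwards [mem_nhdsWithin_of_mem_nhds (Metric.ball_mem_nhds t' hε')] with t'' h''
          rw [decide_eq_decide]
          exact ⟨fun _ => hR, fun _ => h2 t'' (by rw [Metric.mem_ball, Real.dist_eq] at h''; exact h''.le)⟩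
        · filter_upwards [mem_nhdsWithin_of_mem_nhds (Metric.ball_mem_nhds t' hε),
            self_mem_nhdsWithin] with t'' h'' hO''
          rw [decide_eq_decide]
          rw [Metric.mem_ball, Real.dist_eq] at h''
          exact ⟨fun hh => h1 t'' hO'' h''.le hh, fun hh => (hR hh).elim⟩
      exact (continuousWithinAt_const (b := decide (R ℓ t' (γ (t₀ + t'))))).congr_of_eventuallyEq
        this rfl
    intro t' ht'
    have := hO.constant hc ht ht'
    simpa [h] using this.symm
  obtain ⟨ε, hε, h1⟩ := key1 t'
  obtain ⟨t'', h'', hd⟩ := Metric.mem_closure_iff.1 ht' ε hε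
  rw [dist_comm, Real.dist_eq] at hd
  exact h1 t'' h'' hd.le (all t'' h'')

/-! ### Suspension flows -/

/-- A presentation of a flow on (part of) `M` as a suspension flow over the base map `f : Z ≃ₜ Z`.
The section is embedded as `z ↦ C z 0`, and `C z` is the trajectory through this point, for the times
in `[-lo z, hi z]`; at time `hi z` it meets the beginning of the trajectory `C (f z)`, and there are no
further coincidences. The first return time is `hi z + lo (f z)`. The field `lift` says that the range
of `C` carries the quotient topology of the set of pairs `(z, σ)` with `σ ∈ [-lo z, hi z]`. -/
structure SuspensionChart {Z : Type*} [TopologicalSpace Z] (f : Z ≃ₜ Z)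
    (M : Type*) [TopologicalSpace M] where
  lo : Z → ℝ
  hi : Z → ℝ
  C : Z → ℝ → M
  lo_cont : Continuous lo
  hi_cont : Continuous hi
  lo_pos : ∀ z, 0 < lo z
  hi_pos : ∀ z, 0 < hi z
  cont : ContinuousOn (Function.uncurry C) {p | -lo p.1 ≤ p.2 ∧ p.2 ≤ hi p.1}
  glue : ∀ z, C z (hi z) = C (f z) (-lo (f z))
  inj : ∀ z σ z' σ', -lo z ≤ σ → σ ≤ hi z → -lo z' ≤ σ' → σ' ≤ hi z' → C z σ = C z' σ' →
    (z = z' ∧ σ = σ') ∨ (σ = hi z ∧ z' = f z ∧ σ' = -lo z') ∨ (σ' = hi z' ∧ z = f z' ∧ σ = -lo z)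
  one_le_roof : ∀ z, 1 ≤ hi z + lo (f z)
  roof_le : ∀ z, hi z + lo (f z) ≤ 3
  lift : ∀ W : Set M, IsClosed {p : Z × ℝ | (-lo p.1 ≤ p.2 ∧ p.2 ≤ hi p.1) ∧ C p.1 p.2 ∈ W} →
    ∃ V : Set M, IsClosed V ∧ ∀ z σ, -lo z ≤ σ → σ ≤ hi z → (C z σ ∈ V ↔ C z σ ∈ W)

namespace SuspensionChart

variable {Z : Type*} [TopologicalSpace Z] {f : Z ≃ₜ Z} {M : Type*} [TopologicalSpace M]
  (D : SuspensionChart f M)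

/-- The first return time. -/
def roof (z : Z) : ℝ := D.hi z + D.lo (f z)

lemma roof_pos (z : Z) : 0 < D.roof z := by have := D.one_le_roof z; unfold roof; linarith

lemma hi_lt_roof (z : Z) : D.hi z < D.roof z := by have := D.lo_pos (f z); unfold roof; linarith

lemma roof_cont : Continuous D.roof := D.hi_cont.add (D.lo_cont.comp f.continuous)

/-- The trajectory from the section point `y` to its first return, with the time normalized
to `[0, 1]`. -/
def loop (y : Z) (s : ℝ) : M :=
  if s * D.roof y ≤ D.hi y then D.C y (s * D.roof y) else D.C (f y) (s * D.roof y - D.roof y)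

/-- The trajectory of the section point `z`, with the time normalized so that it returns to
the section at the integers. -/
def orbit (z : Z) (s : ℝ) : M := D.loop ((f ^ ⌊s⌋) z) (Int.fract s)

lemma zpow_add_one_apply (z : Z) (n : ℤ) : (f ^ (n + 1)) z = f ((f ^ n) z) := by
  rw [add_comm, zpow_add, zpow_one]; rfl

lemma zpow_add_apply (z : Z) (m n : ℤ) : (f ^ (m + n)) z = (f ^ m) ((f ^ n) z) := by
  rw [zpow_add]; rfl

lemma loop_zero (y : Z) : D.loop y 0 = D.C y 0 := by
  simp [loop, (D.hi_pos y).le]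

lemma loop_one (y : Z) : D.loop y 1 = D.C (f y) 0 := by
  simp [loop, not_le.2 (D.hi_lt_roof y)]

lemma loop_of_le {y : Z} {s : ℝ} (h : s * D.roof y ≤ D.hi y) :
    D.loop y s = D.C y (s * D.roof y) := if_pos h

lemma loop_of_ge {y : Z} {s : ℝ} (h : D.hi y ≤ s * D.roof y) :
    D.loop y s = D.C (f y) (s * D.roof y - D.roof y) := by
  rcases h.lt_or_eq with h | h
  · exact if_neg (not_le.2 h)
  · rw [loop, if_pos h.ge, ← h, D.glue]; congr 1; unfold roof; ring

/-- On `[n, n + 1]` the trajectory is the loop at the `n`-th iterate. -/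
lemma orbit_eq_loop (z : Z) (n : ℤ) {s : ℝ} (h0 : n ≤ s) (h1 : s ≤ n + 1) :
    D.orbit z s = D.loop ((f ^ n) z) (s - n) := by
  rcases h1.lt_or_eq with h1 | h1
  · have : ⌊s⌋ = n := Int.floor_eq_iff.2 ⟨h0, h1⟩
    rw [orbit, Int.fract, this]
  · have h2 : s = ((n + 1 : ℤ) : ℝ) := by push_cast; exact h1
    rw [orbit, h2, Int.fract_intCast, Int.floor_intCast, loop_zero]
    push_cast
    rw [add_sub_cancel_left, loop_one, zpow_add_one_apply]

lemma loop_continuousOn :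
    ContinuousOn (Function.uncurry D.loop) {p : Z × ℝ | 0 ≤ p.2 ∧ p.2 ≤ 1} := by
  have hr : Continuous fun p : Z × ℝ => p.2 * D.roof p.1 :=
    continuous_snd.mul (D.roof_cont.comp continuous_fst)
  have hA : IsClosed {p : Z × ℝ | (0 ≤ p.2 ∧ p.2 ≤ 1) ∧ p.2 * D.roof p.1 ≤ D.hi p.1} :=
    ((isClosed_le continuous_const continuous_snd).inter
      (isClosed_le continuous_snd continuous_const)).inter
      (isClosed_le hr (D.hi_cont.comp continuous_fst))
  have hB : IsClosed {p : Z × ℝ | (0 ≤ p.2 ∧ p.2 ≤ 1) ∧ D.hi p.1 ≤ p.2 * D.roof p.1} :=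
    ((isClosed_le continuous_const continuous_snd).inter
      (isClosed_le continuous_snd continuous_const)).inter
      (isClosed_le (D.hi_cont.comp continuous_fst) hr)
  have cA : ContinuousOn (Function.uncurry D.loop)
      {p : Z × ℝ | (0 ≤ p.2 ∧ p.2 ≤ 1) ∧ p.2 * D.roof p.1 ≤ D.hi p.1} := by
    have : ContinuousOn (fun p : Z × ℝ => D.C p.1 (p.2 * D.roof p.1))
        {p : Z × ℝ | (0 ≤ p.2 ∧ p.2 ≤ 1) ∧ p.2 * D.roof p.1 ≤ D.hi p.1} := by
      refine D.cont.comp (f := fun p : Z × ℝ => (p.1, p.2 * D.roof p.1))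
        (continuous_fst.prodMk hr).continuousOn ?_
      rintro ⟨y, s⟩ ⟨⟨h0, h1⟩, h2⟩
      exact ⟨by have := D.lo_pos y; have := mul_nonneg h0 (D.roof_pos y).le; dsimp at *; linarith, h2⟩
    exact this.congr fun p hp => D.loop_of_le hp.2
  have cB : ContinuousOn (Function.uncurry D.loop)
      {p : Z × ℝ | (0 ≤ p.2 ∧ p.2 ≤ 1) ∧ D.hi p.1 ≤ p.2 * D.roof p.1} := by
    have : ContinuousOn (fun p : Z × ℝ => D.C (f p.1) (p.2 * D.roof p.1 - D.roof p.1))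
        {p : Z × ℝ | (0 ≤ p.2 ∧ p.2 ≤ 1) ∧ D.hi p.1 ≤ p.2 * D.roof p.1} := by
      refine D.cont.comp (f := fun p : Z × ℝ => (f p.1, p.2 * D.roof p.1 - D.roof p.1))
        ((f.continuous.comp continuous_fst).prodMk
          (hr.sub (D.roof_cont.comp continuous_fst))).continuousOn ?_
      rintro ⟨y, s⟩ ⟨⟨h0, h1⟩, h2⟩
      have h3 := D.hi_pos (f y)
      have h4 := mul_le_mul_of_nonneg_right h1 (D.roof_pos y).le
      dsimp at *
      constructor
      · have : D.roof y = D.hi y + D.lo (f y) := rfl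
        linarith
      · linarith
    exact this.congr fun p hp => D.loop_of_ge hp.2
  refine (cA.union_of_isClosed cB hA hB).mono ?_
  intro p hp
  rcases le_total (p.2 * D.roof p.1) (D.hi p.1) with h | h
  exacts [Or.inl ⟨hp, h⟩, Or.inr ⟨hp, h⟩]

lemma orbit_continuous : Continuous (Function.uncurry D.orbit) := by
  have piece : ∀ n : ℤ, ContinuousOn (Function.uncurry D.orbit)
      {p : Z × ℝ | (n : ℝ) ≤ p.2 ∧ p.2 ≤ n + 1} := by
    intro n
    have : ContinuousOn (fun p : Z × ℝ => D.loop ((f ^ n) p.1) (p.2 - n))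
        {p : Z × ℝ | (n : ℝ) ≤ p.2 ∧ p.2 ≤ n + 1} := by
      refine D.loop_continuousOn.comp (f := fun p : Z × ℝ => ((f ^ n) p.1, p.2 - (n : ℝ)))
        (((f ^ n).continuous.comp continuous_fst).prodMk
          (continuous_snd.sub continuous_const)).continuousOn ?_
      rintro ⟨y, s⟩ ⟨h0, h1⟩
      dsimp at *
      constructor <;> linarith
    exact this.congr fun p hp => D.orbit_eq_loop p.1 n hp.1 hp.2
  have closed : ∀ n : ℤ, IsClosed {p : Z × ℝ | (n : ℝ) ≤ p.2 ∧ p.2 ≤ n + 1} := fun n =>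
    (isClosed_le continuous_const continuous_snd).inter
      (isClosed_le continuous_snd continuous_const)
  rw [continuous_iff_continuousAt]
  rintro ⟨z, s⟩
  have h := (piece (⌊s⌋ - 1)).union_of_isClosed (piece ⌊s⌋) (closed _) (closed _)
  refine h.continuousAt ?_
  have : {p : Z × ℝ | (⌊s⌋ : ℝ) - 1 < p.2 ∧ p.2 < ⌊s⌋ + 1} ∈ 𝓝 (z, s) := by
    refine ((isOpen_lt continuous_const continuous_snd).inter
      (isOpen_lt continuous_snd continuous_const)).mem_nhds ⟨?_, Int.lt_floor_add_one s⟩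
    have := Int.floor_le s
    show (⌊s⌋ : ℝ) - 1 < s
    linarith
  filter_upwards [this]
  rintro ⟨y, u⟩ ⟨h0, h1⟩
  dsimp at h0 h1
  rcases le_total u ⌊s⌋ with h | h
  · left; constructor <;> dsimp <;> push_cast <;> linarith
  · right; exact ⟨h, h1.le⟩

/-- The trajectory of `f z` is that of `z`, one return later. -/
lemma orbit_add_int (z : Z) (s : ℝ) (n : ℤ) : D.orbit z (s + n) = D.orbit ((f ^ n) z) s := by
  rw [orbit, orbit, Int.fract_add_intCast, Int.floor_add_intCast, zpow_add_apply]

/-- The normalized time of the point `C z σ`. -/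
def norm (z : Z) (σ : ℝ) : ℝ := if 0 ≤ σ then σ / D.roof z else σ / D.roof (f.symm z)

lemma norm_cont : Continuous fun p : Z × ℝ => D.norm p.1 p.2 := by
  unfold norm
  refine Continuous.if_le ?_ ?_ continuous_const continuous_snd ?_
  · exact continuous_snd.div (D.roof_cont.comp continuous_fst) fun p => (D.roof_pos _).ne'
  · exact continuous_snd.div (D.roof_cont.comp (f.symm.continuous.comp continuous_fst))
      fun p => (D.roof_pos _).ne'
  · intro p hp; rw [← hp]; simp

lemma orbit_norm {z : Z} {σ : ℝ} (h0 : -D.lo z ≤ σ) (h1 : σ ≤ D.hi z) :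
    D.orbit z (D.norm z σ) = D.C z σ := by
  have hr := D.roof_pos z
  have hr' := D.roof_pos (f.symm z)
  unfold norm
  split_ifs with h
  · have e := D.orbit_eq_loop z 0 (s := σ / D.roof z) (by simpa using div_nonneg h hr.le)
      (by rw [div_le_iff₀ hr]; have := D.hi_lt_roof z; push_cast; linarith)
    rw [e]
    have e2 : (f ^ (0 : ℤ)) z = z := rfl
    rw [e2, Int.cast_zero, sub_zero, loop_of_le] <;> rw [div_mul_cancel₀ _ hr.ne']
    exact h1
  · push Not at h
    have hro : D.roof (f.symm z) = D.hi (f.symm z) + D.lo z := by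
      unfold roof; rw [Homeomorph.apply_symm_apply]
    have hh := D.hi_pos (f.symm z)
    have e := D.orbit_eq_loop z (-1) (s := σ / D.roof (f.symm z))
      (by rw [le_div_iff₀ hr']; push_cast; linarith)
      (by rw [div_le_iff₀ hr']; push_cast; linarith)
    rw [e]
    have e2 : (f ^ (-1 : ℤ)) z = f.symm z := by rw [zpow_neg_one]; rfl
    rw [e2, loop_of_ge]
    · rw [Homeomorph.apply_symm_apply]
      congr 1
      push_cast
      field_simp
      ring
    · push_cast
      have : (σ / D.roof (f.symm z) - -1) * D.roof (f.symm z) = σ + D.roof (f.symm z) := by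
        field_simp; ring
      rw [this]; linarith

/-- The part of `M` swept by the flow. -/
def dom : Set M := Set.range (Function.uncurry D.orbit)

lemma loop_inj {y y' : Z} {s s' : ℝ} (h0 : 0 ≤ s) (h1 : s < 1) (h0' : 0 ≤ s') (h1' : s' < 1)
    (h : D.loop y s = D.loop y' s') : y = y' ∧ s = s' := by
  have hr := D.roof_pos y
  have hr' := D.roof_pos y'
  have a0 := mul_nonneg h0 hr.le
  have a0' := mul_nonneg h0' hr'.le
  have a1 : s * D.roof y < D.roof y := by nlinarith
  have a1' : s' * D.roof y' < D.roof y' := by nlinarith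
  have e : D.roof y = D.hi y + D.lo (f y) := rfl
  have e' : D.roof y' = D.hi y' + D.lo (f y') := rfl
  have l1 := D.lo_pos y
  have l2 := D.lo_pos y'
  have l3 := D.lo_pos (f y)
  have l4 := D.lo_pos (f y')
  have u1 := D.hi_pos y
  have u2 := D.hi_pos y'
  have u3 := D.hi_pos (f y)
  have u4 := D.hi_pos (f y')
  have fin : y = y' → s * D.roof y = s' * D.roof y' → y = y' ∧ s = s' := by
    rintro rfl h; exact ⟨rfl, mul_right_cancel₀ hr.ne' h⟩
  rcases lt_or_ge (D.hi y) (s * D.roof y) with c | c <;>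
    rcases lt_or_ge (D.hi y') (s' * D.roof y') with c' | c'
  · rw [D.loop_of_ge c.le, D.loop_of_ge c'.le] at h
    rcases D.inj _ _ _ _ (by linarith) (by linarith) (by linarith) (by linarith) h with
      ⟨h1, h2⟩ | ⟨h1, h2, h3⟩ | ⟨h1, h2, h3⟩
    · have h1 := f.injective h1
      exact fin h1 (by subst h1; linarith)
    · linarith
    · linarith
  · rw [D.loop_of_ge c.le, D.loop_of_le c'] at h
    rcases D.inj _ _ _ _ (by linarith) (by linarith) (by linarith) (by linarith) h with
      ⟨h1, h2⟩ | ⟨h1, h2, h3⟩ | ⟨h1, h2, h3⟩ <;> linarith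
  · rw [D.loop_of_le c, D.loop_of_ge c'.le] at h
    rcases D.inj _ _ _ _ (by linarith) (by linarith) (by linarith) (by linarith) h with
      ⟨h1, h2⟩ | ⟨h1, h2, h3⟩ | ⟨h1, h2, h3⟩ <;> linarith
  · rw [D.loop_of_le c, D.loop_of_le c'] at h
    rcases D.inj _ _ _ _ (by linarith) (by linarith) (by linarith) (by linarith) h with
      ⟨h1, h2⟩ | ⟨h1, h2, h3⟩ | ⟨h1, h2, h3⟩
    · exact fin h1 h2
    · linarith
    · linarith

/-- Two points of trajectories coincide only when the base map forces them to. -/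
lemma orbit_eq_iff {z z' : Z} {s s' : ℝ} :
    D.orbit z s = D.orbit z' s' ↔
      (f ^ ⌊s⌋) z = (f ^ ⌊s'⌋) z' ∧ Int.fract s = Int.fract s' := by
  constructor
  · exact D.loop_inj (Int.fract_nonneg _) (Int.fract_lt_one _) (Int.fract_nonneg _)
      (Int.fract_lt_one _)
  · rintro ⟨h1, h2⟩
    rw [orbit, orbit, h1, h2]

lemma C_mem_dom {z : Z} {σ : ℝ} (h0 : -D.lo z ≤ σ) (h1 : σ ≤ D.hi z) : D.C z σ ∈ D.dom :=
  ⟨(z, D.norm z σ), D.orbit_norm h0 h1⟩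

lemma loop_eq_C (y : Z) {s : ℝ} (h0 : 0 ≤ s) (h1 : s ≤ 1) :
    ∃ z σ, (-D.lo z ≤ σ ∧ σ ≤ D.hi z) ∧ D.loop y s = D.C z σ := by
  have hr := D.roof_pos y
  have a1 : s * D.roof y ≤ D.roof y := by nlinarith
  have a0 := mul_nonneg h0 hr.le
  have e : D.roof y = D.hi y + D.lo (f y) := rfl
  have l1 := D.lo_pos y
  have l2 := D.hi_pos (f y)
  rcases le_total (s * D.roof y) (D.hi y) with c | c
  · exact ⟨y, _, ⟨by linarith, c⟩, D.loop_of_le c⟩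
  · exact ⟨f y, _, ⟨by linarith, by linarith⟩, D.loop_of_ge c⟩

lemma mem_dom_iff {p : M} : p ∈ D.dom ↔ ∃ z σ, (-D.lo z ≤ σ ∧ σ ≤ D.hi z) ∧ p = D.C z σ := by
  constructor
  · rintro ⟨⟨z, s⟩, rfl⟩
    exact D.loop_eq_C _ (Int.fract_nonneg _) (Int.fract_lt_one _).le
  · rintro ⟨z, σ, h, rfl⟩
    exact D.C_mem_dom h.1 h.2

/-- The flow map onto the swept part. -/
def toDom (p : Z × ℝ) : D.dom := ⟨D.orbit p.1 p.2, p, rfl⟩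

lemma toDom_isQuotientMap : IsQuotientMap D.toDom := by
  rw [isQuotientMap_iff_isClosed]
  refine ⟨fun ⟨p, q, hq⟩ => ⟨q, Subtype.ext hq⟩, fun W => ⟨fun hW => hW.preimage ?_, fun hW => ?_⟩⟩
  · exact D.orbit_continuous.subtype_mk _
  · have h1 : IsClosed {p : Z × ℝ | (-D.lo p.1 ≤ p.2 ∧ p.2 ≤ D.hi p.1) ∧
        D.C p.1 p.2 ∈ (Subtype.val '' W)} := by
      have e : {p : Z × ℝ | (-D.lo p.1 ≤ p.2 ∧ p.2 ≤ D.hi p.1) ∧ D.C p.1 p.2 ∈ (Subtype.val '' W)}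
          = {p : Z × ℝ | -D.lo p.1 ≤ p.2 ∧ p.2 ≤ D.hi p.1} ∩
            (fun p : Z × ℝ => (p.1, D.norm p.1 p.2)) ⁻¹' (D.toDom ⁻¹' W) := by
        ext ⟨z, σ⟩
        simp only [mem_ofPred_eq, mem_inter_iff, mem_preimage, toDom]
        refine and_congr_right fun h => ?_
        constructor
        · rintro ⟨w, hw, e⟩
          convert hw
          exact Subtype.ext ((D.orbit_norm h.1 h.2).trans e.symm)
        · intro hw
          exact ⟨_, hw, D.orbit_norm h.1 h.2⟩
      rw [e]
      exact ((isClosed_le (D.lo_cont.comp continuous_fst).neg continuous_snd).inter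
        (isClosed_le continuous_snd (D.hi_cont.comp continuous_fst))).inter
        (hW.preimage (continuous_fst.prodMk D.norm_cont))
    obtain ⟨V, hV, hVW⟩ := D.lift _ h1
    have : W = Subtype.val ⁻¹' V := by
      ext ⟨p, hp⟩
      obtain ⟨z, σ, h, rfl⟩ := D.mem_dom_iff.1 hp
      rw [mem_preimage, hVW z σ h.1 h.2]
      simp [hp]
    rw [this]
    exact hV.preimage continuous_subtype_val

end SuspensionChart

/-- Two suspension flows over the same base map, with the section points and the normalized times
matched. -/
theorem SuspensionChart.exists_homeomorph {Z : Type*} [TopologicalSpace Z] {f : Z ≃ₜ Z}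
    {M N : Type*} [TopologicalSpace M] [TopologicalSpace N]
    (D : SuspensionChart f M) (E : SuspensionChart f N) :
    ∃ x : D.dom ≃ₜ E.dom, ∀ p, x (D.toDom p) = E.toDom p := by
  have fib : ∀ p q : Z × ℝ, D.toDom p = D.toDom q ↔ E.toDom p = E.toDom q := by
    intro p q
    rw [Subtype.ext_iff, Subtype.ext_iff]
    exact D.orbit_eq_iff.trans E.orbit_eq_iff.symm
  have hD := D.toDom_isQuotientMap
  have hE := E.toDom_isQuotientMap
  have e1 : ∀ p, E.toDom (Function.surjInv hD.surjective (D.toDom p)) = E.toDom p := fun p =>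
    (fib _ _).1 (Function.surjInv_eq hD.surjective _)
  have e2 : ∀ p, D.toDom (Function.surjInv hE.surjective (E.toDom p)) = D.toDom p := fun p =>
    (fib _ _).2 (Function.surjInv_eq hE.surjective _)
  refine ⟨{ toFun := fun m => E.toDom (Function.surjInv hD.surjective m)
            invFun := fun m => D.toDom (Function.surjInv hE.surjective m)
            left_inv := ?_
            right_inv := ?_
            continuous_toFun := ?_
            continuous_invFun := ?_ }, e1⟩
  · intro m
    obtain ⟨p, rfl⟩ := hD.surjective m
    exact (congrArg _ (congrArg _ (e1 p))).trans (e2 p)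
  · intro m
    obtain ⟨p, rfl⟩ := hE.surjective m
    exact (congrArg _ (congrArg _ (e2 p))).trans (e1 p)
  · rw [hD.continuous_iff]
    exact hE.continuous.congr fun p => (e1 p).symm
  · rw [hE.continuous_iff]
    exact hD.continuous.congr fun p => (e2 p).symm

namespace SuspensionChart

variable {Z : Type*} [TopologicalSpace Z] {f : Z ≃ₜ Z} {M : Type*} [TopologicalSpace M]
  (D : SuspensionChart f M)

/-! ### The time along the trajectories of a suspension flow -/

/-- The time which the flow needs for the normalized time `s` along the trajectory of `z`. -/
def clock (z : Z) (s : ℝ) : ℝ := ∫ u in (0 : ℝ)..s, D.roof ((f ^ ⌊u⌋) z)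

lemma roof_intervalIntegrable (z : Z) (a b : ℝ) :
    IntervalIntegrable (fun u => D.roof ((f ^ ⌊u⌋) z)) MeasureTheory.volume a b := by
  have hm : Measurable fun u : ℝ => D.roof ((f ^ ⌊u⌋) z) :=
    (measurable_from_top (f := fun n : ℤ => D.roof ((f ^ n) z))).comp Int.measurable_floor
  refine (intervalIntegrable_const (c := (3 : ℝ))).mono_fun hm.aestronglyMeasurable ?_
  refine Eventually.of_forall fun u => ?_
  simp only [Real.norm_eq_abs]
  rw [abs_of_pos (D.roof_pos _)]
  exact (D.roof_le _).trans (le_abs_self 3)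

lemma clock_zero (z : Z) : D.clock z 0 = 0 := by simp [clock]

lemma clock_sub (z : Z) (s t : ℝ) :
    D.clock z t - D.clock z s = ∫ u in s..t, D.roof ((f ^ ⌊u⌋) z) :=
  intervalIntegral.integral_interval_sub_left (D.roof_intervalIntegrable z _ _)
    (D.roof_intervalIntegrable z _ _)

lemma clock_bounds (z : Z) {s t : ℝ} (h : s ≤ t) :
    t - s ≤ D.clock z t - D.clock z s ∧ D.clock z t - D.clock z s ≤ 3 * (t - s) := by
  rw [clock_sub]
  constructor
  · have := intervalIntegral.integral_mono_on h (intervalIntegrable_const (c := (1 : ℝ)))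
      (D.roof_intervalIntegrable z s t) fun u _ => D.one_le_roof _
    simpa using this
  · have := intervalIntegral.integral_mono_on h (D.roof_intervalIntegrable z s t)
      (intervalIntegrable_const (c := (3 : ℝ))) fun u _ => D.roof_le _
    simpa [mul_comm] using this

lemma clock_eq (z : Z) (n : ℤ) {s : ℝ} (h0 : n ≤ s) (h1 : s ≤ n + 1) :
    D.clock z s = D.clock z n + (s - n) * D.roof ((f ^ n) z) := by
  have : D.clock z s - D.clock z n = (s - n) * D.roof ((f ^ n) z) := by
    rw [clock_sub, intervalIntegral.integral_of_le h0,
      MeasureTheory.integral_Ioc_eq_integral_Ioo,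
      MeasureTheory.setIntegral_congr_fun (g := fun _ => D.roof ((f ^ n) z)) measurableSet_Ioo]
    · simp [h0]
    · intro u hu
      have : ⌊u⌋ = n := Int.floor_eq_iff.2 ⟨hu.1.le, hu.2.trans_le h1⟩
      simp [this]
  linarith

lemma clock_strictMono (z : Z) : StrictMono (D.clock z) := fun s t h => by
  have := (D.clock_bounds z h.le).1
  linarith

lemma abs_clock_sub (z : Z) (s t : ℝ) :
    |s - t| ≤ |D.clock z s - D.clock z t| ∧ |D.clock z s - D.clock z t| ≤ 3 * |s - t| := by
  rcases le_total s t with h | h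
  · have := D.clock_bounds z h
    rw [abs_sub_comm s t, abs_sub_comm (D.clock z s), abs_of_nonneg (sub_nonneg.2 h),
      abs_of_nonneg (by linarith)]
    exact this
  · have := D.clock_bounds z h
    rw [abs_of_nonneg (sub_nonneg.2 h), abs_of_nonneg (by linarith)]
    exact this

lemma clock_surjective (z : Z) : Function.Surjective (D.clock z) := by
  have hc : Continuous (D.clock z) := by
    refine (LipschitzWith.of_dist_le_mul (K := 3) fun s t => ?_).continuous
    rw [Real.dist_eq, Real.dist_eq]
    exact (D.abs_clock_sub z s t).2
  refine hc.surjective ?_ ?_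
  · refine tendsto_atTop_mono' _ ?_ tendsto_id
    filter_upwards [eventually_ge_atTop 0] with s hs
    have := (D.clock_bounds z hs).1
    rw [clock_zero] at this
    simpa using this
  · refine tendsto_atBot_mono' _ ?_ tendsto_id
    filter_upwards [eventually_le_atBot 0] with s hs
    have := (D.clock_bounds z hs).1
    rw [clock_zero] at this
    simp only [id]
    linarith

/-- The time along a trajectory as an increasing bijection. -/
def clockIso (z : Z) : ℝ ≃o ℝ :=
  (D.clock_strictMono z).orderIsoOfSurjective _ (D.clock_surjective z)

lemma clock_symm (z : Z) (t : ℝ) : D.clock z ((D.clockIso z).symm t) = t :=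
  (D.clockIso z).apply_symm_apply t

/-- The property `U` of curves singles out the trajectories of the suspension flow: every such curve
meets the section; after a visit to the section it follows the chart and comes to the section again,
at the first return time, and likewise backwards; conversely, a curve has the property if it follows
the chart for a short time before and after each moment. -/
structure Describes (U : (ℝ → M) → Prop) : Prop where
  start : ∀ γ, U γ → ∃ t₀ z, γ t₀ = D.C z 0
  step : ∀ γ t₀ z, U γ → γ t₀ = D.C z 0 →
    (∀ σ, -D.lo z ≤ σ → σ ≤ D.hi z → γ (t₀ + σ) = D.C z σ) ∧
    γ (t₀ + D.roof z) = D.C (f z) 0 ∧ γ (t₀ - D.roof (f.symm z)) = D.C (f.symm z) 0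
  build : ∀ γ : ℝ → M, (∀ t,
    (∃ z σ, ∃ ε > 0, -D.lo z ≤ σ ∧ σ + ε ≤ D.hi z ∧
      ∀ s ∈ Icc (0 : ℝ) ε, γ (t + s) = D.C z (σ + s)) ∧
    (∃ z σ, ∃ ε > 0, -D.lo z ≤ σ - ε ∧ σ ≤ D.hi z ∧
      ∀ s ∈ Icc (0 : ℝ) ε, γ (t - s) = D.C z (σ - s))) → U γ

variable {D}

lemma zpow_sub_one_apply (z : Z) (n : ℤ) : (f ^ (n - 1)) z = f.symm ((f ^ n) z) := by
  rw [sub_eq_neg_add, zpow_add, zpow_neg_one]; rfl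

/-- A curve with the property `U` is an orbit, up to the choice of the origin of time. -/
lemma Describes.eq_orbit {U : (ℝ → M) → Prop} (hU : D.Describes U) {γ : ℝ → M} (hγ : U γ) :
    ∃ z t₀, ∀ s, γ (t₀ + D.clock z s) = D.orbit z s := by
  obtain ⟨t₀, z, h0⟩ := hU.start γ hγ
  refine ⟨z, t₀, ?_⟩
  have hint : ∀ n : ℤ, γ (t₀ + D.clock z n) = D.C ((f ^ n) z) 0 := by
    intro n
    induction n with
    | zero => simpa [clock_zero] using h0
    | succ i ih =>
      have := (hU.step _ _ _ hγ ih).2.1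
      have e := D.clock_eq z i (s := (i : ℤ) + 1) (by linarith) (by linarith)
      push_cast at *
      rw [e, zpow_add_one_apply, ← this]
      congr 1; ring
    | pred i ih =>
      have := (hU.step _ _ _ hγ ih).2.2
      rw [← zpow_sub_one_apply] at this
      have e := D.clock_eq z (-(i : ℤ) - 1) (s := ((-i : ℤ) : ℝ)) (by push_cast; linarith)
        (by push_cast; linarith)
      rw [← this]
      congr 1
      rw [e]; push_cast; ring
  intro s
  have h1 := Int.floor_le s
  have h2 := (Int.lt_floor_add_one s).le
  rw [D.clock_eq z ⌊s⌋ h1 h2, D.orbit_eq_loop z ⌊s⌋ h1 h2]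
  set n := ⌊s⌋
  set y := (f ^ n) z with hy
  have hr := D.roof_pos y
  have b0 := D.lo_pos y
  have b1 := D.hi_pos (f y)
  have e : D.roof y = D.hi y + D.lo (f y) := rfl
  have a0 : 0 ≤ (s - n) * D.roof y := mul_nonneg (by linarith) hr.le
  have a1 : (s - n) * D.roof y ≤ D.roof y := by nlinarith
  rcases le_total ((s - n) * D.roof y) (D.hi y) with c | c
  · rw [D.loop_of_le c, ← add_assoc]
    exact (hU.step _ _ _ hγ (hint n)).1 _ (by linarith) c
  · have := (hU.step _ _ _ hγ (hU.step _ _ _ hγ (hint n)).2.1).1 ((s - n) * D.roof y - D.roof y)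
      (by linarith) (by linarith)
    rw [D.loop_of_ge c, ← this]
    congr 1; ring

/-- Conversely, the orbits have the property `U`. -/
lemma Describes.of_orbit {U : (ℝ → M) → Prop} (hU : D.Describes U) {γ : ℝ → M} {z : Z} {t₀ : ℝ}
    (h : ∀ s, γ (t₀ + D.clock z s) = D.orbit z s) : U γ := by
  have chart : ∀ (n : ℤ) σ, -D.lo ((f ^ n) z) ≤ σ → σ ≤ D.hi ((f ^ n) z) →
      γ (t₀ + D.clock z n + σ) = D.C ((f ^ n) z) σ := by
    intro n σ h0 h1
    rw [← D.orbit_norm h0 h1, ← D.orbit_add_int, ← h]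
    congr 1
    rw [add_assoc]; congr 1
    unfold norm
    set y := (f ^ n) z with hy
    have hr := D.roof_pos y
    have hr' := D.roof_pos (f.symm y)
    split_ifs with h3
    · rw [D.clock_eq z n (s := σ / D.roof y + n)]
      · rw [← hy]; field_simp; ring
      · linarith [div_nonneg h3 hr.le]
      · have : σ / D.roof y ≤ 1 := by rw [div_le_one hr]; linarith [D.hi_lt_roof y]
        linarith
    · push Not at h3
      have hro : D.roof (f.symm y) = D.hi (f.symm y) + D.lo y := by
        unfold roof; rw [Homeomorph.apply_symm_apply]
      have hh := D.hi_pos (f.symm y)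
      have e := D.clock_eq z (n - 1) (s := n) (by push_cast; linarith) (by push_cast; linarith)
      have e' := D.clock_eq z (n - 1) (s := σ / D.roof (f.symm y) + n) ?_ ?_
      · rw [e, e', zpow_sub_one_apply, ← hy]; push_cast; field_simp; ring
      · have : -1 ≤ σ / D.roof (f.symm y) := by rw [le_div_iff₀ hr']; linarith
        push_cast; linarith
      · have : σ / D.roof (f.symm y) ≤ 0 := div_nonpos_of_nonpos_of_nonneg h3.le hr'.le
        push_cast; linarith
  refine hU.build γ fun t => ?_
  obtain ⟨s, hs⟩ := D.clock_surjective z (t - t₀)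
  have h1 := Int.floor_le s
  have h2 := Int.lt_floor_add_one s
  have e := D.clock_eq z ⌊s⌋ h1 h2.le
  have e1 := D.clock_eq z ⌊s⌋ (s := ((⌊s⌋ + 1 : ℤ) : ℝ)) (by push_cast; linarith)
    (by push_cast; linarith)
  have c0 := chart ⌊s⌋
  have c1 := chart (⌊s⌋ + 1)
  rw [zpow_add_one_apply] at c1
  set n := ⌊s⌋
  set y := (f ^ n) z with hy
  have hr := D.roof_pos y
  have a0 : 0 ≤ (s - n) * D.roof y := mul_nonneg (by linarith) hr.le
  have a1 : (s - n) * D.roof y < D.roof y := by nlinarith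
  set u := (s - n) * D.roof y with hu
  have b0 := D.lo_pos y
  have b1 := D.hi_pos (f y)
  have er : D.roof y = D.hi y + D.lo (f y) := rfl
  push_cast at e1 c1
  constructor
  · rcases lt_or_ge u (D.hi y) with c | c
    · refine ⟨y, u, D.hi y - u, by linarith, by linarith, by linarith, fun v hv => ?_⟩
      rw [← c0 (u + v) (by linarith [hv.1]) (by linarith [hv.2])]
      congr 1; linarith
    · refine ⟨f y, u - D.roof y, D.roof y - u, by linarith, by linarith, by linarith,
        fun v hv => ?_⟩
      rw [← c1 (u - D.roof y + v) (by linarith [hv.1]) (by linarith [hv.2])]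
      congr 1; linarith
  · rcases le_or_gt u (D.hi y) with c | c
    · refine ⟨y, u, D.lo y, by linarith, by linarith, by linarith, fun v hv => ?_⟩
      rw [← c0 (u - v) (by linarith [hv.2]) (by linarith [hv.1])]
      congr 1; linarith
    · refine ⟨f y, u - D.roof y, u - D.hi y, by linarith, by linarith, by linarith,
        fun v hv => ?_⟩
      rw [← c1 (u - D.roof y - v) (by linarith [hv.2]) (by linarith [hv.1])]
      congr 1; linarith

end SuspensionChart

namespace SuspensionChart

variable {Z : Type*} [TopologicalSpace Z] {f : Z ≃ₜ Z} {M : Type*} [TopologicalSpace M]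
  {D : SuspensionChart f M} {N : Type*} [TopologicalSpace N] {E : SuspensionChart f N}
  {H : ℝ} {T : (ℝ → M) → Prop} {T' : (ℝ → N) → Prop}

/-! ### Comparison of two suspension flows over the same base map

The trajectories run in a time that is `H` times the time of the chart. -/

lemma Describes.exists_orbit (hH : 0 < H) (hD : D.Describes fun γ => T fun t => γ (t / H))
    {γ : ℝ → M} (hγ : T γ) : ∃ z t₀, ∀ s, γ (H * (t₀ + D.clock z s)) = D.orbit z s :=
  hD.eq_orbit (γ := fun σ => γ (H * σ)) (by
    have : (fun t => γ (H * (t / H))) = γ := by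
      funext t; congr 1; field_simp
    rwa [this])

lemma Describes.traj_of_orbit (hH : 0 < H) (hD : D.Describes fun γ => T fun t => γ (t / H))
    {γ : ℝ → M} {z : Z} {t₀ : ℝ} (h : ∀ s, γ (H * (t₀ + D.clock z s)) = D.orbit z s) : T γ := by
  have := hD.of_orbit (γ := fun σ => γ (H * σ)) h
  have e : (fun t => γ (H * (t / H))) = γ := by
    funext t; congr 1; field_simp
  rwa [e] at this

/-- The orbit of `z`, run through at the speed of the flow. -/
lemma Describes.traj_clock (hH : 0 < H) (hD : D.Describes fun γ => T fun t => γ (t / H))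
    (z : Z) (t₀ : ℝ) : T fun t => D.orbit z ((D.clockIso z).symm (t / H - t₀)) := by
  refine hD.traj_of_orbit hH (z := z) (t₀ := t₀) fun s => ?_
  congr 1
  rw [mul_div_cancel_left₀ _ hH.ne', add_sub_cancel_left]
  exact (D.clockIso z).symm_apply_apply s

/-- The swept part of `M` consists of the points whose trajectory is defined for all time. -/
lemma Describes.dom_eq (hH : 0 < H) (hD : D.Describes fun γ => T fun t => γ (t / H)) :
    {p | ∃ γ : ℝ → M, T γ ∧ γ 0 = p} = D.dom := by
  ext p
  constructor
  · rintro ⟨γ, hγ, rfl⟩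
    obtain ⟨z, t₀, h⟩ := hD.exists_orbit hH hγ
    obtain ⟨s, hs⟩ := D.clock_surjective z (-t₀)
    refine ⟨(z, s), ?_⟩
    rw [Function.uncurry_apply_pair, ← h, hs]
    simp
  · rintro ⟨⟨z, s⟩, rfl⟩
    refine ⟨_, hD.traj_clock hH z (-D.clock z s), ?_⟩
    simp only [zero_div, zero_sub, neg_neg, Function.uncurry_apply_pair]
    congr 1
    exact (D.clockIso z).symm_apply_apply s

lemma orbit_eq_orbit (D : SuspensionChart f M) (E : SuspensionChart f N) {z z' : Z} {s s' : ℝ}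
    (h : D.orbit z s = D.orbit z' s') : E.orbit z s = E.orbit z' s' :=
  E.orbit_eq_iff.2 (D.orbit_eq_iff.1 h)

/-- The distance along a trajectory grows at most by the factor `3`, since all return times lie
between `1` and `3`. -/
lemma orbitDist_le (hH : 0 < H) (hD : D.Describes fun γ => T fun t => γ (t / H))
    (hE : E.Describes fun γ => T' fun t => γ (t / H)) (z : Z) (s s' : ℝ) :
    orbitDist T' (E.orbit z s) (E.orbit z s') ≤ 3 * orbitDist T (D.orbit z s) (D.orbit z s') := by
  have hne : {r : ℝ | ∃ γ : ℝ → M, T γ ∧ ∃ t t' : ℝ, γ t = D.orbit z s ∧ γ t' = D.orbit z s' ∧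
      r = |t' - t|}.Nonempty := by
    refine ⟨_, _, hD.traj_clock hH z 0, H * D.clock z s, H * D.clock z s', ?_, ?_, rfl⟩
    all_goals
      rw [mul_div_cancel_left₀ _ hH.ne', sub_zero]
      congr 1
      exact (D.clockIso z).symm_apply_apply _
  rw [mul_comm, ← div_le_iff₀ (by norm_num)]
  refine le_csInf hne ?_
  rintro r ⟨γ, hγ, t, t', h1, h2, rfl⟩
  rw [div_le_iff₀ (by norm_num)]
  obtain ⟨z₁, t₁, h⟩ := hD.exists_orbit hH hγ
  obtain ⟨u, hu⟩ := D.clock_surjective z₁ (t / H - t₁)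
  obtain ⟨u', hu'⟩ := D.clock_surjective z₁ (t' / H - t₁)
  have e : t = H * (t₁ + D.clock z₁ u) := by rw [hu]; field_simp; ring
  have e' : t' = H * (t₁ + D.clock z₁ u') := by rw [hu']; field_simp; ring
  rw [e, h] at h1
  rw [e', h] at h2
  have b : H * |E.clock z₁ u - E.clock z₁ u'| ≤ |t' - t| * 3 := by
    have a1 := (E.abs_clock_sub z₁ u u').2
    have a2 := (D.abs_clock_sub z₁ u u').1
    have : |t' - t| = H * |D.clock z₁ u - D.clock z₁ u'| := by
      rw [e, e', ← mul_sub, abs_mul, abs_of_pos hH, abs_sub_comm]; congr 2; ring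
    rw [this]
    nlinarith
  refine le_trans (csInf_le ⟨0, ?_⟩ ⟨_, hE.traj_clock hH z₁ 0, H * E.clock z₁ u,
    H * E.clock z₁ u', ?_, ?_, rfl⟩) (le_trans (le_of_eq ?_) b)
  · rintro r ⟨_, _, _, _, _, _, rfl⟩
    exact abs_nonneg _
  · rw [← orbit_eq_orbit D E h1, mul_div_cancel_left₀ _ hH.ne', sub_zero]
    congr 1
    exact (E.clockIso z₁).symm_apply_apply _
  · rw [← orbit_eq_orbit D E h2, mul_div_cancel_left₀ _ hH.ne', sub_zero]
    congr 1
    exact (E.clockIso z₁).symm_apply_apply _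
  · rw [← mul_sub, abs_mul, abs_of_pos hH, abs_sub_comm]

/-- Suspension flows over the same base map, with return times between `1` and `3`, are orbit
equivalent by a homeomorphism that is `3`-bilipschitz along the trajectories. -/
theorem exists_orbit_equivalence (D : SuspensionChart f M) (E : SuspensionChart f N) (hH : 0 < H)
    (hD : D.Describes fun γ => T fun t => γ (t / H))
    (hE : E.Describes fun γ => T' fun t => γ (t / H))
    {A : Set M} {B : Set N} (hA : A = D.dom) (hB : B = E.dom) :
    ∃ x : A ≃ₜ B,
      (∀ (a : A) z s, (a : M) = D.orbit z s → (x a : N) = E.orbit z s) ∧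
      (∀ γ : ℝ → A, T (fun s => (γ s : M)) → ∃ γ' : ℝ → B, T' (fun t => (γ' t : N)) ∧
        ∃ φ : ℝ ≃o ℝ, ∀ s, x (γ s) = γ' (φ s)) ∧
      (∀ γ : ℝ → A, T (fun s => (γ s : M)) → ∀ s t : ℝ,
        (3 : ℝ)⁻¹ * orbitDist T (γ s : M) (γ t) ≤ orbitDist T' (x (γ s) : N) (x (γ t)) ∧
        orbitDist T' (x (γ s) : N) (x (γ t)) ≤ 3 * orbitDist T (γ s : M) (γ t)) := by
  subst hA hB
  obtain ⟨x, hx⟩ := D.exists_homeomorph E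
  have hx' : ∀ (a : D.dom) z s, (a : M) = D.orbit z s → (x a : N) = E.orbit z s := by
    intro a z s h
    have : a = D.toDom (z, s) := Subtype.ext h
    rw [this, hx]; rfl
  have param : ∀ γ : ℝ → D.dom, T (fun s => (γ s : M)) → ∃ z t₀, ∀ t,
      (γ t : M) = D.orbit z ((D.clockIso z).symm (t / H - t₀)) := by
    intro γ hγ
    obtain ⟨z, t₀, h⟩ := hD.exists_orbit hH hγ
    refine ⟨z, t₀, fun t => ?_⟩
    rw [← h, clock_symm]
    congr 2
    field_simp
    ring
  refine ⟨x, hx', ?_, ?_⟩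
  · intro γ hγ
    obtain ⟨z, t₀, h⟩ := param γ hγ
    refine ⟨fun t => ⟨E.orbit z ((E.clockIso z).symm (t / H - 0)), (z, _), rfl⟩,
      hE.traj_clock hH z 0, ?_⟩
    let a1 : ℝ ≃o ℝ := OrderIso.divRight₀ H hH
    let a2 : ℝ ≃o ℝ := OrderIso.addRight (-t₀)
    refine ⟨(((a1.trans a2).trans (D.clockIso z).symm).trans (E.clockIso z)).trans
      (OrderIso.mulLeft₀ H hH), fun s => ?_⟩
    apply Subtype.ext
    rw [hx' _ _ _ (h s)]
    have : ((((a1.trans a2).trans (D.clockIso z).symm).trans (E.clockIso z)).trans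
      (OrderIso.mulLeft₀ H hH)) s = H * E.clockIso z ((D.clockIso z).symm (s / H - t₀)) := rfl
    rw [this]
    simp only
    rw [mul_div_cancel_left₀ _ hH.ne', sub_zero, OrderIso.symm_apply_apply]
  · intro γ hγ s t
    obtain ⟨z, t₀, h⟩ := param γ hγ
    rw [hx' _ _ _ (h s), hx' _ _ _ (h t), h s, h t]
    refine ⟨?_, orbitDist_le hH hD hE _ _ _⟩
    have := orbitDist_le hH hE hD z ((D.clockIso z).symm (s / H - t₀))
      ((D.clockIso z).symm (t / H - t₀))
    rw [inv_mul_le_iff₀ (by norm_num)]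
    exact this

end SuspensionChart

/-! ### The base map -/

/-- The sign attached to a Boolean. Upper and lower halves of the tiles and the two directions of
time are treated together, with the sign `true ↦ 1`, `false ↦ -1`. -/
def sg (b : Bool) : ℝ := if b then 1 else -1

@[simp] lemma sg_true : sg true = 1 := rfl
@[simp] lemma sg_false : sg false = -1 := rfl

lemma sg_mul_self (b : Bool) : sg b * sg b = 1 := by cases b <;> simp
lemma sg_not (b : Bool) : sg (!b) = -sg b := by cases b <;> simp

/-- The range of the slopes `κ = (√3 / 2) cot θ`. -/
abbrev Slope : Type := Icc (-(1 / 2) : ℝ) (1 / 2)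

/-- The indices of the rhombi. -/
abbrev Idx : Type := Fin 3 × (ℤ × ℤ)

/-- The place on the short diagonal of the rhombus (the segment from `0` to `v₀`) from which the
trajectories run into the upper (`b = true`), respectively come from the lower (`b = false`),
vertex of the rhombus. -/
def bet (κ : Slope) (b : Bool) : ℝ := 1 / 2 - sg b * κ

lemma bet_nonneg (κ : Slope) (b : Bool) : 0 ≤ bet κ b := by
  have := κ.2.1; have := κ.2.2
  cases b <;> simp only [bet, sg_true, sg_false] <;> linarith

lemma bet_le_one (κ : Slope) (b : Bool) : bet κ b ≤ 1 := by
  have := κ.2.1; have := κ.2.2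
  cases b <;> simp only [bet, sg_true, sg_false] <;> linarith

lemma bet_not (κ : Slope) (b : Bool) : bet κ (!b) = 1 - bet κ b := by
  simp only [bet, sg_not]; ring

/-- The index of the rhombus glued to the edge of `Rⁱ_c` that starts at `c`, in its upper
(`b = true`) or lower half. -/
def nx (b : Bool) (k : Idx) : Idx :=
  ((if b then k.1 - 1 else k.1 + 1), k.2 - e (if b then k.1 - 1 else k.1 + 1))

/-- The index of the rhombus glued to the edge of `Rⁱ_c` that starts at the outward vertex
`c + vᵢ`, in its upper (`b = true`) or lower half. -/
def pv (b : Bool) (k : Idx) : Idx := ((if b then k.1 - 1 else k.1 + 1), k.2 + e k.1)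

@[simp] lemma nx_not_pv (b : Bool) (k : Idx) : nx (!b) (pv b k) = k := by
  obtain ⟨i, c⟩ := k
  cases b <;> simp [nx, pv]

@[simp] lemma pv_not_nx (b : Bool) (k : Idx) : pv (!b) (nx b k) = k := by
  obtain ⟨i, c⟩ := k
  cases b <;> simp [nx, pv]

lemma nx_injective (b : Bool) : Function.Injective (nx b) := fun k k' h => by
  rw [← pv_not_nx b k, h, pv_not_nx]

/-- The places on the short diagonal whose orbit under the rotation by `bet κ false` never meets an
endpoint: the trajectories through them avoid the vertices. -/
def Bset (κ : Slope) : Set ℝ :=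
  {a | 0 < a ∧ a < 1 ∧ ∀ n m : ℤ, a + n * bet κ true ≠ m}

/-- The section of the flows: a rhombus and a place on its short diagonal. -/
abbrev Sec (κ : Slope) : Type := Idx × Bset κ

lemma ne_bet {κ : Slope} {a : ℝ} (ha : a ∈ Bset κ) (b : Bool) : a ≠ bet κ b := by
  intro h
  cases b
  · have := bet_not κ true
    exact ha.2.2 1 1 (by push_cast; rw [h]; simp at this; linarith)
  · exact ha.2.2 (-1) 0 (by push_cast; rw [h]; ring)

/-- The return to the short diagonals, forwards or backwards in time: the rhombus. -/
def baseK (κ : Slope) (b : Bool) (k : Idx) (a : ℝ) : Idx := if a ≤ bet κ b then nx b k else pv b k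

/-- The return to the short diagonals, forwards or backwards in time: the place. -/
def baseA (κ : Slope) (b : Bool) (a : ℝ) : ℝ :=
  if a ≤ bet κ b then a + 1 - bet κ b else a - bet κ b

lemma baseA_mem_Ioo {κ : Slope} {b : Bool} {a : ℝ} (ha : a ∈ Ioo (0 : ℝ) 1) (h : a ≠ bet κ b) :
    baseA κ b a ∈ Ioo (0 : ℝ) 1 := by
  have h0 := bet_nonneg κ b
  have h1 := bet_le_one κ b
  unfold baseA
  split_ifs with h2
  · have := lt_of_le_of_ne h2 h
    constructor <;> linarith [ha.1]
  · push Not at h2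
    constructor <;> linarith [ha.2]

/-- The place after a return differs from the place before by an integer combination of the
rotation angle and `1`. -/
lemma baseA_eq (κ : Slope) (b : Bool) (a : ℝ) :
    ∃ m : ℤ, baseA κ b a = a - sg b * bet κ true + m := by
  have := bet_not κ true
  unfold baseA
  split_ifs with h <;> cases b <;> simp at *
  exacts [⟨0, by push_cast; linarith⟩, ⟨1, by push_cast; linarith⟩, ⟨-1, by push_cast; linarith⟩]

lemma baseA_mem {κ : Slope} {a : ℝ} (b : Bool) (ha : a ∈ Bset κ) : baseA κ b a ∈ Bset κ := by
  have h := baseA_mem_Ioo ⟨ha.1, ha.2.1⟩ (ne_bet ha b)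
  refine ⟨h.1, h.2, fun n m hnm => ?_⟩
  obtain ⟨m', hm'⟩ := baseA_eq κ b a
  rw [hm'] at hnm
  cases b
  · refine ha.2.2 (n + 1) (m - m') ?_
    push_cast; rw [sg_false] at hnm; linarith
  · refine ha.2.2 (n - 1) (m - m') ?_
    push_cast; rw [sg_true] at hnm; linarith

/-- The return map to the section, forwards (`b = true`) or backwards. -/
def baseMap (κ : Slope) (b : Bool) (z : Sec κ) : Sec κ :=
  (baseK κ b z.1 z.2, ⟨baseA κ b z.2, baseA_mem b z.2.2⟩)

lemma baseMap_not_baseMap (κ : Slope) (b : Bool) (z : Sec κ) :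
    baseMap κ (!b) (baseMap κ b z) = z := by
  obtain ⟨k, a, ha⟩ := z
  have hn := bet_not κ b
  have hne := ne_bet ha b
  have h0 := ha.1
  have h1 := ha.2.1
  by_cases h : a ≤ bet κ b
  · have h2 : ¬ (a + 1 - bet κ b ≤ bet κ (!b)) := by rw [hn]; linarith
    refine Prod.ext ?_ (Subtype.ext ?_)
    · simp [baseMap, baseK, baseA, h, h2]
    · simp only [baseMap, baseA, h, if_true, h2, if_false]; rw [hn]; ring
  · have h2 : a - bet κ b ≤ bet κ (!b) := by rw [hn]; linarith
    refine Prod.ext ?_ (Subtype.ext ?_)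
    · simp [baseMap, baseK, baseA, h, h2]
    · simp only [baseMap, baseA, h, if_true, h2, if_false]; rw [hn]; ring

/-- A function on the section which is given by two formulas to both sides of `bet κ b` is
continuous if the formulas are, since `bet κ b` is not in the section. -/
lemma continuous_ite_bet {κ : Slope} {Y : Type*} [TopologicalSpace Y] (b : Bool)
    {g h : Sec κ → Y} (hg : Continuous g) (hh : Continuous h) :
    Continuous fun z : Sec κ => if (z.2 : ℝ) ≤ bet κ b then g z else h z :=
  Continuous.if_le hg hh (continuous_subtype_val.comp continuous_snd) continuous_const
    fun z hz => (ne_bet z.2.2 b hz).elim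

lemma continuous_place (κ : Slope) : Continuous fun z : Sec κ => (z.2 : ℝ) :=
  continuous_subtype_val.comp continuous_snd

lemma baseMap_continuous (κ : Slope) (b : Bool) : Continuous (baseMap κ b) := by
  have hk : ∀ g : Idx → Idx, Continuous fun z : Sec κ => g z.1 := fun g =>
    continuous_of_discreteTopology.comp continuous_fst
  refine Continuous.prodMk ?_ (Continuous.subtype_mk ?_ _)
  · exact continuous_ite_bet b (hk _) (hk _)
  · exact continuous_ite_bet b (((continuous_place κ).add continuous_const).sub continuous_const)
      ((continuous_place κ).sub continuous_const)

/-- The first return map to the section. -/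
def returnMap (κ : Slope) : Sec κ ≃ₜ Sec κ where
  toFun := baseMap κ true
  invFun := baseMap κ false
  left_inv := baseMap_not_baseMap κ true
  right_inv := baseMap_not_baseMap κ false
  continuous_toFun := baseMap_continuous κ true
  continuous_invFun := baseMap_continuous κ false

/-- The height, in units of `√3 / 2`, at which the trajectory through the place `a` of the short diagonal
meets the boundary of the rhombus, upwards (`b = true`) or downwards. -/
def tau (κ : Slope) (b : Bool) (a : ℝ) : ℝ :=
  if a ≤ bet κ b then a / bet κ b else (1 - a) / (1 - bet κ b)

lemma tau_of_le {κ : Slope} {b : Bool} {a : ℝ} (h : a ≤ bet κ b) : tau κ b a = a / bet κ b :=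
  if_pos h

lemma tau_of_gt {κ : Slope} {b : Bool} {a : ℝ} (h : bet κ b < a) :
    tau κ b a = (1 - a) / (1 - bet κ b) := if_neg (not_le.2 h)

lemma tau_pos {κ : Slope} {b : Bool} {a : ℝ} (ha : a ∈ Ioo (0 : ℝ) 1) : 0 < tau κ b a := by
  rcases le_or_gt a (bet κ b) with h | h
  · rw [tau_of_le h]; exact div_pos ha.1 (ha.1.trans_le h)
  · rw [tau_of_gt h]; exact div_pos (by linarith [ha.2]) (by linarith [ha.2])

lemma tau_le_one {κ : Slope} {b : Bool} (a : ℝ) : tau κ b a ≤ 1 := by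
  rcases le_or_gt a (bet κ b) with h | h
  · rw [tau_of_le h]; exact div_le_one_of_le₀ h (bet_nonneg κ b)
  · rw [tau_of_gt h]; exact div_le_one_of_le₀ (by linarith) (by linarith [bet_le_one κ b])

lemma tau_lt_one {κ : Slope} {b : Bool} {a : ℝ} (ha : a ∈ Ioo (0 : ℝ) 1) (hne : a ≠ bet κ b) :
    tau κ b a < 1 := by
  rcases le_or_gt a (bet κ b) with h | h
  · rw [tau_of_le h, div_lt_one (ha.1.trans_le h)]; exact lt_of_le_of_ne h hne
  · rw [tau_of_gt h, div_lt_one (by linarith [ha.2])]; linarith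

lemma le_tau_iff {κ : Slope} {b : Bool} {a s : ℝ} (ha : a ∈ Ioo (0 : ℝ) 1) (h1 : s ≤ 1) :
    s ≤ tau κ b a ↔ s * bet κ b ≤ a ∧ a + s * (1 - bet κ b) ≤ 1 := by
  have e0 := bet_nonneg κ b
  have e1 := bet_le_one κ b
  rcases le_or_gt a (bet κ b) with h | h
  · have hp : 0 < bet κ b := ha.1.trans_le h
    rw [tau_of_le h, le_div_iff₀ hp]
    refine ⟨fun hs => ⟨hs, ?_⟩, fun hs => hs.1⟩
    have : (a + s * (1 - bet κ b)) * bet κ b ≤ 1 * bet κ b := by nlinarith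
    exact le_of_mul_le_mul_right this hp
  · have hp : 0 < 1 - bet κ b := by linarith [ha.2]
    rw [tau_of_gt h, le_div_iff₀ hp]
    refine ⟨fun hs => ⟨by nlinarith, by linarith⟩, fun hs => by linarith [hs.2]⟩

lemma lt_tau_iff {κ : Slope} {b : Bool} {a s : ℝ} (ha : a ∈ Ioo (0 : ℝ) 1) (h1 : s ≤ 1) :
    s < tau κ b a ↔ s * bet κ b < a ∧ a + s * (1 - bet κ b) < 1 := by
  have e0 := bet_nonneg κ b
  have e1 := bet_le_one κ b
  rcases le_or_gt a (bet κ b) with h | h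
  · have hp : 0 < bet κ b := ha.1.trans_le h
    rw [tau_of_le h, lt_div_iff₀ hp]
    refine ⟨fun hs => ⟨hs, ?_⟩, fun hs => hs.1⟩
    have : (a + s * (1 - bet κ b)) * bet κ b < 1 * bet κ b := by
      rcases e1.lt_or_eq with e1 | e1
      · nlinarith
      · rw [e1] at *; nlinarith [ha.2]
    exact lt_of_mul_lt_mul_right this hp.le
  · have hp : 0 < 1 - bet κ b := by linarith [ha.2]
    rw [tau_of_gt h, lt_div_iff₀ hp]
    refine ⟨fun hs => ⟨by nlinarith, by linarith⟩, fun hs => by linarith [hs.2]⟩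

lemma tau_baseA {κ : Slope} {b : Bool} {a : ℝ} (ha : a ∈ Ioo (0 : ℝ) 1) (hne : a ≠ bet κ b) :
    tau κ (!b) (baseA κ b a) = 1 - tau κ b a := by
  have hn := bet_not κ b
  have e0 := bet_nonneg κ b
  have e1 := bet_le_one κ b
  have := ha.1
  have := ha.2
  rcases le_or_gt a (bet κ b) with h | h
  · have hlt := lt_of_le_of_ne h hne
    rw [tau_of_le h, baseA, if_pos h, tau_of_gt (by rw [hn]; linarith), hn]
    have : bet κ b ≠ 0 := by linarith
    have e : (1 - (1 - bet κ b)) = bet κ b := by ring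
    rw [e]
    field_simp
    ring
  · rw [tau_of_gt h, baseA, if_neg (not_le.2 h), tau_of_le (by rw [hn]; linarith), hn]
    have : 1 - bet κ b ≠ 0 := by linarith
    field_simp
    ring

lemma tau_continuous (κ : Slope) (b : Bool) : Continuous fun z : Sec κ => tau κ b z.2 :=
  continuous_ite_bet b ((continuous_place κ).div_const _)
    ((continuous_const.sub (continuous_place κ)).div_const _)

/-! ### Coordinates in the plane -/

/-- Coordinates in which the vectors `vᵢ` are rational: the second coordinate is the height in units of
`√3 / 2`. -/
def pt (x y : ℝ) : ℂ := ⟨x, y * (√3 / 2)⟩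

@[simp] lemma pt_re (x y : ℝ) : (pt x y).re = x := rfl
@[simp] lemma pt_im (x y : ℝ) : (pt x y).im = y * (√3 / 2) := rfl

lemma half_sqrt_pos : 0 < √3 / 2 := by positivity

lemma half_sqrt_sq : (√3 / 2) * (√3 / 2) = 3 / 4 := by
  have : √3 * √3 = 3 := Real.mul_self_sqrt (by norm_num)
  linarith

lemma pt_inj {x y x' y' : ℝ} : pt x y = pt x' y' ↔ x = x' ∧ y = y' := by
  constructor
  · intro h
    exact ⟨congrArg Complex.re h, mul_right_cancel₀ half_sqrt_pos.ne' (congrArg Complex.im h)⟩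
  · rintro ⟨rfl, rfl⟩; rfl

lemma exists_pt (z : ℂ) : ∃ x y, z = pt x y :=
  ⟨z.re, z.im / (√3 / 2), Complex.ext rfl (by simp)⟩

lemma pt_add (x y x' y' : ℝ) : pt x y + pt x' y' = pt (x + x') (y + y') :=
  Complex.ext rfl (by simp; ring)

lemma pt_sub (x y x' y' : ℝ) : pt x y - pt x' y' = pt (x - x') (y - y') :=
  Complex.ext rfl (by simp; ring)

lemma pt_neg (x y : ℝ) : -pt x y = pt (-x) (-y) :=
  Complex.ext rfl (by simp)

lemma pt_smul (t x y : ℝ) : t • pt x y = pt (t * x) (t * y) :=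
  Complex.ext (by simp) (by simp; ring)

lemma ofReal_mul_pt (t x y : ℝ) : (t : ℂ) * pt x y = pt (t * x) (t * y) :=
  Complex.ext (by simp) (by simp; ring)

lemma pt_mul (x y x' y' : ℝ) :
    pt x y * pt x' y' = pt (x * x' - 3 / 4 * (y * y')) (x * y' + y * x') := by
  have := half_sqrt_sq
  refine Complex.ext ?_ ?_
  · simp only [Complex.mul_re, pt_re, pt_im]
    linear_combination (-(y * y')) * this
  · simp only [Complex.mul_im, pt_re, pt_im]; ring

lemma pt_conj (x y : ℝ) : (starRingEnd ℂ) (pt x y) = pt x (-y) :=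
  Complex.ext (by simp) (by simp)

lemma zero_eq_pt : (0 : ℂ) = pt 0 0 := Complex.ext rfl (by simp)

lemma v_zero : v 0 = pt 1 0 := Complex.ext rfl (by simp [v])

lemma v_one : v 1 = pt (-(1 / 2)) 1 :=
  Complex.ext (by simp [v]; norm_num) (by simp [v])

lemma v_two : v 2 = pt (-(1 / 2)) (-1) :=
  Complex.ext (by simp [v]; norm_num) (by simp [v])

lemma continuous_pt : Continuous fun p : ℝ × ℝ => pt p.1 p.2 := by
  have : (fun p : ℝ × ℝ => pt p.1 p.2) =
      fun p : ℝ × ℝ => (p.1 : ℂ) + ((p.2 * (√3 / 2) : ℝ) : ℂ) * Complex.I := by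
    funext p
    exact Complex.ext (by simp) (by simp)
  rw [this]
  fun_prop

/-! ### Convex polygons in coordinates -/

/-- The half plane `p x + q y ≤ r` in the coordinates of `pt`. -/
def halfPlane (p q r : ℝ) : Set ℂ := {z | p * z.re + q * (z.im / (√3 / 2)) ≤ r}

@[simp] lemma pt_mem_halfPlane {p q r x y : ℝ} : pt x y ∈ halfPlane p q r ↔ p * x + q * y ≤ r := by
  have := half_sqrt_pos.ne'
  show p * x + q * (y * (√3 / 2) / (√3 / 2)) ≤ r ↔ _
  rw [mul_div_cancel_right₀ _ this]

lemma convex_halfPlane (p q r : ℝ) : Convex ℝ (halfPlane p q r) := by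
  refine convex_halfSpace_le (f := fun z : ℂ => p * z.re + q * (z.im / (√3 / 2))) ⟨?_, ?_⟩ r
  · intro z w; simp; ring
  · intro c z; simp; ring

lemma Convex.combo3 {s : Set ℂ} (hs : Convex ℝ s) {p q r : ℂ} (hp : p ∈ s) (hq : q ∈ s)
    (hr : r ∈ s) {a b c : ℝ} (ha : 0 ≤ a) (hb : 0 ≤ b) (hc : 0 ≤ c) (h : a + b + c = 1) :
    a • p + b • q + c • r ∈ s := by
  have := hs.sum_mem (t := Finset.univ) (w := ![a, b, c]) (z := ![p, q, r])
    (by intro i _; fin_cases i <;> simpa) (by simpa [Fin.sum_univ_three] using h)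
    (by intro i _; fin_cases i <;> simpa)
  simpa [Fin.sum_univ_three] using this

/-- The coordinate `a` of a point of the plane: the projection along the flow to the line of the
short diagonal. -/
def place (κ : Slope) (w : ℂ) : ℝ := w.re - κ * (w.im / (√3 / 2))

/-- The height of a point of the plane, in units of `√3 / 2`. -/
def height (w : ℂ) : ℝ := w.im / (√3 / 2)

/-- The point at height `σ` of the line through the place `a`, in the direction of the flow. -/
def ray (κ : Slope) (a σ : ℝ) : ℂ := pt (a + κ * σ) σ

@[simp] lemma height_pt (x y : ℝ) : height (pt x y) = y := by
  have := half_sqrt_pos.ne'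
  simp only [height, pt_im]; rw [mul_div_cancel_right₀ _ this]

@[simp] lemma place_pt (κ : Slope) (x y : ℝ) : place κ (pt x y) = x - κ * y := by
  have := half_sqrt_pos.ne'
  simp only [place, pt_im, pt_re]; rw [mul_div_cancel_right₀ _ this]

lemma ray_place_height (κ : Slope) (w : ℂ) : ray κ (place κ w) (height w) = w := by
  obtain ⟨x, y, rfl⟩ := exists_pt w
  simp [ray]

lemma ray_inj {κ : Slope} {a a' σ σ' : ℝ} : ray κ a σ = ray κ a' σ' ↔ a = a' ∧ σ = σ' := by
  rw [ray, ray, pt_inj]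
  constructor
  · rintro ⟨h, rfl⟩; exact ⟨by linarith, rfl⟩
  · rintro ⟨rfl, rfl⟩; exact ⟨rfl, rfl⟩

lemma place_continuous (κ : Slope) : Continuous (place κ) := by
  unfold place; fun_prop

lemma height_continuous : Continuous height := by
  unfold height; fun_prop

lemma ray_continuous (κ : Slope) : Continuous fun p : ℝ × ℝ => ray κ p.1 p.2 :=
  continuous_pt.comp (f := fun p : ℝ × ℝ => (p.1 + κ * p.2, p.2)) (by fun_prop)

lemma exists_sg (y : ℝ) : ∃ b s, 0 ≤ s ∧ y = sg b * s := by
  rcases le_total 0 y with h | h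
  · exact ⟨true, y, h, by simp⟩
  · exact ⟨false, -y, by linarith, by simp⟩

/-! ### The rhombus -/

lemma mem_convexHull_rhombus {b : Bool} {x s : ℝ} (hs : 0 ≤ s) :
    pt x (sg b * s) ∈ convexHull ℝ {0, -v 1, v 0, -v 2} ↔ s / 2 ≤ x ∧ x ≤ 1 - s / 2 := by
  rw [v_zero, v_one, v_two, zero_eq_pt, pt_neg, pt_neg]
  constructor
  · intro h
    have key : ∀ p q r : ℝ, 0 ≤ r → p * (1 / 2) - q ≤ r → p ≤ r → p * (1 / 2) + q ≤ r →
        p * x + q * (sg b * s) ≤ r := by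
      intro p q r h1 h2 h3 h4
      rw [← pt_mem_halfPlane]
      refine convexHull_min ?_ (convex_halfPlane p q r) h
      rintro z (rfl | rfl | rfl | rfl) <;> rw [pt_mem_halfPlane] <;> linarith
    have h1 := key (-2) (sg b) 0 le_rfl (by cases b <;> norm_num) (by norm_num)
      (by cases b <;> norm_num)
    have h2 := key 2 (sg b) 2 (by norm_num) (by cases b <;> norm_num) (by norm_num)
      (by cases b <;> norm_num)
    rw [← mul_assoc, sg_mul_self] at h1 h2
    constructor <;> linarith
  · rintro ⟨h1, h2⟩
    set S : Set ℂ := {pt 0 0, pt (- -(1 / 2)) (-1), pt 1 0, pt (- -(1 / 2)) (- -1)} with hS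
    have hc := convex_convexHull ℝ S
    have m := subset_convexHull ℝ S
    have m1 : pt (1 / 2) (sg b) ∈ S := by cases b <;> simp [hS, pt_inj]
    have := Convex.combo3 hc (m (show pt 0 0 ∈ S by simp [hS])) (m (show pt 1 0 ∈ S by simp [hS]))
      (m m1) (a := 1 - x - s / 2) (b := x - s / 2) (c := s) (by linarith) (by linarith) hs
      (by ring)
    convert this using 1
    rw [pt_smul, pt_smul, pt_smul, pt_add, pt_add, pt_inj]
    constructor <;> ring

lemma mem_rhombus {b : Bool} {x s : ℝ} (hs : 0 ≤ s) :
    pt x (sg b * s) ∈ rhombus ↔ (s / 2 ≤ x ∧ x ≤ 1 - s / 2) ∧ 0 < x ∧ x < 1 ∧ s < 1 := by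
  rw [rhombus, Set.mem_sdiff, mem_convexHull_rhombus hs]
  refine and_congr_right fun h => ?_
  simp only [v_zero, v_one, v_two, zero_eq_pt, pt_neg, mem_insert_iff, mem_singleton_iff, pt_inj,
    not_or]
  constructor
  · rintro ⟨h1, h2, h3, h4⟩
    have hs1 : s < 1 := by
      rcases lt_or_ge s 1 with h5 | h5
      · exact h5
      · exfalso
        have e1 : s = 1 := by linarith
        have e2 : x = 1 / 2 := by linarith
        cases b
        · exact h2 ⟨by linarith, by simp [e1]⟩
        · exact h4 ⟨by linarith, by simp [e1]⟩
    refine ⟨lt_of_not_ge fun hx => h1 ?_, lt_of_not_ge fun hx => h3 ?_, hs1⟩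
    · have : s = 0 := by linarith
      exact ⟨by linarith, by simp [this]⟩
    · have : s = 0 := by linarith
      exact ⟨by linarith, by simp [this]⟩
  · rintro ⟨h1, h2, h3⟩
    refine ⟨fun h => by linarith, fun h => ?_, fun h => by linarith, fun h => ?_⟩ <;>
    · cases b <;> simp at h <;> linarith [h.2]

/-- The line through an inner place of the short diagonal meets the rhombus in the heights
between `-tau κ false a` and `tau κ true a`. -/
lemma ray_mem_rhombus {κ : Slope} {b : Bool} {a s : ℝ} (ha : a ∈ Ioo (0 : ℝ) 1) (hs : 0 ≤ s) :
    ray κ a (sg b * s) ∈ rhombus ↔ s ≤ tau κ b a ∧ s < 1 := by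
  rw [ray, mem_rhombus hs]
  have hk : (κ : ℝ) * (sg b * s) = s / 2 - s * bet κ b := by simp only [bet]; ring
  rw [hk]
  constructor
  · rintro ⟨⟨h1, h2⟩, h3, h4, h5⟩
    exact ⟨(le_tau_iff ha h5.le).2 ⟨by linarith, by linarith⟩, h5⟩
  · rintro ⟨h1, h2⟩
    obtain ⟨h3, h4⟩ := (le_tau_iff ha h2.le).1 h1
    refine ⟨⟨by linarith, by linarith⟩, ?_, ?_, h2⟩
    · rcases hs.lt_or_eq with h | h
      · linarith
      · rw [← h]; linarith [ha.1]
    · rcases hs.lt_or_eq with h | h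
      · linarith
      · rw [← h]; linarith [ha.2]

/-! ### The gluing of the rhombi -/

/-- The point at height `s` of the edge that starts at the vertex `0` of the rhombus, in the upper
(`b = true`) or lower half. -/
def leftPt (b : Bool) (s : ℝ) : ℂ := pt (s / 2) (sg b * s)

/-- The point to which `leftPt b s` is glued. -/
def rightPt (b : Bool) (s : ℝ) : ℂ := pt (s / 2 + 1 / 2) (sg b * (s - 1))

lemma rightPt_eq (b : Bool) (s : ℝ) : rightPt b s = pt (s / 2 + 1 / 2) (sg (!b) * (1 - s)) := by
  rw [rightPt, sg_not]; congr 1; ring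

lemma leftPt_mem {b : Bool} {s : ℝ} (hs : s ∈ Ioo (0 : ℝ) 1) : leftPt b s ∈ rhombus := by
  rw [leftPt, mem_rhombus hs.1.le]
  have := hs.1; have := hs.2
  refine ⟨⟨?_, ?_⟩, ?_, ?_, ?_⟩ <;> linarith

lemma rightPt_mem {b : Bool} {s : ℝ} (hs : s ∈ Ioo (0 : ℝ) 1) : rightPt b s ∈ rhombus := by
  have := hs.1; have := hs.2
  rw [rightPt_eq, mem_rhombus (by linarith)]
  refine ⟨⟨?_, ?_⟩, ?_, ?_, ?_⟩ <;> linarith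

/-- The pair `(p, q)` consists of a point of an edge starting at the vertex `0` of its rhombus and of
the point glued to it. -/
def LeftRight (p q : Idx × ℂ) : Prop :=
  ∃ b, ∃ s ∈ Ioo (0 : ℝ) 1, p.2 = leftPt b s ∧ q.1 = nx b p.1 ∧ q.2 = rightPt b s

lemma mem_openSegment_pt {x y x' y' : ℝ} {z : ℂ} : z ∈ openSegment ℝ (pt x y) (pt x' y') ↔
    ∃ t ∈ Ioo (0 : ℝ) 1, z = pt (x + t * (x' - x)) (y + t * (y' - y)) := by
  rw [openSegment_eq_image', mem_image]
  refine exists_congr fun t => and_congr_right fun _ => ?_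
  rw [pt_sub, pt_smul, pt_add, eq_comm]

lemma glueS_or_iff {p q : PreS} :
    GlueS p q ∨ GlueS q p ↔ LeftRight p.1 q.1 ∨ LeftRight q.1 p.1 := by
  have h1 : ∀ p q : PreS, GlueS p q → LeftRight p.1 q.1 ∨ LeftRight q.1 p.1 := by
    rintro p q (⟨hp, hi, hw⟩ | ⟨hp, hi, hw⟩)
    · left
      rw [v_one, pt_neg, zero_eq_pt, mem_openSegment_pt] at hp
      obtain ⟨t, ht, e⟩ := hp
      refine ⟨false, t, ht, ?_, hi, ?_⟩
      · rw [e, leftPt, pt_inj]; constructor <;> simp; ring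
      · rw [hw, e, v_two, pt_sub, rightPt, pt_inj]; constructor <;> simp <;> ring
    · right
      rw [v_one, pt_neg, v_zero, mem_openSegment_pt] at hp
      obtain ⟨t, ht, e⟩ := hp
      refine ⟨true, t, ht, ?_, ?_, ?_⟩
      · rw [hw, e, v_one, pt_add, leftPt, pt_inj]
        constructor <;> simp
        ring
      · have : q.1.1 = pv false p.1.1 := hi
        rw [this]; exact (nx_not_pv false _).symm
      · rw [e, rightPt, pt_inj]; constructor <;> simp <;> ring
  have h2 : ∀ p q : PreS, LeftRight p.1 q.1 → GlueS p q ∨ GlueS q p := by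
    rintro p q ⟨b, t, ht, e1, e2, e3⟩
    cases b
    · refine Or.inl (GlueS.edge13 _ _ ?_ e2 ?_)
      · rw [v_one, pt_neg, zero_eq_pt, mem_openSegment_pt]
        refine ⟨t, ht, ?_⟩
        rw [e1, leftPt, pt_inj]; constructor <;> simp; ring
      · rw [e1, e3, v_two, leftPt, pt_sub, rightPt, pt_inj]; constructor <;> simp; ring
    · refine Or.inr (GlueS.edge24 _ _ ?_ ?_ ?_)
      · rw [v_one, pt_neg, v_zero, mem_openSegment_pt]
        refine ⟨t, ht, ?_⟩
        rw [e3, rightPt, pt_inj]; constructor <;> simp <;> ring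
      · rw [e2]; exact (pv_not_nx true _).symm
      · rw [e1, e3, v_one, leftPt, rightPt, pt_add, pt_inj]; constructor <;> simp
  constructor
  · rintro (h | h)
    exacts [h1 p q h, (h1 q p h).symm]
  · rintro (h | h)
    exacts [h2 p q h, (h2 q p h).symm]

lemma leftPt_inj {b b' : Bool} {s s' : ℝ} (hs : 0 < s) (hs' : 0 < s')
    (h : leftPt b s = leftPt b' s') : b = b' ∧ s = s' := by
  rw [leftPt, leftPt, pt_inj] at h
  have e : s = s' := by linarith [h.1]
  refine ⟨?_, e⟩
  have h2 := h.2
  cases b <;> cases b' <;> simp at h2 ⊢ <;> linarith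

lemma rightPt_inj {b b' : Bool} {s s' : ℝ} (hs : s < 1) (hs' : s' < 1)
    (h : rightPt b s = rightPt b' s') : b = b' ∧ s = s' := by
  rw [rightPt, rightPt, pt_inj] at h
  have e : s = s' := by linarith [h.1]
  refine ⟨?_, e⟩
  have h2 := h.2
  cases b <;> cases b' <;> simp at h2 ⊢ <;> linarith

lemma leftPt_ne_rightPt {b b' : Bool} {s s' : ℝ} (hs : s ∈ Ioo (0 : ℝ) 1)
    (hs' : s' ∈ Ioo (0 : ℝ) 1) : leftPt b s ≠ rightPt b' s' := by
  intro h
  rw [leftPt, rightPt, pt_inj] at h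
  have := hs.1; have := hs.2; have := hs'.1; have := hs'.2
  have h2 := h.2
  have h1 := h.1
  cases b <;> cases b' <;> simp at h2 <;> linarith

lemma glueS_matching (p q q' : PreS) (h : GlueS p q ∨ GlueS q p) (h' : GlueS p q' ∨ GlueS q' p) :
    q = q' := by
  rw [glueS_or_iff] at h h'
  apply Subtype.ext
  rcases h with ⟨b, s, hs, e1, e2, e3⟩ | ⟨b, s, hs, e1, e2, e3⟩ <;>
    rcases h' with ⟨b', s', hs', e1', e2', e3'⟩ | ⟨b', s', hs', e1', e2', e3'⟩
  · obtain ⟨rfl, rfl⟩ := leftPt_inj hs.1 hs'.1 (e1.symm.trans e1')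
    exact Prod.ext (e2.trans e2'.symm) (e3.trans e3'.symm)
  · exact (leftPt_ne_rightPt hs hs' (e1.symm.trans e3')).elim
  · exact (leftPt_ne_rightPt hs' hs (e1'.symm.trans e3)).elim
  · obtain ⟨rfl, rfl⟩ := rightPt_inj hs.2 hs'.2 (e3.symm.trans e3')
    exact Prod.ext (nx_injective b (e2.symm.trans e2')) (e1.trans e1'.symm)

instance : Nonempty S := ⟨Quot.mk _ ⟨((0, 0), leftPt true (1 / 2)), leftPt_mem (by norm_num)⟩⟩

/-- The point of `S` with coordinate `w` in the rhombus `k`; a junk value if `w` is not in the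
rhombus. -/
def mkS (k : Idx) (w : ℂ) : S :=
  open Classical in if h : w ∈ rhombus then Quot.mk GlueS ⟨(k, w), h⟩ else Classical.arbitrary S

lemma mkS_of_mem {k : Idx} {w : ℂ} (h : w ∈ rhombus) : mkS k w = Quot.mk GlueS ⟨(k, w), h⟩ :=
  dif_pos h

lemma mkS_eq_iff {k k' : Idx} {w w' : ℂ} (h : w ∈ rhombus) (h' : w' ∈ rhombus) :
    mkS k w = mkS k' w' ↔
      (k = k' ∧ w = w') ∨ LeftRight (k, w) (k', w') ∨ LeftRight (k', w') (k, w) := by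
  rw [mkS_of_mem h, mkS_of_mem h', quot_mk_eq_iff glueS_matching, glueS_or_iff]
  simp [Prod.ext_iff]

lemma mkS_continuousOn : ContinuousOn (fun p : Idx × ℂ => mkS p.1 p.2) {p | p.2 ∈ rhombus} := by
  rw [continuousOn_iff_continuous_domRestrict]
  have : Continuous fun p : PreS => (Quot.mk GlueS p : S) := continuous_quot_mk
  exact this.congr fun p => (mkS_of_mem p.2).symm

/-! ### The straight-line flow as a suspension flow -/

lemma ray_exit {κ : Slope} {b : Bool} {a : ℝ} (ha : a ∈ Ioo (0 : ℝ) 1) :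
    (a ≤ bet κ b ∧ ray κ a (sg b * tau κ b a) = leftPt b (tau κ b a) ∧
      ray κ (baseA κ b a) (sg b * (tau κ b a - 1)) = rightPt b (tau κ b a)) ∨
    (¬ a ≤ bet κ b ∧ ray κ a (sg b * tau κ b a) = rightPt (!b) (1 - tau κ b a) ∧
      ray κ (baseA κ b a) (sg b * (tau κ b a - 1)) = leftPt (!b) (1 - tau κ b a)) := by
  have hk : (κ : ℝ) * sg b = 1 / 2 - bet κ b := by simp only [bet]; ring
  have e0 := bet_nonneg κ b
  have := ha.1
  have := ha.2
  by_cases h : a ≤ bet κ b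
  · left
    have hb : 0 < bet κ b := by linarith
    have ht : tau κ b a * bet κ b = a := by rw [tau_of_le h]; field_simp
    refine ⟨h, ?_, ?_⟩
    · rw [ray, leftPt, pt_inj]
      exact ⟨by linear_combination (tau κ b a) * hk - ht, rfl⟩
    · rw [ray, rightPt, pt_inj, baseA, if_pos h]
      exact ⟨by linear_combination (tau κ b a - 1) * hk - ht, rfl⟩
  · right
    have h' := not_le.1 h
    have hb : 0 < 1 - bet κ b := by linarith
    have ht : tau κ b a * (1 - bet κ b) = 1 - a := by rw [tau_of_gt h']; field_simp
    refine ⟨h, ?_, ?_⟩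
    · rw [ray, rightPt, pt_inj, sg_not]
      exact ⟨by linear_combination (tau κ b a) * hk + ht, by ring⟩
    · rw [ray, leftPt, pt_inj, baseA, if_neg h, sg_not]
      exact ⟨by linear_combination (tau κ b a - 1) * hk + ht, by ring⟩

lemma ray_exit_mem {κ : Slope} {b : Bool} {a : ℝ} (ha : a ∈ Ioo (0 : ℝ) 1) (hne : a ≠ bet κ b) :
    ray κ a (sg b * tau κ b a) ∈ rhombus ∧
      ray κ (baseA κ b a) (sg b * (tau κ b a - 1)) ∈ rhombus := by
  have h0 := tau_pos (b := b) (κ := κ) ha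
  have h1 := tau_lt_one ha hne
  rcases ray_exit ha with ⟨-, e1, e2⟩ | ⟨-, e1, e2⟩ <;> rw [e1, e2]
  · exact ⟨leftPt_mem ⟨h0, h1⟩, rightPt_mem ⟨h0, h1⟩⟩
  · exact ⟨rightPt_mem ⟨by linarith, by linarith⟩, leftPt_mem ⟨by linarith, by linarith⟩⟩

/-- At the boundary of its rhombus the trajectory through the place `a` passes to the trajectory
through the place `baseA κ b a`. -/
lemma leftRight_exit {κ : Slope} {b : Bool} (k : Idx) {a : ℝ} (ha : a ∈ Ioo (0 : ℝ) 1)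
    (hne : a ≠ bet κ b) :
    LeftRight (k, ray κ a (sg b * tau κ b a))
        (baseK κ b k a, ray κ (baseA κ b a) (sg b * (tau κ b a - 1))) ∨
      LeftRight (baseK κ b k a, ray κ (baseA κ b a) (sg b * (tau κ b a - 1)))
        (k, ray κ a (sg b * tau κ b a)) := by
  have h0 := tau_pos (b := b) (κ := κ) ha
  have h1 := tau_lt_one ha hne
  rcases ray_exit ha with ⟨h, e1, e2⟩ | ⟨h, e1, e2⟩
  · exact Or.inl ⟨b, _, ⟨h0, h1⟩, e1, by rw [baseK, if_pos h], e2⟩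
  · refine Or.inr ⟨!b, 1 - tau κ b a, ⟨by linarith, by linarith⟩, e2, ?_, e1⟩
    rw [baseK, if_neg h, nx_not_pv]

lemma mkS_exit {κ : Slope} {b : Bool} (k : Idx) {a : ℝ} (ha : a ∈ Ioo (0 : ℝ) 1)
    (hne : a ≠ bet κ b) :
    mkS k (ray κ a (sg b * tau κ b a)) =
      mkS (baseK κ b k a) (ray κ (baseA κ b a) (sg b * (tau κ b a - 1))) :=
  (mkS_eq_iff (ray_exit_mem ha hne).1 (ray_exit_mem ha hne).2).2 (Or.inr (leftRight_exit k ha hne))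

/-- The points of a trajectory that are glued to other points are those of `leftRight_exit`. -/
lemma leftRight_ray {κ : Slope} {k k' : Idx} {a σ : ℝ} {w' : ℂ} (ha : a ∈ Ioo (0 : ℝ) 1)
    (h : LeftRight (k, ray κ a σ) (k', w') ∨ LeftRight (k', w') (k, ray κ a σ)) :
    ∃ b, a ≠ bet κ b ∧ σ = sg b * tau κ b a ∧ k' = baseK κ b k a ∧
      w' = ray κ (baseA κ b a) (sg b * (tau κ b a - 1)) := by
  have fin : ∀ b s, s ∈ Ioo (0 : ℝ) 1 → σ = sg b * s →
      (s * bet κ b = a ∨ a + s * (1 - bet κ b) = 1) →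
      a ≠ bet κ b ∧ σ = sg b * tau κ b a ∧ k' = baseK κ b k a ∧
        w' = ray κ (baseA κ b a) (sg b * (tau κ b a - 1)) := by
    intro b s hs hσ h3
    have e0 := bet_nonneg κ b
    have e1 := bet_le_one κ b
    have := ha.1
    have := ha.2
    have := hs.1
    have := hs.2
    have hne : a ≠ bet κ b := by
      rintro h4
      rcases h3 with h3 | h3 <;> nlinarith
    have ht : tau κ b a = s := by
      rcases h3 with h3 | h3
      · have hb : 0 < bet κ b := by nlinarith
        rw [tau_of_le (by nlinarith), ← h3]; field_simp
      · have hb : 0 < 1 - bet κ b := by nlinarith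
        rw [tau_of_gt (by nlinarith), div_eq_iff hb.ne']; linarith
    have hσ' : σ = sg b * tau κ b a := by rw [ht, hσ]
    refine ⟨hne, hσ', ?_⟩
    have m := leftRight_exit k ha hne
    rw [← hσ'] at m
    have mem1 : ray κ a σ ∈ rhombus := by rw [hσ']; exact (ray_exit_mem ha hne).1
    have mem2 := (ray_exit_mem ha hne).2
    have mem3 : w' ∈ rhombus := by
      rcases h with ⟨b', s', hs', _, _, h3⟩ | ⟨b', s', hs', h3, _, _⟩ <;> dsimp only at h3 <;> rw [h3]
      · exact rightPt_mem hs'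
      · exact leftPt_mem hs'
    have := glueS_matching ⟨(k, ray κ a σ), mem1⟩ ⟨(k', w'), mem3⟩ ⟨(_, _), mem2⟩
      (glueS_or_iff.2 h) (glueS_or_iff.2 m)
    exact Prod.ext_iff.1 (congrArg Subtype.val this)
  have hk : ∀ b, (κ : ℝ) * sg b = 1 / 2 - bet κ b := fun b => by simp only [bet]; ring
  rcases h with ⟨b, s, hs, h3, _, _⟩ | ⟨b, s, hs, _, _, h3⟩
  · rw [leftPt, ray, pt_inj] at h3
    refine ⟨b, fin b s hs h3.2 (Or.inl ?_)⟩
    have h1 := h3.1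
    rw [h3.2] at h1
    linear_combination s * hk b - h1
  · dsimp only at h3
    rw [rightPt_eq, ray, pt_inj] at h3
    refine ⟨!b, fin (!b) (1 - s) ⟨by linarith [hs.2], by linarith [hs.1]⟩ h3.2 (Or.inr ?_)⟩
    have h1 := h3.1
    rw [h3.2] at h1
    linear_combination h1 - (1 - s) * hk (!b)

lemma sec_mem {κ : Slope} (z : Sec κ) : (z.2 : ℝ) ∈ Ioo (0 : ℝ) 1 := ⟨z.2.2.1, z.2.2.2.1⟩

lemma ray_mem_of_mem {κ : Slope} {a σ : ℝ} (ha : a ∈ Ioo (0 : ℝ) 1) (hne : ∀ b, a ≠ bet κ b)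
    (h0 : -tau κ false a ≤ σ) (h1 : σ ≤ tau κ true a) : ray κ a σ ∈ rhombus := by
  obtain ⟨b, s, hs, rfl⟩ := exists_sg σ
  have h : s ≤ tau κ b a := by cases b <;> simp at h0 h1 <;> linarith
  exact (ray_mem_rhombus ha hs).2 ⟨h, h.trans_lt (tau_lt_one ha (hne b))⟩

lemma mem_of_ray_mem {κ : Slope} {a σ : ℝ} (ha : a ∈ Ioo (0 : ℝ) 1) (h : ray κ a σ ∈ rhombus) :
    -tau κ false a ≤ σ ∧ σ ≤ tau κ true a := by
  obtain ⟨b, s, hs, rfl⟩ := exists_sg σ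
  have h := ((ray_mem_rhombus ha hs).1 h).1
  have p1 := tau_pos (κ := κ) (b := true) ha
  have p2 := tau_pos (κ := κ) (b := false) ha
  cases b <;> simp <;> constructor <;> linarith

/-- Every representative of a point of a trajectory lies on a trajectory. -/
lemma exists_ray_of_mkS_eq {κ : Slope} {z : Sec κ} {σ : ℝ} {k : Idx} {w : ℂ}
    (h0 : -tau κ false z.2 ≤ σ) (h1 : σ ≤ tau κ true z.2) (hw : w ∈ rhombus)
    (h : mkS z.1 (ray κ z.2 σ) = mkS k w) :
    ((z.1 = k ∧ ray κ z.2 σ = w) ∨ ∃ b, σ = sg b * tau κ b z.2 ∧ k = (baseMap κ b z).1 ∧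
      w = ray κ (baseMap κ b z).2 (sg b * (tau κ b z.2 - 1))) ∧
    ∃ z' : Sec κ, ∃ σ', (-tau κ false z'.2 ≤ σ' ∧ σ' ≤ tau κ true z'.2) ∧ k = z'.1 ∧
      w = ray κ z'.2 σ' := by
  rw [mkS_eq_iff (ray_mem_of_mem (sec_mem z) (ne_bet z.2.2) h0 h1) hw] at h
  rcases h with ⟨e1, e2⟩ | h
  · exact ⟨Or.inl ⟨e1, e2⟩, z, σ, ⟨h0, h1⟩, e1.symm, e2.symm⟩
  · obtain ⟨b, hne, e1, e2, e3⟩ := leftRight_ray (sec_mem z) h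
    refine ⟨Or.inr ⟨b, e1, e2, e3⟩, baseMap κ b z, _, ?_, e2, e3⟩
    have hm := (ray_exit_mem (sec_mem z) hne).2
    exact mem_of_ray_mem (sec_mem (baseMap κ b z)) hm

/-- The part of a section times the line on which the trajectories are given by one formula. -/
lemma isInducing_sec (κ : Slope) :
    IsInducing fun p : Sec κ × ℝ => ((p.1.1, (p.1.2 : ℝ), p.2) : Idx × ℝ × ℝ) := by
  have h1 : IsInducing (Prod.map id Subtype.val : Sec κ → Idx × ℝ) :=
    IsInducing.id.prodMap IsInducing.subtypeVal
  have h2 := (Homeomorph.prodAssoc Idx ℝ ℝ).isInducing.comp (h1.prodMap (IsInducing.id (X := ℝ)))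
  exact h2

/-- The set of points of `S` that are represented by points with coordinates in a closed
set is closed. -/
lemma isClosed_image_S (κ : Slope) {F : Set (Idx × ℝ × ℝ)} (hF : IsClosed F) :
    IsClosed {p : S | ∃ k w, w ∈ rhombus ∧ (k, place κ w, height w) ∈ F ∧ p = mkS k w} := by
  rw [← isQuotientMap_quot_mk.isClosed_preimage]
  have hc : ∀ (g : Idx → Idx) (u : ℂ), IsClosed {q : PreS |
      (g q.1.1, place κ (q.1.2 + u), height (q.1.2 + u)) ∈ F} := by
    intro g u
    have hw : Continuous fun q : PreS => q.1.2 + u :=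
      (continuous_snd.comp continuous_subtype_val).add continuous_const
    exact hF.preimage (((continuous_of_discreteTopology (f := g)).comp
      (continuous_fst.comp continuous_subtype_val)).prodMk
      (((place_continuous κ).comp hw).prodMk (height_continuous.comp hw)))
  have hre : Continuous fun q : PreS => q.1.2.re :=
    Complex.continuous_re.comp (continuous_snd.comp continuous_subtype_val)
  have hht : Continuous fun q : PreS => height q.1.2 :=
    height_continuous.comp (continuous_snd.comp continuous_subtype_val)
  -- the preimage consists of the points with coordinates in `F` and of the points on the edges whose
  -- partner on the glued edge has coordinates in `F`
  have e : Quot.mk GlueS ⁻¹' {p : S | ∃ k w, w ∈ rhombus ∧ (k, place κ w, height w) ∈ F ∧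
      p = mkS k w} =
      {q : PreS | (id q.1.1, place κ (q.1.2 + 0), height (q.1.2 + 0)) ∈ F} ∪
      ⋃ b : Bool, (({q : PreS | q.1.2.re = sg b * height q.1.2 / 2} ∩
          {q : PreS | 0 ≤ sg b * height q.1.2}) ∩
          {q : PreS | (nx b q.1.1, place κ (q.1.2 + pt (1 / 2) (-sg b)),
            height (q.1.2 + pt (1 / 2) (-sg b))) ∈ F}) ∪
        (({q : PreS | q.1.2.re = 1 + sg b * height q.1.2 / 2} ∩
          {q : PreS | sg b * height q.1.2 ≤ 0}) ∩
          {q : PreS | (pv (!b) q.1.1, place κ (q.1.2 + pt (-(1 / 2)) (sg b)),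
            height (q.1.2 + pt (-(1 / 2)) (sg b))) ∈ F}) := by
    ext ⟨⟨k, w⟩, hw⟩
    simp only [mem_preimage, mem_ofPred_eq, mem_union, mem_iUnion, mem_inter_iff, add_zero, id]
    rw [← mkS_of_mem hw]
    constructor
    · rintro ⟨k', w', hw', hF', h⟩
      rw [mkS_eq_iff hw hw'] at h
      rcases h with ⟨rfl, rfl⟩ | ⟨b, s, hs, h1, h2, h3⟩ | ⟨b, s, hs, h1, h2, h3⟩
      · exact Or.inl hF'
      · dsimp only at h1 h2 h3
        refine Or.inr ⟨b, Or.inl ?_⟩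
        have e : w + pt (1 / 2) (-sg b) = w' := by
          rw [h1, h3, leftPt, pt_add, rightPt, pt_inj]; constructor <;> ring
        rw [e, ← h2]
        refine ⟨?_, hF'⟩
        rw [h1, leftPt, height_pt, ← mul_assoc, sg_mul_self, one_mul]
        exact ⟨rfl, hs.1.le⟩
      · dsimp only at h1 h2 h3
        refine Or.inr ⟨b, Or.inr ?_⟩
        have e : w + pt (-(1 / 2)) (sg b) = w' := by
          rw [h1, h3, leftPt, rightPt, pt_add, pt_inj]; constructor <;> ring
        rw [e, h2, pv_not_nx]
        refine ⟨?_, hF'⟩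
        rw [h3, rightPt, height_pt, ← mul_assoc, sg_mul_self, one_mul]
        exact ⟨by simp; ring, by linarith [hs.2]⟩
    · rintro (h | ⟨b, ⟨⟨h1, h2⟩, h3⟩ | ⟨⟨h1, h2⟩, h3⟩⟩)
      · exact ⟨k, w, hw, h, rfl⟩
      · obtain ⟨x, y, rfl⟩ := exists_pt w
        simp only [pt_re, height_pt] at h1 h2
        have ey : y = sg b * (sg b * y) := by rw [← mul_assoc, sg_mul_self, one_mul]
        set s := sg b * y with hs
        subst h1
        rw [ey, mem_rhombus h2] at hw
        have hs' : s ∈ Ioo (0 : ℝ) 1 := ⟨by linarith [hw.2.1], hw.2.2.2⟩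
        have e1 : pt (s / 2) y = leftPt b s := by rw [leftPt, ← ey]
        have e2 : pt (s / 2) y + pt (1 / 2) (-sg b) = rightPt b s := by
          rw [e1, leftPt, pt_add, rightPt, pt_inj]; constructor <;> ring
        rw [e2] at h3
        refine ⟨_, _, rightPt_mem hs', h3, ?_⟩
        rw [e1, mkS_eq_iff (leftPt_mem hs') (rightPt_mem hs')]
        exact Or.inr (Or.inl ⟨b, s, hs', rfl, rfl, rfl⟩)
      · obtain ⟨x, y, rfl⟩ := exists_pt w
        simp only [pt_re, height_pt] at h1 h2
        have ey : y = sg (!b) * (-(sg b * y)) := by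
          rw [sg_not, neg_mul_neg, ← mul_assoc, sg_mul_self, one_mul]
        set s := sg b * y with hs
        subst h1
        rw [ey, mem_rhombus (by linarith)] at hw
        have hs' : s + 1 ∈ Ioo (0 : ℝ) 1 := ⟨by linarith [hw.2.2.2], by linarith [hw.2.2.1]⟩
        have e1 : pt (1 + s / 2) y = rightPt b (s + 1) := by
          rw [rightPt_eq, pt_inj]
          exact ⟨by ring, by rw [ey]; ring⟩
        have e2 : pt (1 + s / 2) y + pt (-(1 / 2)) (sg b) = leftPt b (s + 1) := by
          rw [e1, rightPt, pt_add, leftPt, pt_inj]; constructor <;> ring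
        rw [e2] at h3
        refine ⟨_, _, leftPt_mem hs', h3, ?_⟩
        rw [e1, mkS_eq_iff (rightPt_mem hs') (leftPt_mem hs')]
        refine Or.inr (Or.inr ⟨b, s + 1, hs', rfl, ?_, rfl⟩)
        have := nx_not_pv (!b) k
        rw [Bool.not_not] at this
        exact this.symm
  rw [e]
  refine (hc id 0).union (isClosed_iUnion_of_finite fun b => IsClosed.union ?_ ?_)
  · exact ((isClosed_eq hre ((continuous_const.mul hht).div_const _)).inter
      (isClosed_le continuous_const (continuous_const.mul hht))).inter (hc _ _)
  · exact ((isClosed_eq hre (continuous_const.add ((continuous_const.mul hht).div_const _))).inter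
      (isClosed_le (continuous_const.mul hht) continuous_const)).inter (hc _ _)

/-- The straight-line flow on `S` as a suspension flow over the return map to the short diagonals
of the rhombi. All return times are equal, since the short diagonals are parallel. -/
def chartS (κ : Slope) : SuspensionChart (returnMap κ) S where
  lo z := tau κ false z.2
  hi z := tau κ true z.2
  C z σ := mkS z.1 (ray κ z.2 σ)
  lo_cont := tau_continuous κ false
  hi_cont := tau_continuous κ true
  lo_pos z := tau_pos (sec_mem z)
  hi_pos z := tau_pos (sec_mem z)
  cont := by
    refine mkS_continuousOn.comp (f := fun p : Sec κ × ℝ => (p.1.1, ray κ p.1.2 p.2)) ?_ ?_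
    · refine Continuous.continuousOn ((continuous_fst.comp continuous_fst).prodMk ?_)
      exact (ray_continuous κ).comp (((continuous_place κ).comp continuous_fst).prodMk
        continuous_snd)
    · rintro ⟨z, σ⟩ ⟨h0, h1⟩
      exact ray_mem_of_mem (sec_mem z) (ne_bet z.2.2) h0 h1
  glue z := by
    have h := mkS_exit (b := true) z.1 (sec_mem z) (ne_bet z.2.2 true)
    rw [sg_true, one_mul, one_mul] at h
    rw [h]
    have e := tau_baseA (sec_mem z) (ne_bet z.2.2 true)
    have e2 : -tau κ false (returnMap κ z).2 = tau κ true z.2 - 1 := by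
      have : tau κ false (returnMap κ z).2 = 1 - tau κ true z.2 := e
      rw [this]; ring
    rw [e2]; rfl
  inj := by
    intro z σ z' σ' h0 h1 h0' h1' h
    have hw := ray_mem_of_mem (sec_mem z') (ne_bet z'.2.2) h0' h1'
    rcases (exists_ray_of_mkS_eq h0 h1 hw h).1 with ⟨e1, e2⟩ | ⟨b, e1, e2, e3⟩
    · obtain ⟨e3, e4⟩ := ray_inj.1 e2
      exact Or.inl ⟨Prod.ext e1 (Subtype.ext e3), e4⟩
    · obtain ⟨e4, e5⟩ := ray_inj.1 e3
      have hz : z' = baseMap κ b z := Prod.ext e2 (Subtype.ext e4)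
      have et : tau κ (!b) z'.2 = 1 - tau κ b z.2 := by
        rw [hz]; exact tau_baseA (sec_mem z) (ne_bet z.2.2 b)
      right
      cases b
      · right
        refine ⟨?_, ?_, by simpa using e1⟩
        · simp at e5 et; linarith
        · rw [hz]; exact (baseMap_not_baseMap κ false z).symm
      · left
        refine ⟨by simpa using e1, hz, ?_⟩
        simp at e5 et; linarith
  one_le_roof z := by
    have : tau κ false (returnMap κ z).2 = 1 - tau κ true z.2 :=
      tau_baseA (sec_mem z) (ne_bet z.2.2 true)
    rw [this]; linarith
  roof_le z := by
    have : tau κ false (returnMap κ z).2 = 1 - tau κ true z.2 :=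
      tau_baseA (sec_mem z) (ne_bet z.2.2 true)
    rw [this]; linarith
  lift := by
    intro W hW
    obtain ⟨F, hF, e⟩ := (isInducing_sec κ).isClosed_iff.1 hW
    refine ⟨_, isClosed_image_S κ hF, fun z σ h0 h1 => ?_⟩
    have mem_iff : ∀ z : Sec κ, ∀ σ, -tau κ false z.2 ≤ σ → σ ≤ tau κ true z.2 →
        ((z.1, (z.2 : ℝ), σ) ∈ F ↔ mkS z.1 (ray κ z.2 σ) ∈ W) := by
      intro z σ h0 h1
      have := Set.ext_iff.1 e (z, σ)
      simp only [mem_preimage, mem_ofPred_eq] at this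
      rw [this]
      exact and_iff_right ⟨h0, h1⟩
    constructor
    · rintro ⟨k, w, hw, hF', h⟩
      obtain ⟨-, z', σ', h', rfl, rfl⟩ := exists_ray_of_mkS_eq h0 h1 hw h
      rw [h, ← mem_iff z' σ' h'.1 h'.2]
      simpa [ray] using hF'
    · intro h
      refine ⟨z.1, ray κ z.2 σ, ray_mem_of_mem (sec_mem z) (ne_bet z.2.2) h0 h1, ?_, rfl⟩
      have := (mem_iff z σ h0 h1).2 h
      simpa [ray] using this

/-! ### The direction of the flow -/

/-- The time which the flow in direction `θ` needs to climb the height of a triangle. -/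
def climb (θ : ℝ) : ℝ := √3 / 2 / Real.sin θ

lemma sin_pos_of_mem {θ : ℝ} (h : θ ∈ Icc (Real.pi / 3) (2 * Real.pi / 3)) : 0 < Real.sin θ := by
  have := Real.pi_pos
  exact Real.sin_pos_of_pos_of_lt_pi (by linarith [h.1]) (by linarith [h.2])

lemma abs_cos_le_of_mem {θ : ℝ} (h : θ ∈ Icc (Real.pi / 3) (2 * Real.pi / 3)) :
    |Real.cos θ| ≤ 1 / 2 := by
  have := Real.pi_pos
  have h1 := Real.cos_le_cos_of_nonneg_of_le_pi (by linarith) (by linarith [h.2]) h.1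
  have h2 := Real.cos_le_cos_of_nonneg_of_le_pi (by linarith [h.1]) (by linarith) h.2
  rw [Real.cos_pi_div_three] at h1
  have h3 : Real.cos (2 * Real.pi / 3) = -(1 / 2) := by
    rw [← Real.cos_pi_div_three, ← Real.cos_pi_sub]; congr 1; ring
  rw [h3] at h2
  rw [abs_le]
  constructor <;> linarith

/-- The slope `(√3 / 2) cot θ` for a direction `θ` between `π / 3` and `2π / 3`. -/
def slope (θ : ℝ) (h : θ ∈ Icc (Real.pi / 3) (2 * Real.pi / 3)) : Slope :=
  ⟨climb θ * Real.cos θ, by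
    have h1 := sin_pos_of_mem h
    have h2 := abs_cos_le_of_mem h
    have h3 := Real.sin_sq_add_cos_sq θ
    have h4 : Real.cos θ ^ 2 ≤ 1 / 4 := by
      have := sq_le_sq' (by linarith [abs_nonneg (Real.cos θ)]) h2
      rw [sq_abs] at this; linarith
    have h5 : √3 / 2 ≤ Real.sin θ := by
      refine abs_le_of_sq_le_sq' ?_ h1.le |>.2
      have := half_sqrt_sq
      nlinarith
    have h6 : |climb θ * Real.cos θ| ≤ 1 / 2 := by
      have : climb θ ≤ 1 := by rw [climb, div_le_one h1]; exact h5
      have h0 : 0 ≤ climb θ := div_nonneg half_sqrt_pos.le h1.le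
      rw [abs_mul, abs_of_nonneg h0]
      nlinarith [abs_nonneg (Real.cos θ)]
    exact ⟨(abs_le.1 h6).1, (abs_le.1 h6).2⟩⟩

lemma climb_pos {θ : ℝ} (h : θ ∈ Icc (Real.pi / 3) (2 * Real.pi / 3)) : 0 < climb θ :=
  div_pos half_sqrt_pos (sin_pos_of_mem h)

lemma dir_re (θ : ℝ) : (dir θ).re = Real.cos θ := Complex.exp_ofReal_mul_I_re θ

lemma dir_im (θ : ℝ) : (dir θ).im = Real.sin θ := Complex.exp_ofReal_mul_I_im θ

lemma climb_mul_dir {θ : ℝ} (h : θ ∈ Icc (Real.pi / 3) (2 * Real.pi / 3)) :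
    (climb θ : ℂ) * dir θ = pt (slope θ h) 1 := by
  refine Complex.ext ?_ ?_
  · rw [Complex.re_ofReal_mul, dir_re]; rfl
  · rw [Complex.im_ofReal_mul, dir_im, climb, pt_im]
    have := (sin_pos_of_mem h).ne'
    field_simp

lemma dir_eq_pt {θ : ℝ} (h : θ ∈ Icc (Real.pi / 3) (2 * Real.pi / 3)) :
    dir θ = pt (slope θ h / climb θ) (1 / climb θ) := by
  have h1 := climb_mul_dir h
  have h0 := (climb_pos h).ne'
  have : dir θ = ((1 / climb θ : ℝ) : ℂ) * pt (slope θ h) 1 := by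
    rw [← h1, ← mul_assoc, ← Complex.ofReal_mul, one_div_mul_cancel h0]; simp
  rw [this, ofReal_mul_pt]
  congr 1
  · ring
  · ring

lemma ray_add_dir {θ : ℝ} (h : θ ∈ Icc (Real.pi / 3) (2 * Real.pi / 3)) (a σ s : ℝ) :
    ray (slope θ h) a σ + s * dir θ = ray (slope θ h) a (σ + s / climb θ) := by
  rw [dir_eq_pt h, ofReal_mul_pt, ray, ray, pt_add, pt_inj]
  constructor <;> ring

lemma ray_sub_dir {θ : ℝ} (h : θ ∈ Icc (Real.pi / 3) (2 * Real.pi / 3)) (a σ s : ℝ) :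
    ray (slope θ h) a σ - s * dir θ = ray (slope θ h) a (σ - s / climb θ) := by
  have := ray_add_dir h a σ (-s)
  rw [neg_div, ← sub_eq_add_neg] at this
  rw [← this]; push_cast; ring

lemma FollowsLines.dir {M Λ : Type*} {R : Λ → ℝ → M → Prop} {γ : ℝ → M} (hγ : FollowsLines R γ)
    (b : Bool) (t : ℝ) :
    ∃ ε > 0, ∃ ℓ, ∀ s ∈ Icc (0 : ℝ) ε, R ℓ (sg b * s) (γ (t + sg b * s)) := by
  obtain ⟨ε, hε, ⟨ℓ₁, h₁⟩, ⟨ℓ₂, h₂⟩⟩ := hγ t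
  cases b
  · exact ⟨ε, hε, ℓ₂, fun s hs => by
      simpa [sub_eq_add_neg] using h₂ s hs⟩
  · exact ⟨ε, hε, ℓ₁, fun s hs => by simpa using h₁ s hs⟩

/-- A place through which all returns can be followed, forwards and backwards, avoids the
endpoints of the short diagonals for ever. -/
lemma mem_Bset_of_step {κ : Slope} {Q : Idx → ℝ → Prop}
    (h : ∀ k a, Q k a → a ∈ Ioo (0 : ℝ) 1 ∧ ∀ b, Q (baseK κ b k a) (baseA κ b a))
    {k : Idx} {a : ℝ} (hQ : Q k a) : a ∈ Bset κ := by
  have key : ∀ (b : Bool) (n : ℕ) k a, Q k a → ∀ m : ℤ, a - sg b * n * bet κ true ≠ m := by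
    intro b n
    induction n with
    | zero =>
      intro k a hQ m hm
      obtain ⟨h0, h1⟩ := (h k a hQ).1
      simp at hm
      rw [hm] at h0 h1
      have h0 : (0 : ℤ) < m := by exact_mod_cast h0
      have h1 : m < (1 : ℤ) := by exact_mod_cast h1
      omega
    | succ n ih =>
      intro k a hQ m hm
      obtain ⟨m', hm'⟩ := baseA_eq κ b a
      refine ih _ _ ((h k a hQ).2 b) (m + m') ?_
      rw [hm']
      push_cast at hm ⊢
      linarith
  have h0 := (h k a hQ).1
  refine ⟨h0.1, h0.2, fun n m => ?_⟩
  rcases le_total 0 n with hn | hn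
  · have := key false n.toNat k a hQ m
    have e : ((n.toNat : ℕ) : ℝ) = n := by exact_mod_cast Int.toNat_of_nonneg hn
    rw [e] at this
    simpa using this
  · have := key true (-n).toNat k a hQ m
    have e : (((-n).toNat : ℕ) : ℝ) = -n := by exact_mod_cast Int.toNat_of_nonneg (by omega)
    rw [e] at this
    simpa using this

/-! ### The trajectories on `S` -/

/-- The lines of the translation structure of `S`, in direction of slope `κ`, with the height as
parameter. -/
def lineS (κ : Slope) (ℓ : Idx × ℝ × ℝ) (t : ℝ) (p : S) : Prop :=
  ray κ ℓ.2.1 (ℓ.2.2 + t) ∈ rhombus ∧ p = mkS ℓ.1 (ray κ ℓ.2.1 (ℓ.2.2 + t))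

lemma isStraightTrajectory_iff {θ : ℝ} (h : θ ∈ Icc (Real.pi / 3) (2 * Real.pi / 3)) (γ : ℝ → S) :
    IsStraightTrajectory θ (fun t => γ (t / climb θ)) ↔ FollowsLines (lineS (slope θ h)) γ := by
  have hH := climb_pos h
  constructor
  · intro hγ t
    obtain ⟨ε, hε, ⟨k, w, h1⟩, ⟨k', w', h2⟩⟩ := hγ (t * climb θ)
    refine ⟨ε / climb θ, div_pos hε hH, ⟨(k, place (slope θ h) w, height w), fun s hs => ?_⟩,
      ⟨(k', place (slope θ h) w', height w'), fun s hs => ?_⟩⟩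
    · have hs' : s * climb θ ∈ Icc 0 ε :=
        ⟨mul_nonneg hs.1 hH.le, (le_div_iff₀ hH).1 hs.2⟩
      obtain ⟨h3, h4⟩ := h1 _ hs'
      rw [← mkS_of_mem h3, ← add_mul] at h4
      dsimp only at h4
      rw [mul_div_cancel_right₀ _ hH.ne'] at h4
      rw [← ray_place_height (slope θ h) w, ray_add_dir, mul_div_cancel_right₀ _ hH.ne'] at h3 h4
      exact ⟨h3, h4⟩
    · have hs' : s * climb θ ∈ Icc 0 ε :=
        ⟨mul_nonneg hs.1 hH.le, (le_div_iff₀ hH).1 hs.2⟩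
      obtain ⟨h3, h4⟩ := h2 _ hs'
      rw [← mkS_of_mem h3, ← sub_mul] at h4
      dsimp only at h4
      rw [mul_div_cancel_right₀ _ hH.ne'] at h4
      rw [← ray_place_height (slope θ h) w', ray_sub_dir, mul_div_cancel_right₀ _ hH.ne'] at h3 h4
      exact ⟨h3, h4⟩
  · intro hγ t
    obtain ⟨ε, hε, ⟨ℓ, h1⟩, ⟨ℓ', h2⟩⟩ := hγ (t / climb θ)
    refine ⟨ε * climb θ, mul_pos hε hH, ⟨ℓ.1, ray (slope θ h) ℓ.2.1 ℓ.2.2, fun s hs => ?_⟩,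
      ⟨ℓ'.1, ray (slope θ h) ℓ'.2.1 ℓ'.2.2, fun s hs => ?_⟩⟩
    · have hs' : s / climb θ ∈ Icc 0 ε := ⟨div_nonneg hs.1 hH.le, (div_le_iff₀ hH).2 hs.2⟩
      obtain ⟨h3, h4⟩ := h1 _ hs'
      rw [← ray_add_dir] at h3 h4
      exact ⟨h3, by dsimp only; rw [add_div, h4, mkS_of_mem h3]⟩
    · have hs' : s / climb θ ∈ Icc 0 ε := ⟨div_nonneg hs.1 hH.le, (div_le_iff₀ hH).2 hs.2⟩
      obtain ⟨h3, h4⟩ := h2 _ hs'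
      rw [← sub_eq_add_neg, ← ray_sub_dir] at h3 h4
      exact ⟨h3, by dsimp only; rw [sub_div, h4, mkS_of_mem h3]⟩

section

variable {κ : Slope} {γ : ℝ → S}

/-- A straight trajectory runs through the whole line segment in the rhombus in which it is, and
this segment does not end in a vertex. -/
lemma straight_chord (hγ : FollowsLines (lineS κ) γ) {k : Idx} {a t₀ σ₀ : ℝ}
    (ha : a ∈ Ioo (0 : ℝ) 1) (hσ : σ₀ ∈ Ioo (-tau κ false a) (tau κ true a))
    (h0 : γ (t₀ + σ₀) = mkS k (ray κ a σ₀)) {σ : ℝ}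
    (hσ' : σ ∈ Icc (-tau κ false a) (tau κ true a)) :
    ray κ a σ ∈ rhombus ∧ γ (t₀ + σ) = mkS k (ray κ a σ) := by
  have mem : ∀ t ∈ Ioo (-tau κ false a) (tau κ true a), ray κ a t ∈ rhombus := by
    intro t ht
    obtain ⟨b, s, hs, rfl⟩ := exists_sg t
    have h1 := tau_le_one (κ := κ) (b := b) a
    have h : s < tau κ b a := by
      have := ht.1; have := ht.2
      cases b <;> simp at * <;> linarith
    exact (ray_mem_rhombus ha hs).2 ⟨h.le, h.trans_le h1⟩
  have := hγ.onLine (ℓ := (k, a, 0)) isPreconnected_Ioo t₀ ?_ hσ ?_ (t' := σ) ?_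
  · simpa [lineS] using this
  · rintro t ht ⟨-, h1⟩ ⟨k', a', h'⟩ u ⟨h2, h3⟩ v p h4
    rw [h1] at h3
    simp only [zero_add] at h3
    rcases (mkS_eq_iff (mem t ht) h2).1 h3 with ⟨e1, e2⟩ | h5
    · obtain ⟨e3, e4⟩ := ray_inj.1 e2
      dsimp only at e1 e2 e3 e4
      subst e1 e3
      have e5 : h' + (u + v) = 0 + (t + v) := by linarith
      dsimp only [lineS] at h4 ⊢
      rwa [e5] at h4
    · exfalso
      obtain ⟨b, hne, e1, -⟩ := leftRight_ray ha h5
      have := ht.1; have := ht.2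
      cases b <;> simp at e1 <;> linarith
  · rw [lineS]; simp only [zero_add]; exact ⟨mem _ hσ, h0⟩
  · rw [closure_Ioo (by linarith [hσ.1, hσ.2])]
    exact hσ'

lemma straight_ne_bet (hγ : FollowsLines (lineS κ) γ) {k : Idx} {a t₀ σ₀ : ℝ}
    (ha : a ∈ Ioo (0 : ℝ) 1) (hσ : σ₀ ∈ Ioo (-tau κ false a) (tau κ true a))
    (h0 : γ (t₀ + σ₀) = mkS k (ray κ a σ₀)) (b : Bool) : a ≠ bet κ b := by
  intro h
  have p1 := tau_pos (κ := κ) (b := true) ha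
  have p2 := tau_pos (κ := κ) (b := false) ha
  have h1 : tau κ b a = 1 := by
    rw [tau_of_le h.le, h, div_self]; have := ha.1; linarith
  have := (straight_chord hγ ha hσ h0 (σ := sg b * tau κ b a)
    (by cases b <;> simp <;> linarith)).1
  have := ((ray_mem_rhombus ha (by rw [h1]; norm_num)).1 this).2
  linarith

/-- A straight trajectory that meets a short diagonal also meets the next and the previous one. -/
lemma straight_step (hγ : FollowsLines (lineS κ) γ) {k : Idx} {a t₀ : ℝ}
    (ha : a ∈ Ioo (0 : ℝ) 1) (h0 : γ t₀ = mkS k (ray κ a 0)) (b : Bool) :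
    γ (t₀ + sg b) = mkS (baseK κ b k a) (ray κ (baseA κ b a) 0) := by
  have p : ∀ b, 0 < tau κ b a := fun b => tau_pos ha
  have h0' : γ (t₀ + 0) = mkS k (ray κ a 0) := by rwa [add_zero]
  have hI : (0 : ℝ) ∈ Ioo (-tau κ false a) (tau κ true a) := ⟨by linarith [p false], p true⟩
  have hne := straight_ne_bet hγ ha hI h0' b
  have ha' := baseA_mem_Ioo ha hne
  have hlt := tau_lt_one ha hne
  have ht := tau_baseA ha hne
  have hend := (straight_chord hγ ha hI h0' (σ := sg b * tau κ b a)
    (by have := p true; have := p false; cases b <;> simp <;> linarith)).2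
  -- just after leaving the rhombus the trajectory is in the next one
  obtain ⟨ε, hε, ⟨k', a', h'⟩, hℓ⟩ := hγ.dir b (t₀ + sg b * tau κ b a)
  have e0 := hℓ 0 ⟨le_rfl, hε.le⟩
  simp only [lineS, mul_zero, add_zero, hend] at e0
  set δ := min ε ((1 - tau κ b a) / 2) with hδ
  have hδ0 : 0 < δ := lt_min hε (by linarith)
  have hδ1 : δ ≤ ε := min_le_left _ _
  have hδ2 : δ ≤ (1 - tau κ b a) / 2 := min_le_right _ _
  have e1 := hℓ δ ⟨hδ0.le, hδ1⟩
  rcases (mkS_eq_iff (ray_exit_mem ha hne).1 e0.1).1 e0.2 with ⟨e2, e3⟩ | h5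
  · exfalso
    obtain ⟨e4, e5⟩ := ray_inj.1 e3
    have := e1.1
    simp only at this
    rw [← e4, ← e5, ← mul_add, ray_mem_rhombus ha (by linarith [p b])] at this
    linarith [this.1]
  · obtain ⟨b', -, e2, e3, e4⟩ := leftRight_ray ha h5
    have hb : b' = b := by
      have := p b; have := p b'
      cases b <;> cases b' <;> simp at e2 ⊢ <;> linarith
    subst hb
    obtain ⟨e5, e6⟩ := ray_inj.1 e4
    simp only [lineS] at e1
    have e1' := e1.2
    rw [e5, e6, e3, ← mul_add] at e1'
    have hc := straight_chord hγ (k := baseK κ b' k a) (t₀ := t₀ + sg b') ha'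
      (σ₀ := sg b' * (tau κ b' a - 1 + δ)) ?_ ?_ (σ := 0) ?_
    · simpa using hc.2
    · rw [mem_Ioo]
      have hpp : 0 < tau κ b' (baseA κ b' a) := tau_pos ha'
      cases b' <;> simp at ht hpp ⊢ <;> rw [ht] <;> constructor <;> linarith
    · rw [← e1']; congr 1; ring
    · have h1 : 0 < tau κ true (baseA κ b' a) := tau_pos ha'
      have h2 : 0 < tau κ false (baseA κ b' a) := tau_pos ha'
      exact ⟨by linarith, h1.le⟩

/-- A trajectory cannot run along an edge that starts at the vertex `0`, since it would run into this
vertex. -/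
lemma straight_not_edge (hγ : FollowsLines (lineS κ) γ) {k : Idx} {σ₀ t₀ : ℝ}
    (hmem : ray κ 0 σ₀ ∈ rhombus) (h0 : γ (t₀ + σ₀) = mkS k (ray κ 0 σ₀)) : False := by
  obtain ⟨b, s, hs, rfl⟩ := exists_sg σ₀
  have hk : (κ : ℝ) * sg b = 1 / 2 - bet κ b := by simp only [bet]; ring
  have hn := bet_nonneg κ b
  have e : ∀ u, ray κ 0 (sg b * u) = pt (u / 2 - u * bet κ b) (sg b * u) := by
    intro u; rw [ray, pt_inj]; exact ⟨by linear_combination u * hk, rfl⟩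
  have hm := hmem
  rw [e, mem_rhombus hs] at hm
  have hs0 : 0 < s := by
    rcases hs.lt_or_eq with h | h
    · exact h
    · rw [← h] at hm; linarith [hm.2.1]
  -- a line through the vertex `0` meets the rhombus elsewhere only if it runs along an edge
  have hb : bet κ b = 0 := by
    have : s * bet κ b ≤ 0 := by linarith [hm.1.1]
    nlinarith
  have e' : ∀ u, ray κ 0 (sg b * u) = leftPt b u := by
    intro u; rw [e, hb, leftPt, pt_inj]; exact ⟨by ring, rfl⟩
  have e'' : ∀ u, ray κ 1 (sg b * (u - 1)) = rightPt b u := by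
    intro u; rw [ray, rightPt, pt_inj]
    exact ⟨by rw [hb] at hk; linear_combination (u - 1) * hk, rfl⟩
  have hpos : ∀ t, t ∈ (fun u => sg b * u) ⁻¹' Ioo (0 : ℝ) 1 →
      sg b * t ∈ Ioo (0 : ℝ) 1 ∧ t = sg b * (sg b * t) := fun t ht =>
    ⟨ht, by rw [← mul_assoc, sg_mul_self, one_mul]⟩
  -- the lines through the point and through its partner in the glued rhombus both run along the edge,
  -- so the trajectory stays on it until it reaches the removed vertex
  have key := hγ.onLine (ℓ := (k, 0, 0)) (O := (fun u => sg b * u) ⁻¹' Ioo (0 : ℝ) 1)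
    (by cases b
        · have : (fun u => sg false * u) ⁻¹' Ioo (0 : ℝ) 1 = Ioo (-1) 0 := by
            ext u; simp only [mem_preimage, mem_Ioo, sg_false]; constructor <;> rintro ⟨h1, h2⟩ <;>
              constructor <;> linarith
          rw [this]; exact isPreconnected_Ioo
        · have : (fun u => sg true * u) ⁻¹' Ioo (0 : ℝ) 1 = Ioo 0 1 := by
            ext u; simp
          rw [this]; exact isPreconnected_Ioo) t₀ ?_ (t := sg b * s) ?_ ?_ (t' := 0) ?_
  · have := key.1
    simp only [add_zero] at this
    have e0 := e' 0
    rw [mul_zero] at e0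
    rw [e0, leftPt, mem_rhombus le_rfl] at this
    linarith [this.2.1]
  · rintro t ht ⟨h1', h1⟩ ⟨k', a', h'⟩ u ⟨h2, h3⟩ v p h4
    obtain ⟨ht1, ht2⟩ := hpos t ht
    simp only [zero_add] at h1 h1'
    rw [h1] at h3
    rcases (mkS_eq_iff h1' h2).1 h3 with ⟨e1, e2⟩ | ⟨b', s', hs', h5, h6, h7⟩ |
      ⟨b', s', hs', h5, h6, h7⟩
    · obtain ⟨e3, e4⟩ := ray_inj.1 e2
      dsimp only at e1 e2 e3 e4
      subst e1
      have e5 : h' + (u + v) = 0 + (t + v) := by linarith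
      dsimp only [lineS] at h4 ⊢
      rwa [e5, ← e3] at h4
    · dsimp only at h5 h6 h7
      rw [ht2, e'] at h5
      obtain ⟨rfl, rfl⟩ := leftPt_inj ht1.1 hs'.1 h5
      rw [← e''] at h7
      obtain ⟨e3, e4⟩ := ray_inj.1 h7
      have e5 : h' + (u + v) = sg b * (sg b * (t + v) - 1) := by
        have : sg b * (sg b * (t + v)) = t + v := by rw [← mul_assoc, sg_mul_self, one_mul]
        have : sg b * (sg b * t) = t := by rw [← mul_assoc, sg_mul_self, one_mul]
        linarith
      obtain ⟨h8, rfl⟩ := h4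
      dsimp only at h8 ⊢
      rw [e5, e3] at h8 ⊢
      rw [e''] at h8 ⊢
      have hmem' : sg b * (t + v) ∈ Ioo (0 : ℝ) 1 := by
        rw [rightPt_eq] at h8
        rcases le_total (sg b * (t + v)) 1 with hle | hle
        · rw [mem_rhombus (by linarith)] at h8
          constructor <;> linarith [h8.2.1, h8.2.2.1, h8.2.2.2]
        · exfalso
          rw [show sg (!b) * (1 - sg b * (t + v)) = sg b * (sg b * (t + v) - 1) by rw [sg_not]; ring,
            mem_rhombus (by linarith)] at h8
          linarith [h8.1.2]
      have e6 : ray κ 0 (t + v) = leftPt b (sg b * (t + v)) := by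
        rw [← e', ← mul_assoc, sg_mul_self, one_mul]
      rw [lineS]
      simp only [zero_add]
      rw [e6]
      refine ⟨leftPt_mem hmem', ?_⟩
      rw [eq_comm, mkS_eq_iff (leftPt_mem hmem') (rightPt_mem hmem')]
      exact Or.inr (Or.inl ⟨b, _, hmem', rfl, h6, rfl⟩)
    · dsimp only at h7
      rw [ht2, e'] at h7
      exact (leftPt_ne_rightPt ht1 hs' h7).elim
  · show sg b * (sg b * s) ∈ Ioo (0 : ℝ) 1
    rw [← mul_assoc, sg_mul_self, one_mul]; exact ⟨hs0, hm.2.2.2⟩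
  · rw [lineS]; simp only [zero_add]; exact ⟨hmem, h0⟩
  · cases b
    · have : (fun u => sg false * u) ⁻¹' Ioo (0 : ℝ) 1 = Ioo (-1) 0 := by
        ext u; simp only [mem_preimage, mem_Ioo, sg_false]; constructor <;> rintro ⟨h1, h2⟩ <;>
          constructor <;> linarith
      rw [this, closure_Ioo (by norm_num)]; norm_num
    · have : (fun u => sg true * u) ⁻¹' Ioo (0 : ℝ) 1 = Ioo 0 1 := by
        ext u; simp
      rw [this, closure_Ioo (by norm_num)]; norm_num

/-- Every straight trajectory meets a short diagonal. -/
lemma straight_start (hγ : FollowsLines (lineS κ) γ) :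
    ∃ t₀ k a, a ∈ Ioo (0 : ℝ) 1 ∧ γ t₀ = mkS k (ray κ a 0) := by
  obtain ⟨ε, hε, ⟨⟨k, a, h⟩, h1⟩, -⟩ := hγ 0
  simp only [lineS, zero_add] at h1
  have hk : ∀ b, (κ : ℝ) * sg b = 1 / 2 - bet κ b := fun b => by simp only [bet]; ring
  have hx : ∀ σ, ray κ a σ ∈ rhombus → 0 ≤ a ∧ a ≤ 1 := by
    intro σ hσ
    obtain ⟨b, s, hs, rfl⟩ := exists_sg σ
    rw [ray, mem_rhombus hs] at hσ
    have := bet_nonneg κ b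
    have := bet_le_one κ b
    have e : (κ : ℝ) * (sg b * s) = s * (1 / 2 - bet κ b) := by rw [← hk b]; ring
    rw [e] at hσ
    constructor <;> nlinarith [hσ.1.1, hσ.1.2]
  have m := h1 (ε / 2) ⟨by linarith, by linarith⟩
  have h2 := hx _ m.1
  rcases h2.1.lt_or_eq with h3 | h3
  · rcases h2.2.lt_or_eq with h4 | h4
    · have ha : a ∈ Ioo (0 : ℝ) 1 := ⟨h3, h4⟩
      have b0 := mem_of_ray_mem ha (h1 0 ⟨le_rfl, hε.le⟩).1
      have b1 := mem_of_ray_mem ha (h1 ε ⟨hε.le, le_rfl⟩).1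
      have hc := straight_chord hγ (t₀ := -h) ha (σ₀ := h + ε / 2)
        ⟨by linarith, by linarith⟩ (by rw [← m.2]; congr 1; ring) (σ := 0)
        ⟨by have := tau_pos (κ := κ) (b := false) ha; linarith, (tau_pos ha).le⟩
      exact ⟨_, k, a, ha, hc.2⟩
    · -- the trajectory runs along an edge that ends at the vertex `v₀`
      exfalso
      subst h4
      set σ := h + ε / 2 with hσ
      obtain ⟨b, s, hs, e⟩ := exists_sg σ
      have hm := m.1
      have hbn := bet_le_one κ b
      have e2 : ray κ 1 σ = pt (1 + s / 2 - s * bet κ b) (sg b * s) := by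
        rw [ray, pt_inj, e]; exact ⟨by linear_combination s * hk b, rfl⟩
      rw [e2, mem_rhombus hs] at hm
      have hs0 : 0 < s := by
        rcases hs.lt_or_eq with h | h
        · exact h
        · rw [← h] at hm; linarith [hm.2.2.1]
      have hb : bet κ b = 1 := by
        have : s * (1 - bet κ b) ≤ 0 := by linarith [hm.1.2]
        nlinarith
      have hs1 : 1 - s ∈ Ioo (0 : ℝ) 1 := ⟨by linarith [hm.2.2.2], by linarith⟩
      have e3 : ray κ 1 σ = rightPt (!b) (1 - s) := by
        rw [e2, rightPt_eq, pt_inj, Bool.not_not, hb]; constructor <;> ring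
      have e4 : ray κ 0 (sg (!b) * (1 - s)) = leftPt (!b) (1 - s) := by
        rw [ray, leftPt, pt_inj]
        have := hk (!b)
        rw [bet_not, hb] at this
        exact ⟨by linear_combination (1 - s) * this, rfl⟩
      refine straight_not_edge hγ (k := pv b k) (σ₀ := sg (!b) * (1 - s))
        (t₀ := ε / 2 - sg (!b) * (1 - s)) ?_ ?_
      · rw [e4]; exact leftPt_mem hs1
      · rw [sub_add_cancel, m.2, e3, e4, mkS_eq_iff (rightPt_mem hs1) (leftPt_mem hs1)]
        exact Or.inr (Or.inr ⟨!b, _, hs1, rfl, (nx_not_pv b k).symm, rfl⟩)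
  · exfalso
    subst h3
    exact straight_not_edge hγ (t₀ := -h) m.1 (by rw [← m.2]; congr 1; ring)

end

/-- The suspension flow describes the trajectories of the straight-line flow. -/
theorem chartS_describes {θ : ℝ} (h : θ ∈ Icc (Real.pi / 3) (2 * Real.pi / 3)) :
    (chartS (slope θ h)).Describes fun γ => IsStraightTrajectory θ fun t => γ (t / climb θ) := by
  set κ := slope θ h with hκ
  have hroof : ∀ z, (chartS κ).roof z = 1 := by
    intro z
    have : tau κ false (returnMap κ z).2 = 1 - tau κ true z.2 :=
      tau_baseA (sec_mem z) (ne_bet z.2.2 true)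
    show tau κ true z.2 + tau κ false (returnMap κ z).2 = 1
    rw [this]; ring
  constructor
  · intro γ hγ
    rw [isStraightTrajectory_iff h] at hγ
    obtain ⟨t₀, k, a, ha, h0⟩ := straight_start hγ
    have hB : a ∈ Bset κ := by
      refine mem_Bset_of_step (Q := fun k a => a ∈ Ioo (0 : ℝ) 1 ∧ ∃ t₀, γ t₀ = mkS k (ray κ a 0))
        ?_ (k := k) ⟨ha, t₀, h0⟩
      rintro k a ⟨ha, t, ht⟩
      refine ⟨ha, fun b => ⟨baseA_mem_Ioo ha ?_, _, straight_step hγ ha ht b⟩⟩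
      refine straight_ne_bet hγ (t₀ := t) (σ₀ := 0) ha ⟨?_, tau_pos ha⟩ (by rw [add_zero]; exact ht) b
      have := tau_pos (κ := κ) (b := false) ha
      linarith
    exact ⟨t₀, (k, ⟨a, hB⟩), h0⟩
  · intro γ t₀ z hγ h0
    rw [isStraightTrajectory_iff h] at hγ
    have h0 : γ t₀ = mkS z.1 (ray κ z.2 0) := h0
    refine ⟨fun σ h1 h2 => ?_, ?_, ?_⟩
    · refine (straight_chord hγ (t₀ := t₀) (σ₀ := 0) (sec_mem z) ⟨?_, tau_pos (sec_mem z)⟩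
        (by rw [add_zero]; exact h0) ⟨h1, h2⟩).2
      have := tau_pos (κ := κ) (b := false) (sec_mem z)
      linarith
    · rw [hroof]; exact straight_step hγ (sec_mem z) h0 true
    · rw [hroof]
      exact straight_step hγ (sec_mem z) h0 false
  · intro γ hγ
    rw [isStraightTrajectory_iff h]
    intro t
    obtain ⟨⟨z, σ, ε, hε, h1, h2, h3⟩, ⟨z', σ', ε', hε', h1', h2', h3'⟩⟩ := hγ t
    refine ⟨min ε ε', lt_min hε hε', ⟨(z.1, z.2, σ), fun s hs => ?_⟩,
      ⟨(z'.1, z'.2, σ'), fun s hs => ?_⟩⟩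
    · have hs' := hs.2.trans (min_le_left _ _)
      have h1 : -tau κ false z.2 ≤ σ := h1
      have h2 : σ + ε ≤ tau κ true z.2 := h2
      exact ⟨ray_mem_of_mem (sec_mem z) (ne_bet z.2.2) (by linarith [hs.1]) (by linarith),
        h3 s ⟨hs.1, hs'⟩⟩
    · have hs' := hs.2.trans (min_le_right _ _)
      have h1 : -tau κ false z'.2 ≤ σ' - ε' := h1'
      have h2 : σ' ≤ tau κ true z'.2 := h2'
      exact ⟨ray_mem_of_mem (sec_mem z') (ne_bet z'.2.2) (by dsimp only; linarith)
        (by dsimp only; linarith [hs.1]), h3' s ⟨hs.1, hs'⟩⟩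

/-! ### Frames -/

/-- The index before (`b = true`) or after `i`. -/
def turn (b : Bool) (i : Fin 3) : Fin 3 := if b then i - 1 else i + 1

lemma eq_or_turn (i j : Fin 3) : j = i ∨ ∃ b, j = turn b i := by
  fin_cases i <;> fin_cases j <;> simp [turn]
  decide

lemma v_turn (b : Bool) (i : Fin 3) : v (turn b i) = v i * pt (-(1 / 2)) (-sg b) := by
  have h : (-1 : Fin 3) = 2 := by decide
  fin_cases i <;> cases b <;>
    simp [turn, h, v_zero, v_one, v_two, pt_mul, pt_inj] <;> norm_num

lemma two_mul_pt (x y : ℝ) : (2 : ℂ) * pt x y = pt (2 * x) (2 * y) := by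
  rw [← ofReal_mul_pt]; norm_num

lemma v_mul_conj (i : Fin 3) : v i * (starRingEnd ℂ) (v i) = 1 := by
  have : (1 : ℂ) = pt 1 0 := Complex.ext rfl (by simp)
  rw [this]
  fin_cases i <;> simp [v_zero, v_one, v_two, pt_conj, pt_mul, pt_inj] <;> norm_num

lemma v_ne_zero (i : Fin 3) : v i ≠ 0 := fun h => by
  have := v_mul_conj i
  rw [h] at this
  simp at this

lemma norm_v (i : Fin 3) : ‖v i‖ = 1 := by
  have h := v_mul_conj i
  rw [Complex.mul_conj, Complex.normSq_eq_norm_sq] at h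
  have h2 : ‖v i‖ ^ 2 = 1 := by exact_mod_cast h
  nlinarith [norm_nonneg (v i)]

lemma ctr_add (c c' : ℤ × ℤ) : ctr (c + c') = ctr c + ctr c' := by
  simp only [ctr, Prod.fst_add, Prod.snd_add, Int.cast_add]; ring

lemma ctr_neg (c : ℤ × ℤ) : ctr (-c) = -ctr c := by
  simp only [ctr, Prod.fst_neg, Prod.snd_neg, Int.cast_neg]; ring

lemma ctr_sub (c c' : ℤ × ℤ) : ctr (c - c') = ctr c - ctr c' := by
  rw [sub_eq_add_neg, ctr_add, ctr_neg, sub_eq_add_neg]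

lemma ctr_eq (c : ℤ × ℤ) : ctr c = pt (2 * c.1 - c.2) (2 * c.2) := by
  simp only [ctr, v_zero, v_one]
  have h1 : (2 * (c.1 : ℂ)) = ((2 * c.1 : ℝ) : ℂ) := by push_cast; ring
  have h2 : (2 * (c.2 : ℂ)) = ((2 * c.2 : ℝ) : ℂ) := by push_cast; ring
  rw [h1, h2, ofReal_mul_pt, ofReal_mul_pt, pt_add, pt_inj]
  constructor <;> ring

lemma ctr_e (i : Fin 3) : ctr (e i) = 2 * v i := by
  rw [ctr_eq]
  fin_cases i <;> simp [e, v_zero, v_one, v_two, two_mul_pt, pt_inj]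
  norm_num

/-- The frame of the rhombus `Rⁱ_c`: its center is moved to `c` and its axis is rotated to `vᵢ`. -/
def fr (k : Idx) (w : ℂ) : ℂ := ctr k.2 + v k.1 * w

lemma fr_injective (k : Idx) : Function.Injective (fr k) := fun _ _ h =>
  mul_left_cancel₀ (v_ne_zero k.1) (add_left_cancel h)

lemma fr_continuous (k : Idx) : Continuous (fr k) := by
  unfold fr; fun_prop

lemma exists_fr (k : Idx) (z : ℂ) : ∃ x y, z = fr k (pt x y) := by
  obtain ⟨x, y, h⟩ := exists_pt ((z - ctr k.2) / v k.1)
  refine ⟨x, y, ?_⟩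
  rw [fr, ← h, mul_div_cancel₀ _ (v_ne_zero k.1)]
  ring

/-- The inverse of a frame. -/
def unfr (k : Idx) (z : ℂ) : ℂ := (z - ctr k.2) / v k.1

@[simp] lemma unfr_fr (k : Idx) (w : ℂ) : unfr k (fr k w) = w := by
  simp only [unfr, fr]; rw [add_sub_cancel_left, mul_div_cancel_left₀ _ (v_ne_zero k.1)]

@[simp] lemma fr_unfr (k : Idx) (z : ℂ) : fr k (unfr k z) = z := by
  simp only [unfr, fr]; rw [mul_div_cancel₀ _ (v_ne_zero k.1)]; ring

lemma unfr_continuous (k : Idx) : Continuous (unfr k) := by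
  unfold unfr; fun_prop

/-- Two frames of one hexagon. -/
lemma fr_turn (b : Bool) (i : Fin 3) (c : ℤ × ℤ) (x y : ℝ) : fr (turn b i, c) (pt x y) =
    fr (i, c) (pt (-(x / 2) + 3 / 4 * (sg b * y)) (-(sg b * x) - y / 2)) := by
  simp only [fr]
  rw [v_turn, mul_assoc, pt_mul]
  congr 3 <;> ring

lemma nx_eq (b : Bool) (k : Idx) : nx b k = (turn b k.1, k.2 - e (turn b k.1)) := rfl

/-- The frame of the next hexagon. -/
lemma fr_nx (b : Bool) (k : Idx) (x y : ℝ) : fr (nx b k) (pt x y) =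
    fr k (pt (1 - x / 2 + 3 / 4 * (sg b * y)) (2 * sg b - sg b * x - y / 2)) := by
  rw [nx_eq]
  simp only [fr]
  rw [ctr_sub, ctr_e, v_turn, mul_assoc, pt_mul]
  have e1 : ctr k.2 - 2 * (v k.1 * pt (-(1 / 2)) (-sg b)) +
      v k.1 * pt (-(1 / 2) * x - 3 / 4 * (-sg b * y)) (-(1 / 2) * y + -sg b * x) =
      ctr k.2 + v k.1 * (pt (-(1 / 2) * x - 3 / 4 * (-sg b * y)) (-(1 / 2) * y + -sg b * x) -
        2 * pt (-(1 / 2)) (-sg b)) := by ring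
  rw [e1, two_mul_pt, pt_sub]
  congr 3 <;> ring

/-- The position of the up-pointing triangle on the top edge of a hexagon, seen in the frame with
axis `vᵢ`, relative to that hexagon. -/
def triShift : Fin 3 → ℤ × ℤ := ![0, e 2, -e 1]

/-- The triangle on the edge of a hexagon that is at the top (`b = true`) or at the bottom in the
frame `k`. -/
def triTile (b : Bool) (k : Idx) : Tile :=
  if b then Tile.up (k.2 + triShift k.1) else Tile.down (k.2 - triShift k.1)

/-- The frame with axis `vⱼ` in which the triangle `triTile b k` is at the top, respectively
at the bottom. -/
def triFrame (b : Bool) (k : Idx) (j : Fin 3) : Idx :=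
  (j, if b then k.2 + triShift k.1 - triShift j else k.2 - triShift k.1 + triShift j)

lemma triFrame_self (b : Bool) (k : Idx) : triFrame b k k.1 = k := by
  cases b <;> simp [triFrame]

lemma triTile_eq_iff {b b' : Bool} {k k' : Idx} :
    triTile b k = triTile b' k' ↔ b = b' ∧ k' = triFrame b k k'.1 := by
  obtain ⟨i, c⟩ := k
  obtain ⟨j, c'⟩ := k'
  cases b <;> cases b' <;> simp [triTile, triFrame]
  · constructor
    · intro h; rw [h]; simp
    · intro h; rw [h]; simp
  · constructor
    · intro h; rw [h]; simp
    · intro h; rw [h]; simp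

lemma triTile_ne_hex (b : Bool) (k : Idx) (c : ℤ × ℤ) : triTile b k ≠ Tile.hex c := by
  cases b <;> simp [triTile]

/-- Two frames of one triangle differ by a rotation about the center of the triangle. -/
lemma fr_triFrame (b b' : Bool) (k : Idx) (x y : ℝ) :
    fr (triFrame b k (turn b' k.1)) (pt x y) =
      fr k (pt (-(x / 2) + 3 / 4 * (sg b' * y) - sg b' * sg b)
        (-(sg b' * x) - y / 2 + 2 * sg b)) := by
  obtain ⟨i, c⟩ := k
  have e0 : ctr (0 : ℤ × ℤ) = 0 := by simp [ctr]
  have h3 : (-1 : Fin 3) = 2 := by decide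
  have e1 : ctr (triFrame b (i, c) (turn b' i)).2 =
      ctr c + ((sg b : ℝ) : ℂ) * (ctr (triShift i) - ctr (triShift (turn b' i))) := by
    cases b <;> simp [triFrame, ctr_add, ctr_sub] <;> ring
  simp only [fr]
  rw [e1, add_assoc]
  congr 1
  show _ + v (turn b' i) * pt x y = v i * _
  rw [v_turn]
  fin_cases i <;> cases b' <;>
    simp [turn, triShift, h3, e0, ctr_e, ctr_neg, v_zero, v_one, v_two, two_mul_pt, ofReal_mul_pt,
      pt_sub, pt_add, pt_neg, pt_mul, pt_inj] <;>
    constructor <;> ring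

/-! ### The tiles in the frames -/

/-- The vertices of the regular hexagon around the origin. -/
def hexCorners : Set ℂ :=
  {pt 1 0, pt (-1) 0, pt (1 / 2) 1, pt (1 / 2) (-1), pt (-(1 / 2)) 1, pt (-(1 / 2)) (-1)}

/-- The vertices of the triangle on the top or bottom edge of this hexagon. -/
def triCorners (b : Bool) : Set ℂ := {pt (1 / 2) (sg b), pt (-(1 / 2)) (sg b), pt 0 (2 * sg b)}

lemma corners_hex (k : Idx) : (Tile.hex k.2).corners = fr k '' hexCorners := by
  obtain ⟨i, c⟩ := k
  have key : ∀ w : ℂ, (∃ j, w = v j ∨ w = -v j) ↔ w ∈ (fun u => v i * u) '' hexCorners := by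
    intro w
    simp only [hexCorners, image_insert_eq, image_singleton, mem_insert_iff, mem_singleton_iff]
    rw [show (∃ j, w = v j ∨ w = -v j) ↔ ((w = v 0 ∨ w = -v 0) ∨ (w = v 1 ∨ w = -v 1) ∨
      (w = v 2 ∨ w = -v 2)) by
        constructor
        · rintro ⟨j, hj⟩; fin_cases j <;> simp at hj <;> tauto
        · rintro (h | h | h); exacts [⟨0, h⟩, ⟨1, h⟩, ⟨2, h⟩]]
    fin_cases i <;> simp [v_zero, v_one, v_two, pt_mul, pt_neg] <;> norm_num <;> tauto
  ext z
  have := key (z - ctr c)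
  simp only [Tile.corners, mem_ofPred_eq]
  rw [show fr (i, c) '' hexCorners =
    (fun u => ctr c + u) '' ((fun u => v i * u) '' hexCorners) by rw [image_image]; rfl]
  constructor
  · rintro ⟨j, hj⟩
    refine ⟨z - ctr c, this.1 ⟨j, ?_⟩, by ring⟩
    rcases hj with rfl | rfl
    · left; ring
    · right; ring
  · rintro ⟨w, hw, rfl⟩
    obtain ⟨j, hj⟩ := (key w).2 hw
    refine ⟨j, ?_⟩
    rcases hj with rfl | rfl
    · left; ring
    · right; ring

lemma corners_tri (b : Bool) (k : Idx) : (triTile b k).corners = fr k '' triCorners b := by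
  obtain ⟨i, c⟩ := k
  have e0 : ctr (0 : ℤ × ℤ) = 0 := by simp [ctr]
  have hc : ∃ x y, ctr c = pt x y := exists_pt _
  obtain ⟨x, y, hc⟩ := hc
  ext z
  cases b <;> fin_cases i <;>
    simp [triTile, Tile.corners, triCorners, fr, triShift, ctr_sub, ctr_add, ctr_neg, ctr_e, hc,
      v_zero, v_one, v_two, two_mul_pt, pt_add, pt_sub, pt_mul, pt_neg] <;>
    ring_nf <;> simp only [eq_comm (a := z)] <;> tauto

lemma convexHull_fr (k : Idx) (s : Set ℂ) :
    convexHull ℝ (fr k '' s) = fr k '' convexHull ℝ s := by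
  let A : ℂ →ᵃ[ℝ] ℂ := (LinearMap.mulLeft ℝ (v k.1)).toAffineMap + AffineMap.const ℝ ℂ (ctr k.2)
  have hA : (A : ℂ → ℂ) = fr k := by
    funext w
    simp [A, fr, add_comm]
  rw [← hA]
  exact (AffineMap.image_convexHull A s).symm

lemma fr_mem_hex_region (k : Idx) (w : ℂ) :
    fr k w ∈ (Tile.hex k.2).region ↔ w ∈ convexHull ℝ hexCorners ∧ w ∉ hexCorners := by
  rw [Tile.region, corners_hex k, convexHull_fr, Set.mem_sdiff, (fr_injective k).mem_set_image,
    (fr_injective k).mem_set_image]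

lemma fr_mem_tri_region (b : Bool) (k : Idx) (w : ℂ) :
    fr k w ∈ (triTile b k).region ↔ w ∈ convexHull ℝ (triCorners b) ∧ w ∉ triCorners b := by
  rw [Tile.region, corners_tri b k, convexHull_fr, Set.mem_sdiff, (fr_injective k).mem_set_image,
    (fr_injective k).mem_set_image]

lemma mem_convexHull_hex {b : Bool} {x s : ℝ} (hs : 0 ≤ s) :
    pt x (sg b * s) ∈ convexHull ℝ hexCorners ↔ s ≤ 1 ∧ |x| ≤ 1 - s / 2 := by
  constructor
  · intro h
    have key : ∀ p q r : ℝ, p ≤ r → -p ≤ r → p / 2 + q ≤ r → p / 2 - q ≤ r → -p / 2 + q ≤ r →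
        -p / 2 - q ≤ r → p * x + q * (sg b * s) ≤ r := by
      intro p q r h1 h2 h3 h4 h5 h6
      rw [← pt_mem_halfPlane]
      refine convexHull_min ?_ (convex_halfPlane p q r) h
      rintro z (rfl | rfl | rfl | rfl | rfl | rfl) <;> rw [pt_mem_halfPlane] <;> linarith
    have h1 := key 0 (sg b) 1 (by norm_num) (by norm_num) (by cases b <;> norm_num)
      (by cases b <;> norm_num) (by cases b <;> norm_num) (by cases b <;> norm_num)
    have h2 := key 2 (sg b) 2 (by norm_num) (by norm_num) (by cases b <;> norm_num)
      (by cases b <;> norm_num) (by cases b <;> norm_num) (by cases b <;> norm_num)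
    have h3 := key (-2) (sg b) 2 (by norm_num) (by norm_num) (by cases b <;> norm_num)
      (by cases b <;> norm_num) (by cases b <;> norm_num) (by cases b <;> norm_num)
    rw [← mul_assoc, sg_mul_self] at h1 h2 h3
    refine ⟨by linarith, abs_le.2 ⟨by linarith, by linarith⟩⟩
  · rintro ⟨h1, h2⟩
    rw [abs_le] at h2
    have hc := convex_convexHull ℝ hexCorners
    have m := subset_convexHull ℝ hexCorners
    have m1 : pt 1 0 ∈ hexCorners := by simp [hexCorners]
    have m2 : pt (-1) 0 ∈ hexCorners := by simp [hexCorners]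
    have m3 : pt (1 / 2) (sg b) ∈ hexCorners := by cases b <;> simp [hexCorners]
    have m4 : pt (-(1 / 2)) (sg b) ∈ hexCorners := by cases b <;> simp [hexCorners]
    -- the segment at height `s` divides both slanted sides in the ratio `s : 1 - s`
    have hw : 0 < 1 - s / 2 := by linarith
    set t := (1 + x / (1 - s / 2)) / 2 with ht
    have ht0 : 0 ≤ t := by
      have : -1 ≤ x / (1 - s / 2) := by rw [le_div_iff₀ hw]; linarith
      rw [ht]; linarith
    have ht1 : t ≤ 1 := by
      have : x / (1 - s / 2) ≤ 1 := by rw [div_le_one hw]; linarith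
      rw [ht]; linarith
    have hx : (2 * t - 1) * (1 - s / 2) = x := by
      rw [show 2 * t - 1 = x / (1 - s / 2) by rw [ht]; ring, div_mul_cancel₀ _ hw.ne']
    have l1 := hc (m m2) (m m4) (show 0 ≤ 1 - s by linarith) hs (by ring)
    have l2 := hc (m m1) (m m3) (show 0 ≤ 1 - s by linarith) hs (by ring)
    have l3 := hc l1 l2 (show 0 ≤ 1 - t by linarith) ht0 (by ring)
    convert l3 using 1
    simp only [pt_smul, pt_add, pt_inj]
    constructor
    · linear_combination -hx
    · ring

lemma mem_hex_region {k : Idx} {b : Bool} {x s : ℝ} (hs : 0 ≤ s) :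
    fr k (pt x (sg b * s)) ∈ (Tile.hex k.2).region ↔
      (s ≤ 1 ∧ |x| ≤ 1 - s / 2) ∧ |x| < 1 ∧ (s = 1 → |x| < 1 / 2) := by
  rw [fr_mem_hex_region, mem_convexHull_hex hs]
  refine and_congr_right fun h => ?_
  have hb := sg_mul_self b
  simp only [hexCorners, mem_insert_iff, mem_singleton_iff, pt_inj, not_or]
  constructor
  · rintro ⟨h1, h2, h3, h4, h5, h6⟩
    constructor
    · refine lt_of_le_of_ne (by linarith) fun h7 => ?_
      have hs0 : s = 0 := by linarith
      rcases eq_or_eq_neg_of_abs_eq h7 with h8 | h8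
      · exact h1 ⟨h8, by simp [hs0]⟩
      · exact h2 ⟨h8, by simp [hs0]⟩
    · intro hs1
      refine lt_of_le_of_ne (by linarith) fun h7 => ?_
      rcases eq_or_eq_neg_of_abs_eq h7 with h8 | h8 <;> cases b
      · exact h4 ⟨h8, by simp [hs1]⟩
      · exact h3 ⟨h8, by simp [hs1]⟩
      · exact h6 ⟨h8, by simp [hs1]⟩
      · exact h5 ⟨h8, by simp [hs1]⟩
  · rintro ⟨h1, h2⟩
    have h3 : ∀ y : ℝ, y * y = 1 → sg b * s = y → s = 1 := by
      intro y hy h4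
      have : s * s = 1 := by rw [← hy, ← h4]; linear_combination (-(s * s)) * hb
      nlinarith
    refine ⟨?_, ?_, ?_, ?_, ?_, ?_⟩ <;> rintro ⟨rfl, h4⟩
    · norm_num at h1
    · norm_num at h1
    · have := h2 (h3 _ (by norm_num) h4); norm_num [abs_of_pos] at this
    · have := h2 (h3 _ (by norm_num) h4); norm_num [abs_of_pos] at this
    · have := h2 (h3 _ (by norm_num) h4); rw [abs_neg] at this; norm_num [abs_of_pos] at this
    · have := h2 (h3 _ (by norm_num) h4); rw [abs_neg] at this; norm_num [abs_of_pos] at this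

lemma mem_convexHull_tri {b : Bool} {x s : ℝ} :
    pt x (sg b * s) ∈ convexHull ℝ (triCorners b) ↔ 1 ≤ s ∧ |x| ≤ 1 - s / 2 := by
  have hb := sg_mul_self b
  constructor
  · intro h
    have key : ∀ p q r : ℝ, p / 2 + q ≤ r → -p / 2 + q ≤ r → 2 * q ≤ r → p * x + q * s ≤ r := by
      intro p q r h1 h2 h3
      have : pt x (sg b * s) ∈ halfPlane p (q * sg b) r := by
        refine convexHull_min ?_ (convex_halfPlane _ _ r) h
        rintro z (rfl | rfl | rfl) <;> rw [pt_mem_halfPlane]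
        · linear_combination h1 + q * hb
        · linear_combination h2 + q * hb
        · linear_combination h3 + 2 * q * hb
      rw [pt_mem_halfPlane] at this
      linear_combination this - q * s * hb
    have h1 := key 0 (-1) (-1) (by norm_num) (by norm_num) (by norm_num)
    have h2 := key 2 1 2 (by norm_num) (by norm_num) (by norm_num)
    have h3 := key (-2) 1 2 (by norm_num) (by norm_num) (by norm_num)
    refine ⟨by linarith, abs_le.2 ⟨by linarith, by linarith⟩⟩
  · rintro ⟨h1, h2⟩
    rw [abs_le] at h2
    have hc := convex_convexHull ℝ (triCorners b)
    have m := subset_convexHull ℝ (triCorners b)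
    have := Convex.combo3 hc (m (show pt (1 / 2) (sg b) ∈ triCorners b by simp [triCorners]))
      (m (show pt (-(1 / 2)) (sg b) ∈ triCorners b by simp [triCorners]))
      (m (show pt 0 (2 * sg b) ∈ triCorners b by simp [triCorners]))
      (a := x + (1 - s / 2)) (b := 1 - s / 2 - x) (c := s - 1) (by linarith) (by linarith)
      (by linarith) (by ring)
    convert this using 1
    rw [pt_smul, pt_smul, pt_smul, pt_add, pt_add, pt_inj]
    constructor <;> ring

lemma mem_tri_region {k : Idx} {b : Bool} {x s : ℝ} :
    fr k (pt x (sg b * s)) ∈ (triTile b k).region ↔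
      (1 ≤ s ∧ |x| ≤ 1 - s / 2) ∧ s < 2 ∧ (s = 1 → |x| < 1 / 2) := by
  rw [fr_mem_tri_region, mem_convexHull_tri]
  refine and_congr_right fun h => ?_
  have hb : sg b ≠ 0 := by cases b <;> simp
  have hs1 : sg b * s = sg b ↔ s = 1 := by
    constructor
    · intro h; exact mul_left_cancel₀ hb (by rw [h, mul_one])
    · rintro rfl; rw [mul_one]
  have hs2 : sg b * s = 2 * sg b ↔ s = 2 := by
    constructor
    · intro h; exact mul_left_cancel₀ hb (by rw [h, mul_comm])
    · rintro rfl; rw [mul_comm]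
  simp only [triCorners, mem_insert_iff, mem_singleton_iff, pt_inj, not_or, hs1, hs2]
  constructor
  · rintro ⟨h1, h2, h3⟩
    constructor
    · refine lt_of_le_of_ne (by linarith [abs_nonneg x]) fun h7 => h3 ⟨?_, h7⟩
      have : |x| = 0 := by linarith [abs_nonneg x]
      exact abs_eq_zero.1 this
    · intro hs1
      refine lt_of_le_of_ne (by linarith) fun h7 => ?_
      rcases eq_or_eq_neg_of_abs_eq h7 with h8 | h8
      · exact h1 ⟨h8, hs1⟩
      · exact h2 ⟨h8, hs1⟩
  · rintro ⟨h1, h2⟩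
    refine ⟨?_, ?_, ?_⟩ <;> rintro ⟨rfl, h4⟩
    · have := h2 h4; norm_num [abs_of_pos] at this
    · have := h2 h4; rw [abs_neg] at this; norm_num [abs_of_pos] at this
    · linarith

/-! ### The gluing of the tiles -/

/-- The point `m v₀ + n v₁` of the lattice `Λ`. -/
def lat (p : ℤ × ℤ) : ℂ := pt (p.1 - p.2 / 2) p.2

lemma lat_injective : Function.Injective lat := by
  rintro ⟨m, n⟩ ⟨m', n'⟩ h
  rw [lat, lat, pt_inj] at h
  dsimp only at h
  have h2 : n = n' := by exact_mod_cast h.2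
  subst h2
  have h1 : (m : ℝ) = m' := by linarith [h.1]
  simpa using h1

lemma ctr_eq_lat (c : ℤ × ℤ) : ctr c = lat (2 * c.1, 2 * c.2) := by
  rw [ctr_eq, lat, pt_inj]; push_cast; constructor <;> ring

lemma lat_add (p q : ℤ × ℤ) : lat p + lat q = lat (p + q) := by
  rw [lat, lat, lat, pt_add, pt_inj, Prod.fst_add, Prod.snd_add]; push_cast; constructor <;> ring

lemma lat_sub (p q : ℤ × ℤ) : lat p - lat q = lat (p - q) := by
  rw [lat, lat, lat, pt_sub, pt_inj, Prod.fst_sub, Prod.snd_sub]; push_cast; constructor <;> ring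

lemma lat_neg (p : ℤ × ℤ) : -lat p = lat (-p) := by
  rw [lat, lat, pt_neg, pt_inj, Prod.fst_neg, Prod.snd_neg]; push_cast; constructor <;> ring

lemma v_zero_eq_lat : v 0 = lat (1, 0) := by rw [v_zero, lat, pt_inj]; norm_num

lemma v_one_eq_lat : v 1 = lat (0, 1) := by rw [v_one, lat, pt_inj]; norm_num

lemma v_two_eq_lat : v 2 = lat (-1, -1) := by rw [v_two, lat, pt_inj]; norm_num

lemma exists_lat_of_mem_hex {c : ℤ × ℤ} {z : ℂ} (h : z ∈ (Tile.hex c).corners) :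
    ∃ p : ℤ × ℤ, z = lat p ∧ -1 ≤ p.1 - 2 * c.1 ∧ p.1 - 2 * c.1 ≤ 1 ∧ -1 ≤ p.2 - 2 * c.2 ∧
      p.2 - 2 * c.2 ≤ 1 ∧ -1 ≤ p.1 - 2 * c.1 - (p.2 - 2 * c.2) ∧
      p.1 - 2 * c.1 - (p.2 - 2 * c.2) ≤ 1 ∧ (p.1 - 2 * c.1 ≠ 0 ∨ p.2 - 2 * c.2 ≠ 0) := by
  obtain ⟨i, hi⟩ := h
  rw [ctr_eq_lat] at hi
  fin_cases i <;> simp [v_zero_eq_lat, v_one_eq_lat, v_two_eq_lat, lat_add, lat_sub] at hi <;>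
    rcases hi with hi | hi <;> exact ⟨_, hi, by simp⟩

/-- The sign of `b`, as an integer. -/
def isg (b : Bool) : ℤ := if b then 1 else -1

lemma exists_lat_of_mem_tri {b : Bool} {c : ℤ × ℤ} {z : ℂ}
    (h : z ∈ (triTile b (0, c)).corners) :
    ∃ p : ℤ × ℤ, z = lat p ∧ ((p.1 = 2 * c.1 + isg b ∧ p.2 = 2 * c.2 + isg b) ∨
      (p.1 = 2 * c.1 ∧ p.2 = 2 * c.2 + isg b) ∨
      (p.1 = 2 * c.1 + isg b ∧ p.2 = 2 * c.2 + 2 * isg b)) := by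
  cases b <;> simp [triTile, triShift, Tile.corners, ctr_eq_lat, v_one_eq_lat, v_two_eq_lat,
    lat_add, lat_sub] at h <;>
    rcases h with h | h | h <;> exact ⟨_, h, by simp [isg]; try omega⟩

/-- The ends of the edge between the hexagon and the triangle of the frame `k`. -/
def edgeEnd (b : Bool) (k : Idx) (b' : Bool) : ℂ := fr k (pt (sg b' / 2) (sg b))

lemma edgeEnd_true_sub_false (b : Bool) (k : Idx) : edgeEnd b k true - edgeEnd b k false = v k.1 := by
  simp only [edgeEnd, fr]
  rw [add_sub_add_left_eq_sub, ← mul_sub, pt_sub]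
  have : (1 : ℂ) = pt 1 0 := Complex.ext rfl (by simp)
  conv_rhs => rw [← mul_one (v k.1), this]
  congr 2 <;> norm_num

lemma edgeEnd_true (b : Bool) (k : Idx) : edgeEnd b k true = ctr k.2 - v (turn b k.1) := by
  rw [edgeEnd, fr, v_turn, sub_eq_add_neg, ← mul_neg, pt_neg]; simp

lemma edgeEnd_false (b : Bool) (k : Idx) : edgeEnd b k false = ctr k.2 + v (turn (!b) k.1) := by
  rw [edgeEnd, fr, v_turn, sg_not]
  congr 3 <;> simp
  norm_num

lemma edgeEnd_mem_hex (b : Bool) (k : Idx) (b' : Bool) : edgeEnd b k b' ∈ (Tile.hex k.2).corners := by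
  cases b'
  · exact ⟨_, Or.inl (edgeEnd_false b k)⟩
  · exact ⟨_, Or.inr (edgeEnd_true b k)⟩

lemma edgeEnd_mem_tri (b : Bool) (k : Idx) (b' : Bool) : edgeEnd b k b' ∈ (triTile b k).corners := by
  rw [corners_tri]
  refine mem_image_of_mem _ ?_
  cases b' <;> simp [triCorners]
  right; left; congr 1; norm_num

/-- The lattice coordinates of the ends of the edges of the hexagon around the origin. -/
def edgeLat : Fin 3 → Bool → ℤ × ℤ :=
  ![fun b => if b then (1, 1) else (0, 1), fun b => if b then (-1, 0) else (-1, -1),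
    fun b => if b then (0, -1) else (1, 0)]

lemma edgeEnd_eq_lat (b : Bool) (i : Fin 3) (c : ℤ × ℤ) (b' : Bool) : edgeEnd b (i, c) b' =
    lat (2 * c.1 + isg b * (edgeLat i (b == b')).1, 2 * c.2 + isg b * (edgeLat i (b == b')).2) := by
  have h02 : (-1 : Fin 3) = 2 := by decide
  have h12 : (1 : Fin 3) + 1 = 2 := by decide
  cases b' <;> simp only [edgeEnd_true, edgeEnd_false, ctr_eq_lat] <;> fin_cases i <;> cases b <;>
    simp [turn, v_zero_eq_lat, v_one_eq_lat, v_two_eq_lat, lat_add, lat_neg, h02, h12, isg,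
      edgeLat, sub_eq_add_neg]

lemma triTile_eq_zero (b : Bool) (i : Fin 3) (c : ℤ × ℤ) :
    triTile b (i, c) = triTile b (0, (c.1 + isg b * (triShift i).1, c.2 + isg b * (triShift i).2)) := by
  obtain ⟨c1, c2⟩ := c
  rw [triTile_eq_iff]
  refine ⟨rfl, Prod.ext rfl (Prod.ext ?_ ?_)⟩ <;> cases b <;> simp [triFrame, isg, triShift] <;> ring

set_option maxHeartbeats 800000 in
/-- Two common vertices of a hexagon and a triangle are the ends of an edge. -/
lemma common_hex_tri {b : Bool} {c c' : ℤ × ℤ} {z w : ℂ} (hne : z ≠ w)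
    (hz : z ∈ (Tile.hex c).corners) (hz' : z ∈ (triTile b (0, c')).corners)
    (hw : w ∈ (Tile.hex c).corners) (hw' : w ∈ (triTile b (0, c')).corners) :
    ∃ i b', triTile b (0, c') = triTile b (i, c) ∧ z = edgeEnd b (i, c) b' ∧
      w = edgeEnd b (i, c) (!b') := by
  obtain ⟨⟨m, n⟩, rfl, h1⟩ := exists_lat_of_mem_hex hz
  obtain ⟨p', e1, h2⟩ := exists_lat_of_mem_tri hz'
  obtain rfl := lat_injective e1
  obtain ⟨⟨m', n'⟩, rfl, h3⟩ := exists_lat_of_mem_hex hw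
  obtain ⟨p', e2, h4⟩ := exists_lat_of_mem_tri hw'
  obtain rfl := lat_injective e2
  obtain ⟨c1, c2⟩ := c
  obtain ⟨c1', c2'⟩ := c'
  have hne' : ¬ (m = m' ∧ n = n') := by rintro ⟨rfl, rfl⟩; exact hne rfl
  simp only at h1 h2 h3 h4
  suffices ∃ i b', (c1' = c1 + isg b * (triShift i).1 ∧ c2' = c2 + isg b * (triShift i).2) ∧
      (m = 2 * c1 + isg b * (edgeLat i (b == b')).1 ∧
        n = 2 * c2 + isg b * (edgeLat i (b == b')).2) ∧
      (m' = 2 * c1 + isg b * (edgeLat i (b == !b')).1 ∧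
        n' = 2 * c2 + isg b * (edgeLat i (b == !b')).2) by
    obtain ⟨i, b', ⟨h5, h6⟩, ⟨h7, h8⟩, h9, h10⟩ := this
    refine ⟨i, b', ?_, ?_, ?_⟩
    · rw [triTile_eq_zero b i, h5, h6]
    · rw [edgeEnd_eq_lat, h7, h8]
    · rw [edgeEnd_eq_lat, h9, h10]
  -- the vertices of a hexagon, in lattice coordinates relative to its center
  replace h1 : -1 ≤ m - 2 * c1 ∧ m - 2 * c1 ≤ 1 ∧ -1 ≤ n - 2 * c2 ∧ n - 2 * c2 ≤ 1 ∧
      -1 ≤ m - 2 * c1 - (n - 2 * c2) ∧ m - 2 * c1 - (n - 2 * c2) ≤ 1 := by tauto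
  replace h3 : -1 ≤ m' - 2 * c1 ∧ m' - 2 * c1 ≤ 1 ∧ -1 ≤ n' - 2 * c2 ∧ n' - 2 * c2 ≤ 1 ∧
      -1 ≤ m' - 2 * c1 - (n' - 2 * c2) ∧ m' - 2 * c1 - (n' - 2 * c2) ≤ 1 := by tauto
  rcases h2 with ⟨rfl, rfl⟩ | ⟨rfl, rfl⟩ | ⟨rfl, rfl⟩ <;>
    rcases h4 with ⟨rfl, rfl⟩ | ⟨rfl, rfl⟩ | ⟨rfl, rfl⟩
  · exact (hne' ⟨rfl, rfl⟩).elim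
  · refine ⟨0, b, ?_⟩
    cases b <;> simp [isg, triShift, edgeLat] at h1 h3 ⊢ <;> omega
  · refine ⟨1, !b, ?_⟩
    cases b <;> simp [isg, triShift, e, edgeLat] at h1 h3 ⊢ <;> omega
  · refine ⟨0, !b, ?_⟩
    cases b <;> simp [isg, triShift, edgeLat] at h1 h3 ⊢ <;> omega
  · exact (hne' ⟨rfl, rfl⟩).elim
  · refine ⟨2, b, ?_⟩
    cases b <;> simp [isg, triShift, e, edgeLat] at h1 h3 ⊢ <;> omega
  · refine ⟨1, b, ?_⟩
    cases b <;> simp [isg, triShift, e, edgeLat] at h1 h3 ⊢ <;> omega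
  · refine ⟨2, !b, ?_⟩
    cases b <;> simp [isg, triShift, e, edgeLat] at h1 h3 ⊢ <;> omega
  · exact (hne' ⟨rfl, rfl⟩).elim

/-- Two triangles with two common vertices are equal. -/
lemma common_tri_tri {b b' : Bool} {c c' : ℤ × ℤ} {z w : ℂ} (hne : z ≠ w)
    (hz : z ∈ (triTile b (0, c)).corners) (hz' : z ∈ (triTile b' (0, c')).corners)
    (hw : w ∈ (triTile b (0, c)).corners) (hw' : w ∈ (triTile b' (0, c')).corners) :
    triTile b (0, c) = triTile b' (0, c') := by
  obtain ⟨⟨m, n⟩, rfl, h1⟩ := exists_lat_of_mem_tri hz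
  obtain ⟨p', e1, h2⟩ := exists_lat_of_mem_tri hz'
  obtain rfl := lat_injective e1
  obtain ⟨⟨m', n'⟩, rfl, h3⟩ := exists_lat_of_mem_tri hw
  obtain ⟨p', e2, h4⟩ := exists_lat_of_mem_tri hw'
  obtain rfl := lat_injective e2
  obtain ⟨c1, c2⟩ := c
  obtain ⟨c1', c2'⟩ := c'
  have hne' : ¬ (m = m' ∧ n = n') := by rintro ⟨rfl, rfl⟩; exact hne rfl
  simp only at h1 h2 h3 h4
  -- the parities of its lattice coordinates tell a vertex from the others of the triangle
  have key : b = b' ∧ c1 = c1' ∧ c2 = c2' := by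
    cases b <;> cases b' <;> simp [isg] at h1 h2 h3 h4 ⊢ <;>
    rcases h1 with h1 | h1 | h1 <;> rcases h3 with h3 | h3 | h3 <;> omega
  obtain ⟨rfl, rfl, rfl⟩ := key
  rfl

/-- Two hexagons with two common vertices are equal. -/
lemma common_hex_hex {c c' : ℤ × ℤ} {z w : ℂ} (hne : z ≠ w)
    (hz : z ∈ (Tile.hex c).corners) (hz' : z ∈ (Tile.hex c').corners)
    (hw : w ∈ (Tile.hex c).corners) (hw' : w ∈ (Tile.hex c').corners) : c = c' := by
  obtain ⟨⟨m, n⟩, rfl, h1⟩ := exists_lat_of_mem_hex hz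
  obtain ⟨p', e1, h2⟩ := exists_lat_of_mem_hex hz'
  obtain rfl := lat_injective e1
  obtain ⟨⟨m', n'⟩, rfl, h3⟩ := exists_lat_of_mem_hex hw
  obtain ⟨p', e2, h4⟩ := exists_lat_of_mem_hex hw'
  obtain rfl := lat_injective e2
  obtain ⟨c1, c2⟩ := c
  obtain ⟨c1', c2'⟩ := c'
  have hne' : ¬ (m = m' ∧ n = n') := by rintro ⟨rfl, rfl⟩; exact hne rfl
  simp only at h1 h2 h3 h4
  by_contra hc
  have hc' : c1 ≠ c1' ∨ c2 ≠ c2' := by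
    by_contra h
    push Not at h
    exact hc (by rw [h.1, h.2])
  have d1 : c1' - c1 = -1 ∨ c1' = c1 ∨ c1' - c1 = 1 := by omega
  have d2 : c2' - c2 = -1 ∨ c2' = c2 ∨ c2' - c2 = 1 := by omega
  rcases d1 with d1 | d1 | d1 <;> rcases d2 with d2 | d2 | d2 <;> omega

/-! ### Refraction in the frames -/

lemma cross_eq (z w : ℂ) : cross z w = ((starRingEnd ℂ) z * w).im := by
  simp only [cross, Complex.mul_im, Complex.conj_re, Complex.conj_im]; ring

lemma v_mul_conj' (i : Fin 3) : (starRingEnd ℂ) (v i) * v i = 1 := by rw [mul_comm, v_mul_conj]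

/-- The direction after refraction at an edge parallel to `vᵢ`. -/
def refr (i : Fin 3) (d : Circle) : Circle :=
  ⟨-(v i) ^ 2 * (starRingEnd ℂ) (d : ℂ), mem_sphere_zero_iff_norm.2 <| by
    rw [norm_mul, norm_neg, norm_pow, norm_v, Complex.norm_conj,
      Circle.norm_coe]
    norm_num⟩

lemma coe_refr (i : Fin 3) (d : Circle) :
    (refr i d : ℂ) = -(v i) ^ 2 * (starRingEnd ℂ) (d : ℂ) := rfl

lemma refr_refr (i : Fin 3) (d : Circle) : refr i (refr i d) = d := by
  apply Circle.ext
  rw [coe_refr, coe_refr]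
  simp only [map_mul, map_neg, map_pow, Complex.conj_conj]
  linear_combination (v i * (starRingEnd ℂ) (v i) + 1) * (d : ℂ) * v_mul_conj i

lemma cross_refr (i : Fin 3) (d : Circle) : cross (v i) (refr i d) = cross (v i) d := by
  rw [cross_eq, cross_eq, coe_refr]
  have : (starRingEnd ℂ) (v i) * (-(v i) ^ 2 * (starRingEnd ℂ) (d : ℂ)) =
      -(starRingEnd ℂ) ((starRingEnd ℂ) (v i) * d) := by
    rw [map_mul, Complex.conj_conj]
    linear_combination (-(v i * (starRingEnd ℂ) (d : ℂ))) * v_mul_conj i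
  rw [this, Complex.neg_im, Complex.conj_im, neg_neg]

/-- The vector `p` of a hexagon is refracted to the vector `q` of an adjacent triangle. -/
def HexTri (p q : Tile × ℂ × Circle) : Prop :=
  ∃ (b : Bool) (k : Idx) (x : ℝ), |x| < 1 / 2 ∧ p.1 = Tile.hex k.2 ∧ q.1 = triTile b k ∧
    p.2.1 = fr k (pt x (sg b)) ∧ q.2.1 = p.2.1 ∧ cross (v k.1) p.2.2 ≠ 0 ∧
    q.2.2 = refr k.1 p.2.2

lemma mem_edge {b : Bool} {k : Idx} {b' : Bool} {z : ℂ} :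
    z ∈ openSegment ℝ (edgeEnd b k b') (edgeEnd b k !b') ↔
      ∃ x : ℝ, |x| < 1 / 2 ∧ z = fr k (pt x (sg b)) := by
  have e : ∀ t : ℝ, edgeEnd b k b' + t • (edgeEnd b k (!b') - edgeEnd b k b') =
      fr k (pt (sg b' * (1 / 2 - t)) (sg b)) := by
    intro t
    simp only [edgeEnd, fr]
    rw [add_sub_add_left_eq_sub, ← mul_sub, ← mul_smul_comm, add_assoc, ← mul_add, pt_sub, pt_smul,
      pt_add, sg_not]
    congr 3 <;> ring
  rw [openSegment_eq_image', mem_image]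
  constructor
  · rintro ⟨t, ht, rfl⟩
    refine ⟨_, ?_, e t⟩
    rw [abs_lt]
    cases b' <;> simp <;> constructor <;> linarith [ht.1, ht.2]
  · rintro ⟨x, hx, rfl⟩
    rw [abs_lt] at hx
    refine ⟨1 / 2 - sg b' * x, ?_, ?_⟩
    · cases b' <;> simp <;> constructor <;> linarith
    · rw [e]
      congr 2
      linear_combination x * sg_mul_self b'

lemma tile_cases (τ : Tile) : (∃ c, τ = Tile.hex c) ∨ ∃ b c, τ = triTile b (0, c) := by
  cases τ with
  | hex c => exact Or.inl ⟨c, rfl⟩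
  | up c => exact Or.inr ⟨true, c, by simp [triTile, triShift]⟩
  | down c => exact Or.inr ⟨false, c, by simp [triTile, triShift]⟩

lemma fr_edge_mem_hex {b : Bool} {k : Idx} {x : ℝ} (hx : |x| < 1 / 2) :
    fr k (pt x (sg b)) ∈ (Tile.hex k.2).region := by
  have := mem_hex_region (k := k) (b := b) (x := x) zero_le_one
  rw [mul_one] at this
  rw [this]
  refine ⟨⟨le_rfl, by linarith⟩, by linarith, fun _ => hx⟩

lemma fr_edge_mem_tri {b : Bool} {k : Idx} {x : ℝ} (hx : |x| < 1 / 2) :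
    fr k (pt x (sg b)) ∈ (triTile b k).region := by
  have := mem_tri_region (k := k) (b := b) (x := x) (s := 1)
  rw [mul_one] at this
  rw [this]
  refine ⟨⟨le_rfl, by linarith⟩, by linarith, fun _ => hx⟩

/-- Refraction takes place exactly at the edges between a hexagon and a triangle. -/
lemma glueX_or_iff {p q : PreX} : GlueX p q ∨ GlueX q p ↔ HexTri p.1 q.1 ∨ HexTri q.1 p.1 := by
  have sq : ∀ b k b', (edgeEnd b k (!b') - edgeEnd b k b') = -sg b' * v k.1 := by
    intro b k b'
    rw [← edgeEnd_true_sub_false b k]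
    cases b' <;> simp
  have sq2 : ∀ b k b', -(edgeEnd b k (!b') - edgeEnd b k b') ^ 2 = -v k.1 ^ 2 := by
    intro b k b'
    rw [sq]
    cases b' <;> simp
  have cr : ∀ b k b' d, cross (edgeEnd b k (!b') - edgeEnd b k b') d ≠ 0 ↔ cross (v k.1) d ≠ 0 := by
    intro b k b' d
    have : cross (-sg b' * v k.1) d = -sg b' * cross (v k.1) d := by
      cases b' <;> simp [cross]; ring
    rw [sq, this]
    cases b' <;> simp
  constructor
  · have h1 : ∀ p q : PreX, GlueX p q → HexTri p.1 q.1 ∨ HexTri q.1 p.1 := by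
      rintro p q ⟨z, w, hne, hab, ha, hb, hz, ht, hz2, hd⟩
      rcases tile_cases p.1.1 with ⟨c, ep⟩ | ⟨β, c, ep⟩ <;>
        rcases tile_cases q.1.1 with ⟨c', eq⟩ | ⟨β', c', eq⟩ <;> rw [ep, eq] at ha hb hne
      · exact (hne (by rw [common_hex_hex hab ha.1 ha.2 hb.1 hb.2])).elim
      · obtain ⟨i, b', e1, rfl, rfl⟩ := common_hex_tri hab ha.1 ha.2 hb.1 hb.2
        obtain ⟨x, hx, e2⟩ := mem_edge.1 hz
        rw [cr] at ht
        rw [sq2] at hd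
        exact Or.inl ⟨β', (i, c), x, hx, ep, eq.trans e1, e2, hz2, ht, Circle.ext hd⟩
      · obtain ⟨i, b', e1, rfl, rfl⟩ := common_hex_tri hab ha.2 ha.1 hb.2 hb.1
        obtain ⟨x, hx, e2⟩ := mem_edge.1 hz
        rw [cr] at ht
        rw [sq2] at hd
        have hd' : q.1.2.2 = refr i p.1.2.2 := Circle.ext hd
        refine Or.inr ⟨β, (i, c'), x, hx, eq, ep.trans e1, hz2.trans e2, hz2.symm, ?_, ?_⟩
        · rw [hd', cross_refr]; exact ht
        · rw [hd', refr_refr]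
      · exact (hne (common_tri_tri hab ha.1 ha.2 hb.1 hb.2)).elim
    rintro (h | h)
    exacts [h1 p q h, (h1 q p h).symm]
  · have h1 : ∀ p q : PreX, HexTri p.1 q.1 → GlueX p q := by
      rintro p q ⟨b, k, x, hx, ep, eq, hz, hz2, ht, hd⟩
      refine GlueX.refract p q (edgeEnd b k true) (edgeEnd b k (!true)) ?_ ?_ ?_ ?_ ?_ ?_ hz2 ?_
      · rw [ep, eq]; exact (triTile_ne_hex b k k.2).symm
      · intro h
        have := edgeEnd_true_sub_false b k
        rw [h] at this
        exact v_ne_zero k.1 (by rw [← this]; simp)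
      · rw [ep, eq]; exact ⟨edgeEnd_mem_hex _ _ _, edgeEnd_mem_tri _ _ _⟩
      · rw [ep, eq]; exact ⟨edgeEnd_mem_hex _ _ _, edgeEnd_mem_tri _ _ _⟩
      · exact mem_edge.2 ⟨x, hx, hz⟩
      · rwa [cr]
      · rw [sq2, hd]; rfl
    rintro (h | h)
    exacts [Or.inl (h1 p q h), Or.inr (h1 q p h)]

/-- The edges of a hexagon are disjoint. -/
lemma hex_edge_unique {i j : Fin 3} {c : ℤ × ℤ} {x x' : ℝ} {b b' : Bool} (hx' : |x'| < 1 / 2)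
    (h : fr (i, c) (pt x (sg b)) = fr (j, c) (pt x' (sg b'))) : j = i ∧ b' = b := by
  rw [abs_lt] at hx'
  rcases eq_or_turn i j with rfl | ⟨β, rfl⟩
  · have := (pt_inj.1 (fr_injective _ h)).2
    cases b <;> cases b' <;> simp at this ⊢ <;> linarith
  · exfalso
    rw [fr_turn] at h
    have := (pt_inj.1 (fr_injective _ h)).2
    cases b <;> cases b' <;> cases β <;> simp at this <;> linarith

/-- The edges of a triangle are disjoint. -/
lemma tri_edge_unique {b : Bool} {k : Idx} {j : Fin 3} {x x' : ℝ} (hx' : |x'| < 1 / 2)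
    (h : fr k (pt x (sg b)) = fr (triFrame b k j) (pt x' (sg b))) : j = k.1 := by
  rw [abs_lt] at hx'
  rcases eq_or_turn k.1 j with rfl | ⟨β, rfl⟩
  · rfl
  · exfalso
    rw [fr_triFrame] at h
    have := (pt_inj.1 (fr_injective _ h)).2
    cases b <;> cases β <;> simp at this <;> linarith

lemma hexTri_right_unique {p q q' : Tile × ℂ × Circle} (h : HexTri p q) (h' : HexTri p q') :
    q = q' := by
  obtain ⟨b, ⟨i, c⟩, x, hx, e1, e2, e3, e4, -, e5⟩ := h
  obtain ⟨b', ⟨j, c'⟩, x', hx', f1, f2, f3, f4, -, f5⟩ := h'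
  have hc : c = c' := by
    rw [e1] at f1
    exact Tile.hex.inj f1
  subst hc
  rw [e3] at f3
  obtain ⟨rfl, rfl⟩ := hex_edge_unique hx' f3
  exact Prod.ext (e2.trans f2.symm) (Prod.ext (e4.trans f4.symm) (e5.trans f5.symm))

lemma hexTri_left_unique {p p' q : Tile × ℂ × Circle} (h : HexTri p q) (h' : HexTri p' q) :
    p = p' := by
  obtain ⟨b, k, x, hx, e1, e2, e3, e4, -, e5⟩ := h
  obtain ⟨b', k', x', hx', f1, f2, f3, f4, -, f5⟩ := h'
  rw [e2, triTile_eq_iff] at f2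
  obtain ⟨rfl, f2⟩ := f2
  have hz : p.2.1 = p'.2.1 := e4.symm.trans f4
  rw [e3, f3, f2] at hz
  have := tri_edge_unique hx' hz
  rw [this, triFrame_self] at f2
  subst f2
  refine Prod.ext (e1.trans f1.symm) (Prod.ext (e4.symm.trans f4) ?_)
  rw [← refr_refr k'.1 p.2.2, ← e5, f5, refr_refr]

lemma not_hexTri_hexTri {p q r : Tile × ℂ × Circle} (h : HexTri p q) (h' : HexTri q r) : False := by
  obtain ⟨b, k, x, hx, e1, e2, -⟩ := h
  obtain ⟨b', k', x', hx', f1, f2, -⟩ := h'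
  exact triTile_ne_hex b k k'.2 (e2.symm.trans f1)

lemma HexTri.mem {p q : Tile × ℂ × Circle} (h : HexTri p q) :
    p.2.1 ∈ p.1.region ∧ q.2.1 ∈ q.1.region := by
  obtain ⟨b, k, x, hx, e1, e2, e3, e4, -⟩ := h
  rw [e4, e1, e2, e3]
  exact ⟨fr_edge_mem_hex hx, fr_edge_mem_tri hx⟩

/-- The relation of being identified by refraction, on one or the other side. -/
def Refracted (p q : Tile × ℂ × Circle) : Prop := HexTri p q ∨ HexTri q p

lemma Refracted.symm {p q : Tile × ℂ × Circle} (h : Refracted p q) : Refracted q p := Or.symm h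

lemma Refracted.unique {p q q' : Tile × ℂ × Circle} (h : Refracted p q) (h' : Refracted p q') :
    q = q' := by
  rcases h with h | h <;> rcases h' with h' | h'
  · exact hexTri_right_unique h h'
  · exact (not_hexTri_hexTri h' h).elim
  · exact (not_hexTri_hexTri h h').elim
  · exact hexTri_left_unique h h'

lemma Refracted.mem {p q : Tile × ℂ × Circle} (h : Refracted p q) : q.2.1 ∈ q.1.region := by
  rcases h with h | h
  exacts [h.mem.2, h.mem.1]

instance : Nonempty X := ⟨Quot.mk _ ⟨(Tile.hex (0, 0), fr (0, 0) (pt 0 (sg true)), 1),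
  fr_edge_mem_hex (k := (0, (0, 0))) (by norm_num)⟩⟩

/-- The point of `X` given by a vector; an arbitrary point if it is not based at a point of its
tile. -/
def mkX (p : Tile × ℂ × Circle) : X :=
  open Classical in if h : p.2.1 ∈ p.1.region then Quot.mk GlueX ⟨p, h⟩ else Classical.arbitrary X

lemma mkX_of_mem {p : Tile × ℂ × Circle} (h : p.2.1 ∈ p.1.region) :
    mkX p = Quot.mk GlueX ⟨p, h⟩ := dif_pos h

lemma mkX_eq_iff {p q : Tile × ℂ × Circle} (h : p.2.1 ∈ p.1.region) (h' : q.2.1 ∈ q.1.region) :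
    mkX p = mkX q ↔ p = q ∨ Refracted p q := by
  rw [mkX_of_mem h, mkX_of_mem h', quot_mk_eq_iff, Subtype.mk.injEq, glueX_or_iff]
  · rfl
  · intro p q q' h h'
    rw [glueX_or_iff] at h h'
    exact Subtype.ext (Refracted.unique h h')

lemma Refracted.mkX_eq {p q : Tile × ℂ × Circle} (h : Refracted p q) : mkX p = mkX q :=
  (mkX_eq_iff h.symm.mem h.mem).2 (Or.inr h)

lemma mkX_continuousOn : ContinuousOn mkX {p | p.2.1 ∈ p.1.region} := by
  rw [continuousOn_iff_continuous_domRestrict]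
  exact continuous_quot_mk.congr fun p => (mkX_of_mem p.2).symm

/-! ### The refracted lines -/

lemma norm_dir (θ : ℝ) : ‖dir θ‖ = 1 := Complex.norm_exp_ofReal_mul_I θ

/-- The direction of the flow `T_{θ,+}` in a hexagon, seen from the frame with axis `vᵢ`. -/
def hexDir (θ : ℝ) (i : Fin 3) : Circle :=
  ⟨dir θ * v i, mem_sphere_zero_iff_norm.2 <| by rw [norm_mul, norm_dir, norm_v, one_mul]⟩

/-- The direction of the flow `T_{θ,+}` in a triangle, seen from the frame with axis `vᵢ`. -/
def triDir (θ : ℝ) (i : Fin 3) : Circle :=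
  ⟨-(starRingEnd ℂ) (dir θ) * v i, mem_sphere_zero_iff_norm.2 <| by
    rw [norm_mul, norm_neg, Complex.norm_conj, norm_dir, norm_v, one_mul]⟩

lemma coe_hexDir (θ : ℝ) (i : Fin 3) : (hexDir θ i : ℂ) = dir θ * v i := rfl

lemma coe_triDir (θ : ℝ) (i : Fin 3) : (triDir θ i : ℂ) = -(starRingEnd ℂ) (dir θ) * v i := rfl

lemma dir_ne_zero (θ : ℝ) : dir θ ≠ 0 := fun h => by
  have := norm_dir θ
  rw [h] at this; simp at this

lemma v_injective : Function.Injective v := by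
  intro i j h
  rcases eq_or_turn i j with rfl | ⟨b, rfl⟩
  · rfl
  · exfalso
    rw [v_turn] at h
    have : (1 : ℂ) = pt (-(1 / 2)) (-sg b) := mul_left_cancel₀ (v_ne_zero i) (by rw [mul_one, ← h])
    have := congrArg Complex.re this
    simp at this
    linarith

lemma hexDir_injective (θ : ℝ) : Function.Injective (hexDir θ) := fun i j h => by
  have := congrArg (fun d : Circle => (d : ℂ)) h
  exact v_injective (mul_left_cancel₀ (dir_ne_zero θ) this)

lemma triDir_injective (θ : ℝ) : Function.Injective (triDir θ) := fun i j h => by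
  have := congrArg (fun d : Circle => (d : ℂ)) h
  exact v_injective (mul_left_cancel₀ (by simpa using dir_ne_zero θ) this)

lemma refr_hexDir (θ : ℝ) (i : Fin 3) : refr i (hexDir θ i) = triDir θ i := by
  apply Circle.ext
  rw [coe_refr, coe_hexDir, coe_triDir, map_mul]
  linear_combination (-(v i * (starRingEnd ℂ) (dir θ))) * v_mul_conj i

lemma refr_turn_hexDir (θ : ℝ) (b : Bool) (i : Fin 3) :
    refr (turn (!b) i) (hexDir θ (turn b i)) = triDir θ i := by
  apply Circle.ext
  rw [coe_refr, coe_hexDir, coe_triDir, map_mul, v_turn, v_turn, map_mul, pt_conj]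
  have e : pt (-(1 / 2)) (-sg (!b)) ^ 2 * pt (-(1 / 2)) (- -sg b) = 1 := by
    have : (1 : ℂ) = pt 1 0 := Complex.ext rfl (by simp)
    rw [this]
    cases b <;> simp [sq, pt_mul, pt_inj] <;> norm_num
  linear_combination (-(v i ^ 2 * (starRingEnd ℂ) (v i) * (starRingEnd ℂ) (dir θ))) * e
    - (v i * (starRingEnd ℂ) (dir θ)) * v_mul_conj i

lemma cross_v_hexDir (θ : ℝ) (i : Fin 3) : cross (v i) (hexDir θ i) = Real.sin θ := by
  rw [cross_eq, coe_hexDir, show (starRingEnd ℂ) (v i) * (dir θ * v i) =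
    (starRingEnd ℂ) (v i) * v i * dir θ by ring, v_mul_conj', one_mul, dir_im]

section

variable {θ : ℝ} (h : θ ∈ Icc (Real.pi / 3) (2 * Real.pi / 3))

lemma cross_v_turn_hexDir (b : Bool) (i : Fin 3) :
    cross (v (turn (!b) i)) (hexDir θ (turn b i)) = -(Real.sin θ * bet (slope θ h) b) := by
  have e : (starRingEnd ℂ) (v (turn (!b) i)) * (dir θ * v (turn b i)) =
      dir θ * pt (-(1 / 2)) (sg b) := by
    rw [v_turn, v_turn, map_mul, pt_conj]
    have e : pt (-(1 / 2)) (- -sg (!b)) * pt (-(1 / 2)) (-sg b) = pt (-(1 / 2)) (sg b) := by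
      cases b <;> simp [pt_mul, pt_inj] <;> norm_num
    linear_combination (v i * (starRingEnd ℂ) (v i) * dir θ) * e +
      (dir θ * pt (-(1 / 2)) (sg b)) * v_mul_conj i
  have hs := sin_pos_of_mem h
  rw [cross_eq, coe_hexDir, e, dir_eq_pt h, pt_mul, pt_im, bet, climb]
  field_simp
  ring

/-- The vectors of the flow `T_{θ,+}` in the hexagon of the frame `k`, with direction close to
the normal of the axis of the frame. -/
def hexVec (k : Idx) (a σ : ℝ) : Tile × ℂ × Circle :=
  (Tile.hex k.2, fr k (ray (slope θ h) a σ), hexDir θ k.1)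

/-- The continuation of the line of vectors `hexVec k a` in the triangle at the top or bottom. -/
def triVec (b : Bool) (k : Idx) (a σ : ℝ) : Tile × ℂ × Circle :=
  (triTile b k, fr k (pt (a + slope θ h * (2 * sg b - σ)) σ), triDir θ k.1)

lemma hexVec_inj {k k' : Idx} {a a' σ σ' : ℝ} :
    hexVec h k a σ = hexVec h k' a' σ' ↔ k = k' ∧ a = a' ∧ σ = σ' := by
  constructor
  · intro e
    simp only [hexVec, Prod.mk.injEq] at e
    obtain ⟨e1, e2, e3⟩ := e
    have hk : k = k' := Prod.ext (hexDir_injective θ e3) (Tile.hex.inj e1)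
    subst hk
    exact ⟨rfl, ray_inj.1 (fr_injective k e2)⟩
  · rintro ⟨rfl, rfl, rfl⟩; rfl

lemma triVec_inj {b b' : Bool} {k k' : Idx} {a a' σ σ' : ℝ} :
    triVec h b k a σ = triVec h b' k' a' σ' ↔ b = b' ∧ k = k' ∧ a = a' ∧ σ = σ' := by
  constructor
  · intro e
    simp only [triVec, Prod.mk.injEq, triTile_eq_iff] at e
    obtain ⟨⟨rfl, e1⟩, e2, e3⟩ := e
    rw [← triDir_injective θ e3, triFrame_self] at e1
    subst e1
    have := pt_inj.1 (fr_injective _ e2)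
    obtain ⟨e4, rfl⟩ := this
    exact ⟨rfl, rfl, by linarith, rfl⟩
  · rintro ⟨rfl, rfl, rfl, rfl⟩; rfl

/-- The height at which the line through the place `a` leaves the hexagon. -/
def hexEnd (κ : Slope) (b : Bool) (a : ℝ) : ℝ := if a ≤ bet κ b then 1 else tau κ b a

lemma hexEnd_pos {κ : Slope} {b : Bool} {a : ℝ} (ha : a ∈ Ioo (0 : ℝ) 1) : 0 < hexEnd κ b a := by
  unfold hexEnd; split_ifs
  exacts [one_pos, tau_pos ha]

lemma hexEnd_le_one {κ : Slope} {b : Bool} {a : ℝ} : hexEnd κ b a ≤ 1 := by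
  unfold hexEnd; split_ifs
  exacts [le_rfl, tau_le_one a]

lemma slope_mul_sg (κ : Slope) (b : Bool) : (κ : ℝ) * sg b = 1 / 2 - bet κ b := by
  simp only [bet]; ring

lemma hexVec_mem_iff {b : Bool} {k : Idx} {a s : ℝ} (hs : 0 ≤ s) :
    (hexVec h k a (sg b * s)).2.1 ∈ (hexVec h k a (sg b * s)).1.region ↔
      (s ≤ 1 ∧ |a + s * (1 / 2 - bet (slope θ h) b)| ≤ 1 - s / 2) ∧
        |a + s * (1 / 2 - bet (slope θ h) b)| < 1 ∧
        (s = 1 → |a + s * (1 / 2 - bet (slope θ h) b)| < 1 / 2) := by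
  have e : a + (slope θ h : ℝ) * (sg b * s) = a + s * (1 / 2 - bet (slope θ h) b) := by
    rw [← slope_mul_sg]; ring
  show fr k (ray (slope θ h) a (sg b * s)) ∈ (Tile.hex k.2).region ↔ _
  rw [ray, e, mem_hex_region hs]

lemma hexVec_mem {b : Bool} {k : Idx} {a s : ℝ} (ha : a ∈ Ioo (0 : ℝ) 1) (hs : 0 ≤ s) :
    (hexVec h k a (sg b * s)).2.1 ∈ (hexVec h k a (sg b * s)).1.region ↔
      s ≤ hexEnd (slope θ h) b a ∧ (s = 1 → a < bet (slope θ h) b) := by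
  rw [hexVec_mem_iff h hs]
  have e0 := bet_nonneg (slope θ h) b
  have e1 := bet_le_one (slope θ h) b
  set β := bet (slope θ h) b
  obtain ⟨ha0, ha1⟩ := ha
  have m1 : s * β ≤ s := by nlinarith
  have m2 : 0 ≤ s * β := by positivity
  rw [abs_le, abs_lt]
  unfold hexEnd
  split_ifs with hle
  · constructor
    · rintro ⟨⟨h1, h2, h3⟩, h4, h5⟩
      refine ⟨h1, fun h6 => ?_⟩
      have := abs_lt.1 (h5 h6)
      rw [h6] at this; linarith [this.2]
    · rintro ⟨h1, h2⟩
      have m3 : s * (1 - β) ≤ 1 - β := by nlinarith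
      refine ⟨⟨h1, by linarith, by linarith⟩, ⟨by linarith, ?_⟩, ?_⟩
      · rcases hs.lt_or_eq with h6 | h6
        · linarith
        · rw [← h6]; linarith
      · intro h6
        have := h2 h6
        rw [h6, abs_lt]; constructor <;> linarith
  · have hlt := not_le.1 hle
    have hpos : 0 < 1 - β := by linarith
    rw [tau_of_gt hlt, le_div_iff₀ hpos]
    constructor
    · rintro ⟨⟨h1, h2, h3⟩, h4, h5⟩
      refine ⟨by linarith, fun h6 => ?_⟩
      have := abs_lt.1 (h5 h6)
      rw [h6] at this; linarith [this.2]
    · rintro ⟨h1, h2⟩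
      have h6 : s < 1 := by
        by_contra hh
        have : 1 * (1 - β) ≤ s * (1 - β) := mul_le_mul_of_nonneg_right (not_lt.1 hh) hpos.le
        linarith
      refine ⟨⟨h6.le, by linarith, by linarith⟩, ⟨by linarith, ?_⟩, fun h7 => by linarith⟩
      rcases hs.lt_or_eq with h6 | h6
      · linarith
      · rw [← h6]; linarith

lemma triVec_mem {b : Bool} {k : Idx} {a s : ℝ} (ha : 0 < a) :
    (triVec h b k a (sg b * s)).2.1 ∈ (triVec h b k a (sg b * s)).1.region ↔
      1 ≤ s ∧ a ≤ (2 - s) * bet (slope θ h) b ∧ (s = 1 → a < bet (slope θ h) b) := by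
  have e : a + (slope θ h : ℝ) * (2 * sg b - sg b * s) =
      a + (2 - s) * (1 / 2 - bet (slope θ h) b) := by
    rw [← slope_mul_sg]; ring
  show fr k (pt _ (sg b * s)) ∈ (triTile b k).region ↔ _
  rw [e, mem_tri_region]
  have e0 := bet_nonneg (slope θ h) b
  have e1 := bet_le_one (slope θ h) b
  set β := bet (slope θ h) b
  rw [abs_le]
  constructor
  · rintro ⟨⟨h1, h2, h3⟩, h4, h5⟩
    refine ⟨h1, by linarith, fun h6 => ?_⟩
    have := abs_lt.1 (h5 h6)
    rw [h6] at this; linarith [this.2]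
  · rintro ⟨h1, h2, h3⟩
    have h4 : s < 2 := by
      by_contra hh
      have := mul_nonneg (sub_nonneg.2 (not_lt.1 hh)) e0
      linarith
    have m : 0 ≤ (2 - s) * (1 - β) := mul_nonneg (by linarith) (by linarith)
    refine ⟨⟨h1, by linarith, by linarith⟩, h4, fun h6 => ?_⟩
    have := h3 h6
    rw [h6, abs_lt]; constructor <;> linarith

lemma triVec_mem_of_lt {b : Bool} {k : Idx} {a s : ℝ} (ha : 0 < a) (hlt : a < bet (slope θ h) b) :
    (triVec h b k a (sg b * s)).2.1 ∈ (triVec h b k a (sg b * s)).1.region ↔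
      1 ≤ s ∧ s ≤ 2 - tau (slope θ h) b a := by
  rw [triVec_mem h ha, tau_of_le hlt.le, and_iff_left fun _ => hlt]
  refine and_congr_right fun _ => ?_
  rw [← div_le_iff₀ (ha.trans hlt)]
  constructor <;> intro _ <;> linarith

lemma hexTri_top (b : Bool) (k : Idx) {a : ℝ} (ha : 0 < a) (hlt : a < bet (slope θ h) b) :
    HexTri (hexVec h k a (sg b)) (triVec h b k a (sg b)) := by
  have e := slope_mul_sg (slope θ h) b
  have e1 := bet_le_one (slope θ h) b
  refine ⟨b, k, a + slope θ h * sg b, ?_, rfl, rfl, rfl, ?_, ?_, ?_⟩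
  · rw [e, abs_lt]; constructor <;> linarith
  · show fr k _ = fr k _
    rw [ray]; congr 2; ring
  · show cross (v k.1) (hexDir θ k.1) ≠ 0
    rw [cross_v_hexDir]; exact (sin_pos_of_mem h).ne'
  · exact (refr_hexDir θ k.1).symm

/-- The line leaves the triangle into the hexagon of the frame `nx b k`. -/
lemma hexTri_next (b : Bool) (k : Idx) {a : ℝ} (ha : 0 < a) (hlt : a < bet (slope θ h) b) :
    HexTri (hexVec h (nx b k) (a + 1 - bet (slope θ h) b) (-(sg b * (1 - tau (slope θ h) b a))))
      (triVec h b k a (sg b * (2 - tau (slope θ h) b a))) := by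
  have e := slope_mul_sg (slope θ h) b
  have e1 := bet_le_one (slope θ h) b
  have e0 := ha.trans hlt
  have hb := sg_mul_self b
  have ht : tau (slope θ h) b a * bet (slope θ h) b = a := by
    rw [tau_of_le hlt.le]; field_simp
  have t0 : 0 < tau (slope θ h) b a := by rw [tau_of_le hlt.le]; positivity
  have t1 : tau (slope θ h) b a < 1 := by rw [tau_of_le hlt.le, div_lt_one e0]; exact hlt
  have hc : (triFrame b k (turn (!b) k.1)).2 = (nx b k).2 := by
    obtain ⟨i, c1, c2⟩ := k
    have h02 : (-1 : Fin 3) = 2 := by decide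
    have h12 : (1 : Fin 3) + 1 = 2 := by decide
    cases b <;> fin_cases i <;> simp [triFrame, turn, nx, triShift, Trihex.e, h02, h12] <;> ring
  have hz : fr (nx b k) (ray (slope θ h) (a + 1 - bet (slope θ h) b)
      (-(sg b * (1 - tau (slope θ h) b a)))) =
      fr (triFrame b k (turn (!b) k.1)) (pt (1 / 2 - tau (slope θ h) b a) (sg b)) := by
    rw [ray, fr_nx, fr_triFrame, sg_not]
    congr 2
    · linear_combination (-1 / 2 * (-(1 - tau (slope θ h) b a))) * e + 1 / 2 * ht -
        (3 / 4 * (1 - tau (slope θ h) b a) - 3 / 4 + 1) * hb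
    · linear_combination (sg b * (1 - tau (slope θ h) b a)) * e + sg b * ht
  refine ⟨b, triFrame b k (turn (!b) k.1), 1 / 2 - tau (slope θ h) b a, ?_, ?_, ?_, hz, ?_, ?_, ?_⟩
  · rw [abs_lt]; constructor <;> linarith
  · rw [hc]; rfl
  · exact triTile_eq_iff.2 ⟨rfl, rfl⟩
  · show fr k _ = fr (nx b k) _
    rw [ray, fr_nx]
    congr 2
    · linear_combination (1 / 2 * (-(1 - tau (slope θ h) b a)) + tau (slope θ h) b a) * e - 3 / 2 * ht
        + 3 / 4 * (1 - tau (slope θ h) b a) * hb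
    · linear_combination (-(sg b * (1 - tau (slope θ h) b a))) * e - sg b * ht
  · show cross (v (turn (!b) k.1)) (hexDir θ (turn b k.1)) ≠ 0
    rw [cross_v_turn_hexDir h, neg_ne_zero]
    exact (mul_pos (sin_pos_of_mem h) e0).ne'
  · exact (refr_turn_hexDir θ b k.1).symm

/-- `hexTri_next` seen from the hexagon which the line leaves through a slanted edge. -/
lemma hexTri_prev (b : Bool) (k : Idx) {a : ℝ} (ha : a < 1) (hlt : bet (slope θ h) b < a) :
    HexTri (hexVec h k a (sg b * tau (slope θ h) b a))
      (triVec h (!b) (pv b k) (a - bet (slope θ h) b) (sg (!b) * (1 + tau (slope θ h) b a))) := by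
  have e0 := bet_nonneg (slope θ h) b
  have e1 := bet_not (slope θ h) b
  have e2 := tau_baseA (κ := slope θ h) (b := b) ⟨e0.trans_lt hlt, ha⟩ hlt.ne'
  rw [baseA, if_neg (not_le.2 hlt)] at e2
  have := hexTri_next h (!b) (pv b k) (a := a - bet (slope θ h) b) (by linarith) (by linarith)
  rw [nx_not_pv, e2, e1, sg_not] at this
  convert this using 2
  · ring
  · ring
  · rw [sg_not]; ring

lemma refracted_hexVec {b : Bool} {k : Idx} {a s : ℝ} (ha : a ∈ Ioo (0 : ℝ) 1) (hs : 0 ≤ s)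
    {q : Tile × ℂ × Circle} (hq : Refracted (hexVec h k a (sg b * s)) q) :
    (a < bet (slope θ h) b ∧ s = 1 ∧ q = triVec h b k a (sg b)) ∨
    (bet (slope θ h) b < a ∧ s = tau (slope θ h) b a ∧
      q = triVec h (!b) (pv b k) (a - bet (slope θ h) b) (sg (!b) * (1 + tau (slope θ h) b a))) := by
  have e := slope_mul_sg (slope θ h) b
  have e0 := bet_nonneg (slope θ h) b
  have e1 := bet_le_one (slope θ h) b
  obtain ⟨ha0, ha1⟩ := ha
  rcases hq with hq | hq
  swap
  · exfalso
    obtain ⟨b', k', -, -, -, h1, -⟩ := hq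
    exact triTile_ne_hex _ _ _ h1.symm
  have hq' := hq
  obtain ⟨b', ⟨j, c⟩, x, hx, h1, h2, h3, h4, -, h5⟩ := hq
  have hc : k.2 = c := Tile.hex.inj h1
  subst hc
  obtain ⟨i, c⟩ := k
  replace h3 : fr (i, c) (pt (a + slope θ h * (sg b * s)) (sg b * s)) = fr (j, c) (pt x (sg b')) := h3
  rw [abs_lt] at hx
  rcases eq_or_turn i j with rfl | ⟨β, rfl⟩
  · left
    obtain ⟨h6, h7⟩ := pt_inj.1 (fr_injective _ h3)
    have hs1 : s = 1 := by cases b <;> cases b' <;> simp at h7 <;> linarith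
    have hlt : a < bet (slope θ h) b := by
      rw [hs1, mul_one, e] at h6; linarith
    refine ⟨hlt, hs1, hexTri_right_unique hq' ?_⟩
    rw [hs1, mul_one]
    exact hexTri_top h b (j, c) ha0 hlt
  · right
    rw [fr_turn] at h3
    obtain ⟨h6, h7⟩ := pt_inj.1 (fr_injective _ h3)
    have m : s * bet (slope θ h) b ≤ s := by nlinarith
    have e6 : a + s * (1 / 2 - bet (slope θ h) b) = -(x / 2) + 3 / 4 * (sg β * sg b') := by
      rw [← h6, ← e]; ring
    have key : 0 < s ∧ s < 1 ∧ a + s * (1 - bet (slope θ h) b) = 1 := by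
      cases β <;> cases b' <;> cases b <;> simp at h7 e6 m ⊢ <;>
        first
        | (exfalso; linarith)
        | (refine ⟨?_, ?_, ?_⟩ <;> linarith)
    obtain ⟨k1, k2, k3⟩ := key
    have hlt : bet (slope θ h) b < a := by nlinarith
    have hst : s = tau (slope θ h) b a := by
      rw [tau_of_gt hlt, eq_div_iff (by linarith)]; linarith
    refine ⟨hlt, hst, hexTri_right_unique hq' ?_⟩
    rw [hst]
    exact hexTri_prev h b (i, c) ha1 hlt

lemma refracted_triVec {b : Bool} {k : Idx} {a s : ℝ} (ha : 0 < a)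
    {q : Tile × ℂ × Circle} (hq : Refracted (triVec h b k a (sg b * s)) q) :
    a < bet (slope θ h) b ∧ ((s = 1 ∧ q = hexVec h k a (sg b)) ∨
    (s = 2 - tau (slope θ h) b a ∧ q = hexVec h (nx b k) (a + 1 - bet (slope θ h) b)
      (-(sg b * (1 - tau (slope θ h) b a))))) := by
  have e := slope_mul_sg (slope θ h) b
  have e0 := bet_nonneg (slope θ h) b
  have e1 := bet_le_one (slope θ h) b
  rcases hq with hq | hq
  · exfalso
    obtain ⟨b', k', -, -, h1, -⟩ := hq
    exact triTile_ne_hex _ _ _ h1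
  have hq' := hq
  obtain ⟨b', k', x, hx, h1, h2, h3, h4, -, h5⟩ := hq
  obtain ⟨rfl, hk⟩ := triTile_eq_iff.1 (show triTile b k = triTile b' k' from h2)
  have h3 : fr k (pt (a + slope θ h * (2 * sg b - sg b * s)) (sg b * s)) = fr k' (pt x (sg b)) :=
    h4.trans h3
  rw [abs_lt] at hx
  rw [hk] at h3
  rcases eq_or_turn k.1 k'.1 with hj | ⟨β, hj⟩
  · rw [hj, triFrame_self] at h3
    obtain ⟨h6, h7⟩ := pt_inj.1 (fr_injective _ h3)
    have hs1 : s = 1 := by cases b <;> simp at h7 <;> linarith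
    have hlt : a < bet (slope θ h) b := by
      rw [hs1, mul_one, show 2 * sg b - sg b = sg b by ring, e] at h6; linarith
    refine ⟨hlt, Or.inl ⟨hs1, hexTri_left_unique hq' ?_⟩⟩
    rw [hs1, mul_one]
    exact hexTri_top h b k ha hlt
  · rw [hj, fr_triFrame] at h3
    obtain ⟨h6, h7⟩ := pt_inj.1 (fr_injective _ h3)
    have e6 : a + (2 - s) * (1 / 2 - bet (slope θ h) b) =
        -(x / 2) + 3 / 4 * (sg β * sg b) - sg β * sg b := by
      rw [← h6, ← e]; ring
    have key : 0 < 2 - s ∧ 2 - s < 1 ∧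
        (a = (2 - s) * bet (slope θ h) b ∨ a = -((2 - s) * (1 - bet (slope θ h) b))) := by
      cases β <;> cases b <;> simp at h7 e6 ⊢ <;> refine ⟨by linarith, by linarith, ?_⟩ <;>
        first
        | (left; linarith)
        | (right; linarith)
    obtain ⟨k1, k2, k3⟩ := key
    have k3 : a = (2 - s) * bet (slope θ h) b := by
      rcases k3 with k3 | k3
      · exact k3
      · have := mul_nonneg k1.le (sub_nonneg.2 e1)
        linarith
    have hb : 0 < bet (slope θ h) b := by
      rcases e0.lt_or_eq with hb | hb
      · exact hb
      · rw [← hb] at k3; linarith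
    have hlt : a < bet (slope θ h) b := by nlinarith
    have hst : s = 2 - tau (slope θ h) b a := by
      rw [tau_of_le hlt.le, k3, mul_div_cancel_right₀ _ hb.ne']; ring
    refine ⟨hlt, Or.inr ⟨hst, hexTri_left_unique hq' ?_⟩⟩
    rw [hst]
    exact hexTri_next h b k ha hlt

end

/-! ### The refractive flow as a suspension flow -/

/-- The height up to which the refracted line through the place `a` is attached to its axis. For
`a ≤ bet κ b` the line passes the edge of the hexagon at height `1` and the triangle behind it, and
ends where it enters the next hexagon; otherwise it ends on leaving the hexagon, and the triangle
behind belongs to the line through the next axis. -/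
def reach (κ : Slope) (b : Bool) (a : ℝ) : ℝ := if a ≤ bet κ b then 2 - tau κ b a else tau κ b a

lemma reach_pos {κ : Slope} {b : Bool} {a : ℝ} (ha : a ∈ Ioo (0 : ℝ) 1) : 0 < reach κ b a := by
  have := tau_pos (κ := κ) (b := b) ha
  have := tau_le_one (κ := κ) (b := b) a
  unfold reach; split_ifs <;> linarith

lemma reach_continuous (κ : Slope) (b : Bool) : Continuous fun z : Sec κ => reach κ b z.2 :=
  continuous_ite_bet b (continuous_const.sub (tau_continuous κ b)) (tau_continuous κ b)

lemma reach_baseA {κ : Slope} {b : Bool} {a : ℝ} (ha : a ∈ Ioo (0 : ℝ) 1) (hne : a ≠ bet κ b) :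
    reach κ (!b) (baseA κ b a) = if a ≤ bet κ b then 1 - tau κ b a else 1 + tau κ b a := by
  have e := bet_not κ b
  have e2 := tau_baseA ha hne
  have h0 := ha.1
  have h1 := ha.2
  unfold reach
  rw [e2, e]
  unfold baseA
  split_ifs <;> first | (exfalso; linarith) | ring1

section

variable {θ : ℝ} (h : θ ∈ Icc (Real.pi / 3) (2 * Real.pi / 3))

/-- The vector at height `σ` of the refracted line through the place `a` of the frame `k`. -/
def vec (k : Idx) (a σ : ℝ) : Tile × ℂ × Circle :=
  if a ≤ bet (slope θ h) true ∧ 1 < σ then triVec h true k a σ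
  else if a ≤ bet (slope θ h) false ∧ σ < -1 then triVec h false k a σ else hexVec h k a σ

lemma vec_sg {b : Bool} {k : Idx} {a s : ℝ} (hs : 0 ≤ s) : vec h k a (sg b * s) =
    if a ≤ bet (slope θ h) b ∧ 1 < s then triVec h b k a (sg b * s)
    else hexVec h k a (sg b * s) := by
  unfold vec
  cases b <;> simp only [sg_true, sg_false, neg_mul, one_mul]
  · rw [if_neg (by rintro ⟨-, h⟩; linarith)]
    simp only [neg_lt_neg_iff]
  · split_ifs with h1 h2
    · rfl
    · linarith [h2.2]
    · rfl

lemma vec_of_le_one {b : Bool} {k : Idx} {a s : ℝ} (hs : 0 ≤ s) (h1 : s ≤ 1) :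
    vec h k a (sg b * s) = hexVec h k a (sg b * s) := by
  rw [vec_sg h hs, if_neg fun h2 => by linarith [h2.2]]

lemma vec_of_one_lt {b : Bool} {k : Idx} {a s : ℝ} (ha : a ≤ bet (slope θ h) b) (h1 : 1 < s) :
    vec h k a (sg b * s) = triVec h b k a (sg b * s) := by
  rw [vec_sg h (by linarith), if_pos ⟨ha, h1⟩]

lemma vec_of_bet_lt {b : Bool} {k : Idx} {a s : ℝ} (hs : 0 ≤ s) (ha : bet (slope θ h) b < a) :
    vec h k a (sg b * s) = hexVec h k a (sg b * s) := by
  rw [vec_sg h hs, if_neg fun h2 => by linarith [h2.1]]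

lemma mkX_vec_of_one_le {b : Bool} {k : Idx} {a s : ℝ} (ha : 0 < a) (hlt : a < bet (slope θ h) b)
    (h1 : 1 ≤ s) : mkX (vec h k a (sg b * s)) = mkX (triVec h b k a (sg b * s)) := by
  rcases h1.lt_or_eq with h1 | rfl
  · rw [vec_of_one_lt h hlt.le h1]
  · rw [vec_of_le_one h zero_le_one le_rfl, mul_one]
    exact Refracted.mkX_eq (Or.inl (hexTri_top h b k ha hlt))

lemma vec_mem {b : Bool} {k : Idx} {a s : ℝ} (ha : a ∈ Ioo (0 : ℝ) 1) (hne : a ≠ bet (slope θ h) b)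
    (hs : 0 ≤ s) (h1 : s ≤ reach (slope θ h) b a) :
    (vec h k a (sg b * s)).2.1 ∈ (vec h k a (sg b * s)).1.region := by
  rcases lt_or_gt_of_ne hne with hlt | hlt
  · rw [reach, if_pos hlt.le] at h1
    rcases le_or_gt s 1 with h2 | h2
    · rw [vec_of_le_one h hs h2, hexVec_mem h ha hs, hexEnd, if_pos hlt.le]
      exact ⟨h2, fun _ => hlt⟩
    · rw [vec_of_one_lt h hlt.le h2, triVec_mem_of_lt h ha.1 hlt]
      exact ⟨h2.le, h1⟩
  · rw [reach, if_neg (not_le.2 hlt)] at h1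
    rw [vec_of_bet_lt h hs hlt, hexVec_mem h ha hs, hexEnd, if_neg (not_le.2 hlt)]
    have := tau_lt_one ha hne
    exact ⟨h1, fun h2 => by linarith⟩

/-- At its end the line is refracted to the line through the next place. -/
lemma refracted_reach {b : Bool} (k : Idx) {a : ℝ} (ha : a ∈ Ioo (0 : ℝ) 1)
    (hne : a ≠ bet (slope θ h) b) :
    Refracted (vec h k a (sg b * reach (slope θ h) b a))
      (vec h (baseK (slope θ h) b k a) (baseA (slope θ h) b a)
        (sg (!b) * reach (slope θ h) (!b) (baseA (slope θ h) b a))) := by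
  have e := bet_not (slope θ h) b
  have t0 := tau_pos (κ := slope θ h) (b := b) ha
  have t1 := tau_lt_one ha hne
  have h0 := ha.1
  have h1 := ha.2
  rw [reach_baseA ha hne]
  rcases lt_or_gt_of_ne hne with hlt | hlt
  · rw [reach, if_pos hlt.le, if_pos hlt.le, vec_of_one_lt h hlt.le (by linarith), baseK,
      if_pos hlt.le, baseA, if_pos hlt.le, vec_of_le_one h (by linarith) (by linarith), sg_not,
      neg_mul]
    exact Or.inr (hexTri_next h b k ha.1 hlt)
  · have hn := not_le.2 hlt
    rw [reach, if_neg hn, if_neg hn, vec_of_bet_lt h t0.le hlt, baseK, if_neg hn, baseA, if_neg hn,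
      vec_of_one_lt h (by linarith) (by linarith)]
    exact Or.inl (hexTri_prev h b k ha.2 hlt)

lemma refracted_vec {b : Bool} {k : Idx} {a s : ℝ} (ha : a ∈ Ioo (0 : ℝ) 1)
    (hne : a ≠ bet (slope θ h) b) (hs : 0 ≤ s)
    {q : Tile × ℂ × Circle} (hq : Refracted (vec h k a (sg b * s)) q) :
    (a < bet (slope θ h) b ∧ s = 1 ∧ q = triVec h b k a (sg b)) ∨
    (s = reach (slope θ h) b a ∧ q = vec h (baseK (slope θ h) b k a) (baseA (slope θ h) b a)
        (sg (!b) * reach (slope θ h) (!b) (baseA (slope θ h) b a))) := by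
  have t0 := tau_pos (κ := slope θ h) (b := b) ha
  have t1 := tau_lt_one ha hne
  have fin : s = reach (slope θ h) b a → (s = reach (slope θ h) b a ∧
      q = vec h (baseK (slope θ h) b k a) (baseA (slope θ h) b a)
        (sg (!b) * reach (slope θ h) (!b) (baseA (slope θ h) b a))) := by
    intro e
    refine ⟨e, hq.unique ?_⟩
    rw [e]
    exact refracted_reach h k ha hne
  rcases lt_or_gt_of_ne hne with hlt | hlt
  · rcases le_or_gt s 1 with h2 | h2
    · have hq' := hq
      rw [vec_of_le_one h hs h2] at hq'
      rcases refracted_hexVec h ha hs hq' with ⟨-, e2, e3⟩ | ⟨e1, -⟩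
      · exact Or.inl ⟨hlt, e2, e3⟩
      · linarith
    · have hq' := hq
      rw [vec_of_one_lt h hlt.le h2] at hq'
      rcases (refracted_triVec h ha.1 hq').2 with ⟨e1, -⟩ | ⟨e1, -⟩
      · linarith
      · exact Or.inr (fin (by rw [reach, if_pos hlt.le, e1]))
  · have hq' := hq
    rw [vec_of_bet_lt h hs hlt] at hq'
    rcases refracted_hexVec h ha hs hq' with ⟨e1, -⟩ | ⟨-, e2, -⟩
    · linarith
    · exact Or.inr (fin (by rw [reach, if_neg (not_le.2 hlt), e2]))

/-- The vector `q` lies, on one of its sides, on the line with coordinates `(k, a, σ)`. -/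
def OnVec (k : Idx) (a σ : ℝ) (q : Tile × ℂ × Circle) : Prop :=
  q = hexVec h k a σ ∨ ∃ b, q = triVec h b k a σ

lemma onVec_vec (k : Idx) (a σ : ℝ) : OnVec h k a σ (vec h k a σ) := by
  unfold vec
  split_ifs
  exacts [Or.inr ⟨_, rfl⟩, Or.inr ⟨_, rfl⟩, Or.inl rfl]

lemma hexVec_ne_triVec {b : Bool} {k k' : Idx} {a a' σ σ' : ℝ} :
    hexVec h k a σ ≠ triVec h b k' a' σ' := fun e =>
  triTile_ne_hex _ _ _ (congrArg Prod.fst e).symm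

lemma OnVec.unique {k k' : Idx} {a a' σ σ' : ℝ} {q : Tile × ℂ × Circle} (hq : OnVec h k a σ q)
    (hq' : OnVec h k' a' σ' q) : k = k' ∧ a = a' ∧ σ = σ' := by
  rcases hq with rfl | ⟨b, rfl⟩ <;> rcases hq' with e | ⟨b', e⟩
  · exact (hexVec_inj h).1 e
  · exact (hexVec_ne_triVec h e).elim
  · exact (hexVec_ne_triVec h e.symm).elim
  · exact ((triVec_inj h).1 e).2

lemma vec_mem_sec {z : Sec (slope θ h)} {σ : ℝ} (h0 : -reach (slope θ h) false z.2 ≤ σ)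
    (h1 : σ ≤ reach (slope θ h) true z.2) :
    (vec h z.1 z.2 σ).2.1 ∈ (vec h z.1 z.2 σ).1.region := by
  obtain ⟨b, s, hs, rfl⟩ := exists_sg σ
  refine vec_mem h (sec_mem z) (ne_bet z.2.2 b) hs ?_
  cases b <;> simp at h0 h1 <;> linarith

/-- The coincidences between the vectors of two lines. -/
lemma exists_vec_of_mkX_eq {z : Sec (slope θ h)} {σ : ℝ}
    (h0 : -reach (slope θ h) false z.2 ≤ σ) (h1 : σ ≤ reach (slope θ h) true z.2)
    {q : Tile × ℂ × Circle} (hq : q.2.1 ∈ q.1.region) (e : mkX (vec h z.1 z.2 σ) = mkX q) :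
    OnVec h z.1 z.2 σ q ∨ ∃ b, σ = sg b * reach (slope θ h) b z.2 ∧
      q = vec h (baseMap (slope θ h) b z).1 (baseMap (slope θ h) b z).2
        (sg (!b) * reach (slope θ h) (!b) (baseMap (slope θ h) b z).2) := by
  rcases (mkX_eq_iff (vec_mem_sec h h0 h1) hq).1 e with rfl | hr
  · exact Or.inl (onVec_vec h _ _ _)
  · obtain ⟨b, s, hs, rfl⟩ := exists_sg σ
    rcases refracted_vec h (sec_mem z) (ne_bet z.2.2 b) hs hr with ⟨-, rfl, e2⟩ | ⟨e1, e2⟩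
    · left
      rw [mul_one]
      exact Or.inr ⟨b, e2⟩
    · exact Or.inr ⟨b, by rw [e1], e2⟩

end

/-! ### Closed sets of vectors -/

/-- The hexagon to which a tile belongs. -/
def Tile.home : Tile → ℤ × ℤ
  | .hex c => c
  | .up c => c
  | .down c => c

lemma home_hex (c : ℤ × ℤ) : (Tile.hex c).home = c := rfl

lemma home_triTile_zero (b : Bool) (c : ℤ × ℤ) : (triTile b (0, c)).home = c := by
  cases b <;> simp [triTile, triShift, Tile.home]

instance : DiscreteTopology Tile := ⟨rfl⟩

lemma continuous_unfr_tile (g : Tile → Idx) :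
    Continuous fun q : Tile × ℂ × Circle => unfr (g q.1) q.2.1 := by
  have hg : ∀ f : Idx → ℂ, Continuous fun q : Tile × ℂ × Circle => f (g q.1) := fun f =>
    (continuous_of_discreteTopology (f := fun τ => f (g τ))).comp continuous_fst
  simp only [unfr, div_eq_mul_inv]
  exact ((continuous_fst.comp continuous_snd).sub (hg fun k => ctr k.2)).mul
    (hg fun k => (v k.1)⁻¹)

lemma isClosed_tile (s : Set Tile) : IsClosed {q : Tile × ℂ × Circle | q.1 ∈ s} :=
  (isClosed_discrete s).preimage continuous_fst

lemma isClosed_direction {s : Set Circle} (hs : s.Finite) :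
    IsClosed {q : Tile × ℂ × Circle | q.2.2 ∈ s} :=
  hs.isClosed.preimage (continuous_snd.comp continuous_snd)

lemma refr_injective (i : Fin 3) : Function.Injective (refr i) := fun d d' e => by
  rw [← refr_refr i d, e, refr_refr]

lemma refr_continuous (i : Fin 3) : Continuous (refr i) := by
  refine Continuous.subtype_mk ?_ _
  exact continuous_const.mul (Complex.continuous_conj.comp continuous_subtype_val)

section

variable {θ : ℝ} (h : θ ∈ Icc (Real.pi / 3) (2 * Real.pi / 3))

/-- The set of vectors on the lines `hexVec` and `triVec` with coordinates in a closed set is closed: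
there are finitely many directions, the direction determines the axis, and with the tile the frame. -/
lemma isClosed_onVec {F : Set (Idx × ℝ × ℝ)} (hF : IsClosed F) :
    IsClosed {q : Tile × ℂ × Circle | ∃ k a σ, (k, a, σ) ∈ F ∧ OnVec h k a σ q} := by
  set κ := slope θ h with hκ
  have hc : ∀ (g : Tile → Idx) (f : ℂ → ℝ), Continuous f → IsClosed {q : Tile × ℂ × Circle |
      (g q.1, f (unfr (g q.1) q.2.1), height (unfr (g q.1) q.2.1)) ∈ F} := by
    intro g f hf
    refine hF.preimage (((continuous_of_discreteTopology (f := g)).comp continuous_fst).prodMk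
      ((hf.comp (continuous_unfr_tile g)).prodMk (height_continuous.comp (continuous_unfr_tile g))))
  have e : {q : Tile × ℂ × Circle | ∃ k a σ, (k, a, σ) ∈ F ∧ OnVec h k a σ q} =
      (⋃ i, ({q | q.1 ∈ range Tile.hex} ∩ {q | q.2.2 ∈ ({hexDir θ i} : Set Circle)}) ∩
        {q | ((i, q.1.home), place κ (unfr (i, q.1.home) q.2.1),
          height (unfr (i, q.1.home) q.2.1)) ∈ F}) ∪
      ⋃ b, ⋃ i, ({q | q.1 ∈ range fun c => triTile b (0, c)} ∩
        {q | q.2.2 ∈ ({triDir θ i} : Set Circle)}) ∩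
        {q | (triFrame b (0, q.1.home) i, (fun w => w.re - κ * (2 * sg b - height w))
          (unfr (triFrame b (0, q.1.home) i) q.2.1),
          height (unfr (triFrame b (0, q.1.home) i) q.2.1)) ∈ F} := by
    ext q
    simp only [mem_ofPred_eq, mem_union, mem_iUnion, mem_inter_iff, mem_singleton_iff, mem_range]
    constructor
    · rintro ⟨k, a, σ, hm, rfl | ⟨b, rfl⟩⟩
      · refine Or.inl ⟨k.1, ⟨⟨k.2, rfl⟩, rfl⟩, ?_⟩
        simpa [hexVec, home_hex, ray, ← hκ] using hm
      · refine Or.inr ⟨b, k.1, ⟨⟨_, (triTile_eq_zero b k.1 k.2).symm⟩, rfl⟩, ?_⟩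
        have : triFrame b (0, (triTile b k).home) k.1 = k := by
          have e1 := triTile_eq_zero b k.1 k.2
          rw [Prod.mk.eta] at e1
          rw [e1, home_triTile_zero]
          exact (triTile_eq_iff.1 e1.symm).2.symm
        simp only [triVec]
        rw [this, unfr_fr]
        simpa [← hκ] using hm
    · rintro (⟨i, ⟨⟨c, hc⟩, hd⟩, hm⟩ | ⟨b, i, ⟨⟨c, hc⟩, hd⟩, hm⟩)
      · refine ⟨_, _, _, hm, Or.inl ?_⟩
        refine Prod.ext ?_ (Prod.ext ?_ hd)
        · rw [← hc]; rfl
        · simp [hexVec, ← hκ, ray_place_height]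
      · refine ⟨_, _, _, hm, Or.inr ⟨b, ?_⟩⟩
        refine Prod.ext ?_ (Prod.ext ?_ hd)
        · rw [← hc, home_triTile_zero]
          exact triTile_eq_iff.2 ⟨rfl, rfl⟩
        · show q.2.1 = fr _ _
          obtain ⟨x, y, hxy⟩ := exists_pt (unfr (triFrame b (0, q.1.home) i) q.2.1)
          have : q.2.1 = fr (triFrame b (0, q.1.home) i) (pt x y) := by rw [← hxy, fr_unfr]
          rw [hxy]
          conv_lhs => rw [this]
          simp [← hκ]
  rw [e]
  refine (isClosed_iUnion_of_finite fun i => ?_).union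
    (isClosed_iUnion_of_finite fun b => isClosed_iUnion_of_finite fun i => ?_)
  · exact ((isClosed_tile _).inter (isClosed_direction (finite_singleton _))).inter
      (hc (fun τ => (i, τ.home)) _ (place_continuous κ))
  · exact ((isClosed_tile _).inter (isClosed_direction (finite_singleton _))).inter
      (hc (fun τ => triFrame b (0, τ.home) i) _ (Complex.continuous_re.sub
        (continuous_const.mul (continuous_const.sub height_continuous))))

/-- The set of points of `X` that are represented by vectors with coordinates in a closed set is
closed. -/
lemma isClosed_image_X {F : Set (Idx × ℝ × ℝ)} (hF : IsClosed F) :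
    IsClosed {p : X | ∃ q : Tile × ℂ × Circle, q.2.1 ∈ q.1.region ∧
      (∃ k a σ, (k, a, σ) ∈ F ∧ OnVec h k a σ q) ∧ p = mkX q} := by
  rw [← isQuotientMap_quot_mk.isClosed_preimage]
  set A := {q : Tile × ℂ × Circle | ∃ k a σ, (k, a, σ) ∈ F ∧ OnVec h k a σ q} with hA
  have hAc : IsClosed A := isClosed_onVec h hF
  -- vectors in these directions are not tangent to the edge, and become vectors of the lines
  let N : Fin 3 → Set Circle := fun j =>
    {d : Circle | cross (v j) d ≠ 0 ∧ refr j d ∈ range (hexDir θ) ∪ range (triDir θ)}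
  have hN : ∀ j, (N j).Finite := fun j =>
    (((finite_range _).union (finite_range _)).preimage (refr_injective j).injOn).subset
      fun d hd => hd.2
  have hAN : ∀ j τ z (d : Circle), cross (v j) d ≠ 0 → (τ, z, refr j d) ∈ A → d ∈ N j := by
    rintro j τ z d hd ⟨k, a, σ, -, e | ⟨b, e⟩⟩
    · exact ⟨hd, Or.inl ⟨k.1, (congrArg (fun q => q.2.2) e).symm⟩⟩
    · exact ⟨hd, Or.inr ⟨k.1, (congrArg (fun q => q.2.2) e).symm⟩⟩
  have hgc : ∀ (g : Tile → Tile) (j : Fin 3),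
      IsClosed {q : Tile × ℂ × Circle | (g q.1, q.2.1, refr j q.2.2) ∈ A} := fun g j =>
    hAc.preimage (((continuous_of_discreteTopology (f := g)).comp continuous_fst).prodMk
      ((continuous_fst.comp continuous_snd).prodMk
        ((refr_continuous j).comp (continuous_snd.comp continuous_snd))))
  have hht : ∀ (g : Tile → Idx) (y : ℝ),
      IsClosed {q : Tile × ℂ × Circle | height (unfr (g q.1) q.2.1) = y} := fun g y =>
    isClosed_eq (height_continuous.comp (continuous_unfr_tile g)) continuous_const
  have e : Quot.mk GlueX ⁻¹' {p : X | ∃ q : Tile × ℂ × Circle, q.2.1 ∈ q.1.region ∧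
      (∃ k a σ, (k, a, σ) ∈ F ∧ OnVec h k a σ q) ∧ p = mkX q} = (Subtype.val : PreX → _) ⁻¹'
      (A ∪ ⋃ b, ⋃ j,
        ((({q | q.1 ∈ range Tile.hex} ∩ {q | q.2.2 ∈ N j}) ∩
          {q | height (unfr (j, q.1.home) q.2.1) = sg b}) ∩
          {q | (triTile b (j, q.1.home), q.2.1, refr j q.2.2) ∈ A}) ∪
        ((({q | q.1 ∈ range fun c => triTile b (0, c)} ∩ {q | q.2.2 ∈ N j}) ∩
          {q | height (unfr (triFrame b (0, q.1.home) j) q.2.1) = sg b}) ∩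
          {q | (Tile.hex (triFrame b (0, q.1.home) j).2, q.2.1, refr j q.2.2) ∈ A})) := by
    ext ⟨q, hq⟩
    simp only [mem_preimage, mem_ofPred_eq, mem_union, mem_iUnion, mem_inter_iff, mem_range]
    rw [← mkX_of_mem hq]
    constructor
    · rintro ⟨q', hq', hm, e⟩
      rcases (mkX_eq_iff hq hq').1 e with rfl | ⟨b, k, x, hx, h1, h2, h3, h4, h5, h6⟩ |
        ⟨b, k, x, hx, h1, h2, h3, h4, h5, h6⟩
      · exact Or.inl hm
      · have hm' : (triTile b (k.1, q.1.home), q.2.1, refr k.1 q.2.2) ∈ A := by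
          rw [h1, home_hex, Prod.mk.eta, ← h2, ← h4, ← h6]; exact hm
        refine Or.inr ⟨b, k.1, Or.inl ⟨⟨⟨⟨k.2, h1.symm⟩, hAN _ _ _ _ h5 hm'⟩, ?_⟩, hm'⟩⟩
        rw [h1, home_hex, Prod.mk.eta, h3, unfr_fr, height_pt]
      · have hk : triFrame b (0, q.1.home) k.1 = k := by
          have e1 := triTile_eq_zero b k.1 k.2
          rw [Prod.mk.eta] at e1
          rw [h2, e1, home_triTile_zero]
          exact (triTile_eq_iff.1 e1.symm).2.symm
        have hd : refr k.1 q.2.2 = q'.2.2 := by rw [h6, refr_refr]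
        have hm' : (Tile.hex (triFrame b (0, q.1.home) k.1).2, q.2.1, refr k.1 q.2.2) ∈ A := by
          rw [hk, h4, hd, ← h1]; exact hm
        have h5' : cross (v k.1) q.2.2 ≠ 0 := by rw [h6, cross_refr]; exact h5
        refine Or.inr ⟨b, k.1, Or.inr ⟨⟨⟨⟨_, (h2.trans (triTile_eq_zero b k.1 k.2)).symm⟩,
          hAN _ _ _ _ h5' hm'⟩, ?_⟩, hm'⟩⟩
        · rw [hk, h4, h3, unfr_fr, height_pt]
    · rintro (hm | ⟨b, j, ⟨⟨⟨⟨c, hc⟩, hd⟩, hz⟩, hm⟩ | ⟨⟨⟨⟨c, hc⟩, hd⟩, hz⟩, hm⟩⟩)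
      · exact ⟨q, hq, hm, rfl⟩
      · obtain ⟨x, y, hxy⟩ := exists_pt (unfr (j, q.1.home) q.2.1)
        have hxy' : q.2.1 = fr (j, q.1.home) (pt x y) := by rw [← hxy, fr_unfr]
        rw [hxy, height_pt] at hz
        subst hz
        have hx : |x| < 1 / 2 := by
          have h1 : q.2.1 ∈ q.1.region := hq
          rw [← hc, home_hex] at hxy'
          rw [← hc, hxy', ← mul_one (sg b)] at h1
          exact ((mem_hex_region (k := (j, c)) zero_le_one).1 h1).2.2 rfl
        have hr : Refracted q (triTile b (j, q.1.home), q.2.1, refr j q.2.2) :=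
          Or.inl ⟨b, (j, q.1.home), x, hx, by rw [← hc]; rfl, rfl, hxy', rfl, hd.1, rfl⟩
        exact ⟨_, hr.mem, hm, hr.mkX_eq⟩
      · set k := triFrame b (0, q.1.home) j with hk
        obtain ⟨x, y, hxy⟩ := exists_pt (unfr k q.2.1)
        have hxy' : q.2.1 = fr k (pt x y) := by rw [← hxy, fr_unfr]
        rw [hxy, height_pt] at hz
        subst hz
        have hq1 : q.1 = triTile b k := by
          rw [← hc, hk, ← hc, home_triTile_zero]
          exact triTile_eq_iff.2 ⟨rfl, rfl⟩
        have hx : |x| < 1 / 2 := by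
          have h1 : q.2.1 ∈ q.1.region := hq
          rw [hq1, hxy', ← mul_one (sg b)] at h1
          exact (mem_tri_region.1 h1).2.2 rfl
        have hr : Refracted q (Tile.hex k.2, q.2.1, refr j q.2.2) := by
          refine Or.inr ⟨b, k, x, hx, rfl, hq1, hxy', rfl, ?_, ?_⟩
          · show cross (v j) (refr j q.2.2) ≠ 0
            rw [cross_refr]; exact hd.1
          · exact (refr_refr j q.2.2).symm
        exact ⟨_, hr.mem, hm, hr.mkX_eq⟩
  rw [e]
  refine IsClosed.preimage continuous_subtype_val (hAc.union
    (isClosed_iUnion_of_finite fun b => isClosed_iUnion_of_finite fun j => IsClosed.union ?_ ?_))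
  · exact (((isClosed_tile _).inter (isClosed_direction (hN j))).inter
      (hht (fun τ => (j, τ.home)) _)).inter (hgc (fun τ => triTile b (j, τ.home)) j)
  · exact (((isClosed_tile _).inter (isClosed_direction (hN j))).inter
      (hht (fun τ => triFrame b (0, τ.home) j) _)).inter
      (hgc (fun τ => Tile.hex (triFrame b (0, τ.home) j).2) j)

lemma roof_reach (z : Sec (slope θ h)) :
    reach (slope θ h) true z.2 + reach (slope θ h) false (returnMap (slope θ h) z).2 =
      if (z.2 : ℝ) ≤ bet (slope θ h) true then 3 - 2 * tau (slope θ h) true z.2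
      else 1 + 2 * tau (slope θ h) true z.2 := by
  have e : reach (slope θ h) false (returnMap (slope θ h) z).2 = _ :=
    reach_baseA (sec_mem z) (ne_bet z.2.2 true)
  rw [e, reach]
  split_ifs <;> ring

/-- The refractive flow as a suspension flow over the return map to the axes of the frames. -/
def chartX : SuspensionChart (returnMap (slope θ h)) X where
  lo z := reach (slope θ h) false z.2
  hi z := reach (slope θ h) true z.2
  C z σ := mkX (vec h z.1 z.2 σ)
  lo_cont := reach_continuous _ false
  hi_cont := reach_continuous _ true
  lo_pos z := reach_pos (sec_mem z)
  hi_pos z := reach_pos (sec_mem z)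
  cont := by
    set D := {p : Sec (slope θ h) × ℝ | -reach (slope θ h) false p.1.2 ≤ p.2 ∧
      p.2 ≤ reach (slope θ h) true p.1.2} with hD
    have hDc : IsClosed D := (isClosed_le
        ((reach_continuous _ false).comp continuous_fst).neg continuous_snd).inter
      (isClosed_le continuous_snd ((reach_continuous _ true).comp continuous_fst))
    have hk : ∀ {Y : Type} [TopologicalSpace Y] (g : Idx → Y),
        Continuous fun p : Sec (slope θ h) × ℝ => g p.1.1 := fun g =>
      continuous_of_discreteTopology.comp (continuous_fst.comp continuous_fst)
    have hfr : ∀ f : Sec (slope θ h) × ℝ → ℂ, Continuous f →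
        Continuous fun p : Sec (slope θ h) × ℝ => fr p.1.1 (f p) := fun f hf =>
      (hk fun k => ctr k.2).add ((hk fun k => v k.1).mul hf)
    have hpl : Continuous fun p : Sec (slope θ h) × ℝ => (p.1.2 : ℝ) :=
      (continuous_place _).comp continuous_fst
    have cH : ContinuousOn (fun p : Sec (slope θ h) × ℝ => mkX (vec h p.1.1 p.1.2 p.2))
        (D ∩ {p | |p.2| ≤ 1}) := by
      have : ContinuousOn (fun p : Sec (slope θ h) × ℝ => mkX (hexVec h p.1.1 p.1.2 p.2))
          (D ∩ {p | |p.2| ≤ 1}) := by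
        refine mkX_continuousOn.comp (Continuous.continuousOn ?_) ?_
        · exact (hk fun k => Tile.hex k.2).prodMk ((hfr _ ((ray_continuous _).comp
            (hpl.prodMk continuous_snd))).prodMk (hk fun k => hexDir θ k.1))
        · rintro ⟨z, σ⟩ ⟨⟨h0, h1⟩, h2⟩
          have := vec_mem_sec h h0 h1
          obtain ⟨b, s, hs, rfl⟩ := exists_sg σ
          have hs1 : s ≤ 1 := by
            have := abs_le.1 (show |sg b * s| ≤ 1 from h2)
            cases b <;> simp at this <;> linarith
          rwa [vec_of_le_one h hs hs1] at this
      refine this.congr ?_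
      rintro ⟨z, σ⟩ ⟨⟨h0, h1⟩, h2⟩
      obtain ⟨b, s, hs, rfl⟩ := exists_sg σ
      have hs1 : s ≤ 1 := by
        have := abs_le.1 (show |sg b * s| ≤ 1 from h2)
        cases b <;> simp at this <;> linarith
      show mkX (vec h z.1 z.2 _) = _
      rw [vec_of_le_one h hs hs1]
    have cT : ∀ b, ContinuousOn (fun p : Sec (slope θ h) × ℝ => mkX (vec h p.1.1 p.1.2 p.2))
        (D ∩ {p | 1 ≤ sg b * p.2}) := by
      intro b
      have key : ∀ p ∈ D ∩ {p : Sec (slope θ h) × ℝ | 1 ≤ sg b * p.2},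
          (triVec h b p.1.1 p.1.2 p.2).2.1 ∈ (triVec h b p.1.1 p.1.2 p.2).1.region ∧
          mkX (vec h p.1.1 p.1.2 p.2) = mkX (triVec h b p.1.1 p.1.2 p.2) := by
        rintro ⟨z, σ⟩ ⟨⟨h0, h1⟩, h2⟩
        obtain ⟨s, rfl⟩ : ∃ s, σ = sg b * s :=
          ⟨sg b * σ, by rw [← mul_assoc, sg_mul_self, one_mul]⟩
        have h2 : 1 ≤ s := by
          have : 1 ≤ sg b * (sg b * s) := h2
          rwa [← mul_assoc, sg_mul_self, one_mul] at this
        have hle : s ≤ reach (slope θ h) b z.2 := by cases b <;> simp at h0 h1 <;> linarith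
        have hlt : (z.2 : ℝ) < bet (slope θ h) b := by
          by_contra hn
          have hn' := lt_of_le_of_ne (not_lt.1 hn) (ne_bet z.2.2 b).symm
          rw [reach, if_neg (not_le.2 hn')] at hle
          have := tau_lt_one (sec_mem z) (ne_bet z.2.2 b)
          linarith
        rw [reach, if_pos hlt.le] at hle
        exact ⟨(triVec_mem_of_lt h (sec_mem z).1 hlt).2 ⟨h2, hle⟩,
          mkX_vec_of_one_le h (sec_mem z).1 hlt h2⟩
      have : ContinuousOn (fun p : Sec (slope θ h) × ℝ => mkX (triVec h b p.1.1 p.1.2 p.2))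
          (D ∩ {p | 1 ≤ sg b * p.2}) := by
        refine mkX_continuousOn.comp (Continuous.continuousOn ?_) fun p hp => (key p hp).1
        refine (hk fun k => triTile b k).prodMk ((hfr _ (continuous_pt.comp
            (Continuous.prodMk ?_ continuous_snd))).prodMk (hk fun k => triDir θ k.1))
        exact hpl.add (continuous_const.mul (continuous_const.sub continuous_snd))
      exact this.congr fun p hp => (key p hp).2
    have habs : IsClosed {p : Sec (slope θ h) × ℝ | |p.2| ≤ 1} :=
      isClosed_le continuous_snd.abs continuous_const
    have hge : ∀ b, IsClosed {p : Sec (slope θ h) × ℝ | 1 ≤ sg b * p.2} := fun b =>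
      isClosed_le continuous_const (continuous_const.mul continuous_snd)
    have cU := (cH.union_of_isClosed (cT true) (hDc.inter habs)
      (hDc.inter (hge true))).union_of_isClosed (cT false)
      ((hDc.inter habs).union (hDc.inter (hge true))) (hDc.inter (hge false))
    refine ContinuousOn.mono cU ?_
    intro p hp
    rcases le_or_gt |p.2| 1 with h1 | h1
    · exact Or.inl (Or.inl ⟨hp, h1⟩)
    · rcases lt_abs.1 h1 with h2 | h2
      · exact Or.inl (Or.inr ⟨hp, by simpa using h2.le⟩)
      · exact Or.inr ⟨hp, by simpa using h2.le⟩
  glue z := by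
    have := (refracted_reach h (b := true) z.1 (sec_mem z) (ne_bet z.2.2 true)).mkX_eq
    rw [Bool.not_true, sg_true, sg_false, one_mul, neg_one_mul] at this
    exact this
  inj := by
    intro z σ z' σ' h0 h1 h0' h1' e
    rcases exists_vec_of_mkX_eq h h0 h1 (vec_mem_sec h h0' h1') e with hv | ⟨b, e1, e2⟩
    · obtain ⟨e3, e4, e5⟩ := hv.unique h (onVec_vec h _ _ _)
      exact Or.inl ⟨Prod.ext e3 (Subtype.ext e4), e5⟩
    · have hv := onVec_vec h z'.1 z'.2 σ'
      rw [e2] at hv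
      obtain ⟨e3, e4, e5⟩ := hv.unique h (onVec_vec h _ _ _)
      have hz : z' = baseMap (slope θ h) b z := Prod.ext e3 (Subtype.ext e4)
      right
      cases b
      · right
        refine ⟨?_, ?_, by simpa using e1⟩
        · rw [e5, hz]; simp
        · rw [hz]; exact (baseMap_not_baseMap _ false z).symm
      · left
        refine ⟨by simpa using e1, hz, ?_⟩
        rw [e5, hz]; simp
  one_le_roof z := by
    have := tau_pos (κ := slope θ h) (b := true) (sec_mem z)
    have := tau_le_one (κ := slope θ h) (b := true) z.2
    rw [roof_reach]; split_ifs <;> linarith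
  roof_le z := by
    have := tau_pos (κ := slope θ h) (b := true) (sec_mem z)
    have := tau_le_one (κ := slope θ h) (b := true) z.2
    rw [roof_reach]; split_ifs <;> linarith
  lift := by
    intro W hW
    obtain ⟨F, hF, e⟩ := (isInducing_sec (slope θ h)).isClosed_iff.1 hW
    refine ⟨_, isClosed_image_X h hF, fun z σ h0 h1 => ?_⟩
    have mem_iff : ∀ z : Sec (slope θ h), ∀ σ, -reach (slope θ h) false z.2 ≤ σ →
        σ ≤ reach (slope θ h) true z.2 →
        ((z.1, (z.2 : ℝ), σ) ∈ F ↔ mkX (vec h z.1 z.2 σ) ∈ W) := by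
      intro z σ h0 h1
      have := Set.ext_iff.1 e (z, σ)
      simp only [mem_preimage, mem_ofPred_eq] at this
      rw [this]
      exact and_iff_right ⟨h0, h1⟩
    constructor
    · rintro ⟨q, hq, ⟨k, a, σ', hm, hv⟩, e1⟩
      rcases exists_vec_of_mkX_eq h h0 h1 hq e1 with hv' | ⟨b, -, e2⟩
      · obtain ⟨rfl, rfl, rfl⟩ := hv.unique h hv'
        exact (mem_iff z σ' h0 h1).1 hm
      · set z' := baseMap (slope θ h) b z
        have hv' := onVec_vec h z'.1 z'.2 (sg (!b) * reach (slope θ h) (!b) z'.2)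
        rw [← e2] at hv'
        obtain ⟨e3, e4, e5⟩ := hv.unique h hv'
        have p0 := reach_pos (κ := slope θ h) (b := true) (sec_mem z')
        have p1 := reach_pos (κ := slope θ h) (b := false) (sec_mem z')
        show mkX (vec h z.1 z.2 σ) ∈ W
        rw [e1, e2, ← mem_iff z' _ (by cases b <;> simp; linarith)
          (by cases b <;> simp; linarith), ← e5, ← e3, ← e4]
        exact hm
    · intro hm
      exact ⟨_, vec_mem_sec h h0 h1, ⟨_, _, _, (mem_iff z σ h0 h1).2 hm, onVec_vec h _ _ _⟩, rfl⟩

end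

/-! ### The trajectories of the refractive flow -/

section

variable {θ : ℝ} (h : θ ∈ Icc (Real.pi / 3) (2 * Real.pi / 3))

/-- The vector moved along its line, in the time in which the height increases by `t`. -/
def slide (θ : ℝ) (q : Tile × ℂ × Circle) (t : ℝ) : Tile × ℂ × Circle :=
  (q.1, q.2.1 + ((t * climb θ : ℝ) : ℂ) * q.2.2, q.2.2)

lemma slide_zero (q : Tile × ℂ × Circle) : slide θ q 0 = q := by simp [slide]

lemma slide_slide (q : Tile × ℂ × Circle) (s t : ℝ) :
    slide θ (slide θ q s) t = slide θ q (s + t) := by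
  simp only [slide, Prod.mk.injEq, true_and, and_true]
  push_cast; ring

lemma slide_hexVec (k : Idx) (a σ t : ℝ) : slide θ (hexVec h k a σ) t = hexVec h k a (σ + t) := by
  simp only [slide, hexVec, Prod.mk.injEq, true_and, and_true, fr, coe_hexDir]
  have e : ((t * climb θ : ℝ) : ℂ) * (dir θ * v k.1) = v k.1 * ((t : ℂ) * (climb θ * dir θ)) := by
    push_cast; ring
  rw [e, climb_mul_dir h, ofReal_mul_pt, add_assoc, ← mul_add, ray, ray, pt_add]
  congr 3 <;> ring

lemma slide_triVec (b : Bool) (k : Idx) (a σ t : ℝ) :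
    slide θ (triVec h b k a σ) t = triVec h b k a (σ + t) := by
  simp only [slide, triVec, Prod.mk.injEq, true_and, and_true, fr, coe_triDir]
  have e : ((t * climb θ : ℝ) : ℂ) * (-(starRingEnd ℂ) (dir θ) * v k.1) =
      v k.1 * ((t : ℂ) * -(starRingEnd ℂ) (climb θ * dir θ)) := by
    rw [map_mul, Complex.conj_ofReal]; push_cast; ring
  rw [e, climb_mul_dir h, pt_conj, pt_neg, ofReal_mul_pt, add_assoc, ← mul_add, pt_add]
  congr 3 <;> ring

/-- The lines of vectors in the tiles, with unit speed up to the factor `climb θ`. -/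
def lineX (θ : ℝ) (q : Tile × ℂ × Circle) (t : ℝ) (p : X) : Prop :=
  (slide θ q t).2.1 ∈ (slide θ q t).1.region ∧ p = mkX (slide θ q t)

lemma isRefractiveTrajectory_iff {θ : ℝ} (h : θ ∈ Icc (Real.pi / 3) (2 * Real.pi / 3)) (γ : ℝ → X) :
    IsRefractiveTrajectory (fun t => γ (t / climb θ)) ↔ FollowsLines (lineX θ) γ := by
  have hH := climb_pos h
  constructor
  · intro hγ t
    obtain ⟨ε, hε, ⟨τ, z, d, h1⟩, ⟨τ', z', d', h2⟩⟩ := hγ (t * climb θ)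
    refine ⟨ε / climb θ, div_pos hε hH, ⟨(τ, z, d), fun s hs => ?_⟩,
      ⟨(τ', z', d'), fun s hs => ?_⟩⟩
    · have hs' : s * climb θ ∈ Icc 0 ε :=
        ⟨mul_nonneg hs.1 hH.le, (le_div_iff₀ hH).1 hs.2⟩
      obtain ⟨h3, h4⟩ := h1 _ hs'
      rw [← mkX_of_mem (p := (τ, z + ((s * climb θ : ℝ) : ℂ) * d, d)) h3, ← add_mul] at h4
      dsimp only at h4
      rw [mul_div_cancel_right₀ _ hH.ne'] at h4
      exact ⟨h3, h4⟩
    · have hs' : s * climb θ ∈ Icc 0 ε :=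
        ⟨mul_nonneg hs.1 hH.le, (le_div_iff₀ hH).1 hs.2⟩
      obtain ⟨h3, h4⟩ := h2 _ hs'
      rw [← mkX_of_mem (p := (τ', z' - ((s * climb θ : ℝ) : ℂ) * d', d')) h3, ← sub_mul] at h4
      dsimp only at h4
      rw [mul_div_cancel_right₀ _ hH.ne'] at h4
      have e : slide θ (τ', z', d') (-s) = (τ', z' - ((s * climb θ : ℝ) : ℂ) * d', d') := by
        simp only [slide, Prod.mk.injEq, true_and, and_true]
        push_cast; ring
      rw [lineX, e]
      exact ⟨h3, h4⟩
  · intro hγ t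
    obtain ⟨ε, hε, ⟨ℓ, h1⟩, ⟨ℓ', h2⟩⟩ := hγ (t / climb θ)
    refine ⟨ε * climb θ, mul_pos hε hH, ⟨ℓ.1, ℓ.2.1, ℓ.2.2, fun s hs => ?_⟩,
      ⟨ℓ'.1, ℓ'.2.1, ℓ'.2.2, fun s hs => ?_⟩⟩
    · have hs' : s / climb θ ∈ Icc 0 ε := ⟨div_nonneg hs.1 hH.le, (div_le_iff₀ hH).2 hs.2⟩
      obtain ⟨h3, h4⟩ := h1 _ hs'
      rw [slide, div_mul_cancel₀ _ hH.ne'] at h3 h4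
      exact ⟨h3, by dsimp only; rw [add_div, h4, mkX_of_mem h3]⟩
    · have hs' : s / climb θ ∈ Icc 0 ε := ⟨div_nonneg hs.1 hH.le, (div_le_iff₀ hH).2 hs.2⟩
      obtain ⟨h3, h4⟩ := h2 _ hs'
      have e : slide θ ℓ' (-(s / climb θ)) = (ℓ'.1, ℓ'.2.1 - s * ℓ'.2.2, ℓ'.2.2) := by
        simp only [slide, Prod.mk.injEq, true_and, and_true]
        rw [neg_mul, div_mul_cancel₀ _ hH.ne']
        push_cast; ring
      rw [e] at h3 h4
      exact ⟨h3, by dsimp only; rw [sub_div, h4, mkX_of_mem h3]⟩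

variable {γ : ℝ → X}

lemma refractive_onLine (hγ : FollowsLines (lineX θ) γ) {q : Tile × ℂ × Circle} {O : Set ℝ}
    (hO : IsPreconnected O) (t₀ : ℝ)
    (sep : ∀ t ∈ O, γ (t₀ + t) = mkX (slide θ q t) → ∀ q', ¬ Refracted (slide θ q t) q')
    {t : ℝ} (ht : t ∈ O) (hm : (slide θ q t).2.1 ∈ (slide θ q t).1.region)
    (h0 : γ (t₀ + t) = mkX (slide θ q t)) {t' : ℝ} (ht' : t' ∈ closure O) :
    (slide θ q t').2.1 ∈ (slide θ q t').1.region ∧ γ (t₀ + t') = mkX (slide θ q t') := by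
  refine hγ.onLine hO t₀ ?_ ht ⟨hm, h0⟩ ht'
  rintro t ht ⟨h1, h2⟩ q' u ⟨h3, h4⟩ w p h5
  rw [h2] at h4
  rcases (mkX_eq_iff h1 h3).1 h4 with e | hr
  · rwa [lineX, ← slide_slide, e, slide_slide]
  · exact (sep t ht h2 _ hr).elim

/-- A trajectory that reaches the boundary of a tile continues with the refracted vector. -/
lemma refractive_pass (hγ : FollowsLines (lineX θ) γ) {p q : Tile × ℂ × Circle} (b : Bool) {t : ℝ}
    (h0 : γ t = mkX p) (hr : Refracted p q)
    (hexit : ∀ s > 0, (slide θ p (sg b * s)).2.1 ∉ (slide θ p (sg b * s)).1.region) :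
    ∃ ε > 0, ∀ s ∈ Icc (0 : ℝ) ε, (slide θ q (sg b * s)).2.1 ∈ (slide θ q (sg b * s)).1.region ∧
      γ (t + sg b * s) = mkX (slide θ q (sg b * s)) := by
  obtain ⟨ε, hε, ℓ, hℓ⟩ := hγ.dir b t
  have e0 := hℓ 0 ⟨le_rfl, hε.le⟩
  rw [mul_zero, add_zero, h0, lineX, slide_zero] at e0
  rcases (mkX_eq_iff hr.symm.mem e0.1).1 e0.2 with rfl | hr'
  · exact (hexit ε hε (hℓ ε ⟨hε.le, le_rfl⟩).1).elim
  · rw [hr.unique hr']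
    exact ⟨ε, hε, hℓ⟩

lemma exit_hexVec {b : Bool} {k : Idx} {a : ℝ} (ha : a ∈ Ioo (0 : ℝ) 1) {s : ℝ} (hs : 0 < s) :
    (slide θ (hexVec h k a (sg b * hexEnd (slope θ h) b a)) (sg b * s)).2.1 ∉
      (slide θ (hexVec h k a (sg b * hexEnd (slope θ h) b a)) (sg b * s)).1.region := by
  have := hexEnd_pos (κ := slope θ h) (b := b) ha
  rw [slide_hexVec, ← mul_add, hexVec_mem h ha (by linarith)]
  rintro ⟨h1, -⟩
  linarith

lemma exit_triVec_outward {b : Bool} {k : Idx} {a : ℝ} (ha : 0 < a)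
    (hlt : a < bet (slope θ h) b) {s : ℝ} (hs : 0 < s) :
    (slide θ (triVec h b k a (sg b * (2 - tau (slope θ h) b a))) (sg b * s)).2.1 ∉
      (slide θ (triVec h b k a (sg b * (2 - tau (slope θ h) b a))) (sg b * s)).1.region := by
  rw [slide_triVec, ← mul_add, triVec_mem_of_lt h ha hlt]
  rintro ⟨-, h1⟩
  linarith

lemma exit_triVec_inward {b : Bool} {k : Idx} {a : ℝ} (ha : 0 < a)
    (hlt : a < bet (slope θ h) b) {s : ℝ} (hs : 0 < s) :
    (slide θ (triVec h b k a (sg b)) (sg (!b) * s)).2.1 ∉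
      (slide θ (triVec h b k a (sg b)) (sg (!b) * s)).1.region := by
  rw [slide_triVec, show sg b + sg (!b) * s = sg b * (1 - s) by rw [sg_not]; ring,
    triVec_mem_of_lt h ha hlt]
  rintro ⟨h1, -⟩
  linarith

lemma slide_hexVec_zero (k : Idx) (a σ : ℝ) : slide θ (hexVec h k a 0) σ = hexVec h k a σ := by
  rw [slide_hexVec, zero_add]

lemma slide_triVec_zero (b : Bool) (k : Idx) (a σ : ℝ) :
    slide θ (triVec h b k a 0) σ = triVec h b k a σ := by
  rw [slide_triVec, zero_add]

/-- A trajectory runs through the whole chord of a hexagon. -/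
lemma hex_chord (hγ : FollowsLines (lineX θ) γ) {k : Idx} {a t₀ σ₀ : ℝ} (ha : a ∈ Ioo (0 : ℝ) 1)
    (hσ : σ₀ ∈ Ioo (-hexEnd (slope θ h) false a) (hexEnd (slope θ h) true a))
    (h0 : γ (t₀ + σ₀) = mkX (hexVec h k a σ₀)) {σ : ℝ}
    (hσ' : σ ∈ Icc (-hexEnd (slope θ h) false a) (hexEnd (slope θ h) true a)) :
    (hexVec h k a σ).2.1 ∈ (hexVec h k a σ).1.region ∧ γ (t₀ + σ) = mkX (hexVec h k a σ) := by
  have key : ∀ t ∈ Ioo (-hexEnd (slope θ h) false a) (hexEnd (slope θ h) true a),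
      ∃ b s, t = sg b * s ∧ 0 ≤ s ∧ s < hexEnd (slope θ h) b a := by
    intro t ht
    obtain ⟨b, s, hs, rfl⟩ := exists_sg t
    refine ⟨b, s, rfl, hs, ?_⟩
    have := ht.1; have := ht.2
    cases b <;> simp at * <;> linarith
  have := refractive_onLine hγ (q := hexVec h k a 0) isPreconnected_Ioo t₀ ?_ hσ ?_ ?_ (t' := σ) ?_
  · rwa [slide_hexVec_zero] at this
  · rintro t ht - q' hr
    obtain ⟨b, s, rfl, hs, hlt⟩ := key t ht
    rw [slide_hexVec_zero] at hr
    rcases refracted_hexVec h ha hs hr with ⟨h1, h2, -⟩ | ⟨h1, h2, -⟩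
    · rw [hexEnd, if_pos h1.le] at hlt; linarith
    · rw [hexEnd, if_neg (not_le.2 h1)] at hlt; linarith
  · obtain ⟨b, s, rfl, hs, hlt⟩ := key σ₀ hσ
    rw [slide_hexVec_zero, hexVec_mem h ha hs]
    have := hexEnd_le_one (κ := slope θ h) (b := b) (a := a)
    exact ⟨hlt.le, fun h1 => by linarith⟩
  · rwa [slide_hexVec_zero]
  · rw [closure_Ioo (by linarith [hσ.1, hσ.2])]
    exact hσ'

/-- A trajectory runs through the whole chord of a triangle. -/
lemma tri_chord (hγ : FollowsLines (lineX θ) γ) {b : Bool} {k : Idx} {a t₀ s₀ : ℝ} (ha : 0 < a)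
    (hlt : a < bet (slope θ h) b) (hs : s₀ ∈ Ioo 1 (2 - tau (slope θ h) b a))
    (h0 : γ (t₀ + sg b * s₀) = mkX (triVec h b k a (sg b * s₀))) {s : ℝ}
    (hs' : s ∈ Icc 1 (2 - tau (slope θ h) b a)) :
    γ (t₀ + sg b * s) = mkX (triVec h b k a (sg b * s)) := by
  have himg : ∀ t ∈ (fun u => sg b * u) '' Ioo 1 (2 - tau (slope θ h) b a),
      ∀ q, ¬ Refracted (slide θ (triVec h b k a 0) t) q := by
    rintro _ ⟨u, hu, rfl⟩ q hr
    rw [slide_triVec_zero] at hr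
    rcases (refracted_triVec h ha hr).2 with ⟨h1, -⟩ | ⟨h1, -⟩
    · linarith [hu.1]
    · linarith [hu.2]
  have hcont : Continuous fun u => sg b * u := continuous_const.mul continuous_id
  have := refractive_onLine hγ (q := triVec h b k a 0)
    (isPreconnected_Ioo.image _ hcont.continuousOn) t₀ (fun t ht _ => himg t ht)
    (mem_image_of_mem _ hs) ?_ ?_ (t' := sg b * s) ?_
  · rw [slide_triVec_zero] at this; exact this.2
  · rw [slide_triVec_zero, triVec_mem_of_lt h ha hlt]; exact ⟨hs.1.le, hs.2.le⟩
  · rwa [slide_triVec_zero]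
  · refine image_closure_subset_closure_image hcont (mem_image_of_mem _ ?_)
    rw [closure_Ioo (by linarith [hs.1, hs.2])]
    exact hs'

lemma hex_ne_bet (hγ : FollowsLines (lineX θ) γ) {k : Idx} {a t₀ : ℝ} (ha : a ∈ Ioo (0 : ℝ) 1)
    (h0 : γ t₀ = mkX (hexVec h k a 0)) (b : Bool) : a ≠ bet (slope θ h) b := by
  intro e
  have p1 := hexEnd_pos (κ := slope θ h) (b := true) ha
  have p2 := hexEnd_pos (κ := slope θ h) (b := false) ha
  have h1 : hexEnd (slope θ h) b a = 1 := if_pos e.le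
  have := (hex_chord h hγ (t₀ := t₀) (σ₀ := 0) (k := k) ha ⟨by linarith, p1⟩ (by rwa [add_zero])
    (σ := sg b * hexEnd (slope θ h) b a) (by cases b <;> simp <;> linarith)).1
  rw [hexVec_mem h ha (by rw [h1]; norm_num)] at this
  exact (this.2 h1).ne e

/-- A trajectory that enters a hexagon reaches the axis. -/
lemma hex_enter (hγ : FollowsLines (lineX θ) γ) {p : Tile × ℂ × Circle} {b : Bool} {k : Idx}
    {a t₀ : ℝ} (ha : a ∈ Ioo (0 : ℝ) 1) (h0 : γ t₀ = mkX p)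
    (hr : Refracted p (hexVec h k a (sg (!b) * hexEnd (slope θ h) (!b) a)))
    (hexit : ∀ s > 0, (slide θ p (sg b * s)).2.1 ∉ (slide θ p (sg b * s)).1.region) :
    γ (t₀ + sg b * hexEnd (slope θ h) (!b) a) = mkX (hexVec h k a 0) := by
  obtain ⟨ε, hε, hε2⟩ := refractive_pass hγ b h0 hr hexit
  have p1 := hexEnd_pos (κ := slope θ h) (b := true) ha
  have p2 := hexEnd_pos (κ := slope θ h) (b := false) ha
  have p3 := hexEnd_pos (κ := slope θ h) (b := !b) ha
  set s := min ε (hexEnd (slope θ h) (!b) a / 2) with hs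
  have hs0 : 0 < s := lt_min hε (by linarith)
  have hs1 : s ≤ hexEnd (slope θ h) (!b) a / 2 := min_le_right _ _
  obtain ⟨-, e⟩ := hε2 s ⟨hs0.le, min_le_left _ _⟩
  rw [slide_hexVec] at e
  have := (hex_chord h hγ (t₀ := t₀ + sg b * hexEnd (slope θ h) (!b) a) (k := k) (a := a)
    (σ₀ := sg (!b) * hexEnd (slope θ h) (!b) a + sg b * s) ha ?_ ?_ (σ := 0) ⟨by linarith, p1.le⟩).2
  · simpa using this
  · cases b <;> simp at hs1 p3 ⊢ <;> constructor <;> linarith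
  · rw [← e, sg_not]; congr 1; ring

/-- A trajectory follows the refracted line from one axis to the next, forwards or backwards in time,
and arrives there at the place given by the return map. -/
lemma refractive_step (hγ : FollowsLines (lineX θ) γ) {k : Idx} {a t₀ : ℝ}
    (ha : a ∈ Ioo (0 : ℝ) 1) (h0 : γ t₀ = mkX (hexVec h k a 0)) (b : Bool) :
    (∀ s, 0 ≤ s → s ≤ reach (slope θ h) b a →
      γ (t₀ + sg b * s) = mkX (vec h k a (sg b * s))) ∧
    γ (t₀ + sg b * (reach (slope θ h) b a + reach (slope θ h) (!b) (baseA (slope θ h) b a))) =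
      mkX (hexVec h (baseK (slope θ h) b k a) (baseA (slope θ h) b a) 0) := by
  have p1 := hexEnd_pos (κ := slope θ h) (b := true) ha
  have p2 := hexEnd_pos (κ := slope θ h) (b := false) ha
  have hne := hex_ne_bet h hγ ha h0 b
  have chord : ∀ s, 0 ≤ s → s ≤ hexEnd (slope θ h) b a →
      γ (t₀ + sg b * s) = mkX (hexVec h k a (sg b * s)) := fun s hs hs1 =>
    (hex_chord h hγ (t₀ := t₀) (σ₀ := 0) (k := k) ha ⟨by linarith, p1⟩ (by rwa [add_zero])
      (σ := sg b * s) (by cases b <;> simp <;> constructor <;> linarith)).2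
  have ha' := baseA_mem_Ioo ha hne
  have t0 := tau_pos (κ := slope θ h) (b := b) ha
  have t1 := tau_lt_one ha hne
  have t2 := tau_baseA ha hne
  have hbn := bet_not (slope θ h) b
  have ha0 := ha.1
  have ha1 := ha.2
  rw [reach_baseA ha hne]
  rcases lt_or_gt_of_ne hne with hlt | hlt
  -- the line leaves the hexagon at its top, passes a triangle and enters the next hexagon through a
  -- slanted edge
  · have e1 : hexEnd (slope θ h) b a = 1 := if_pos hlt.le
    rw [e1] at chord
    rw [reach, if_pos hlt.le, if_pos hlt.le]
    -- the part in the triangle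
    have hend := chord 1 zero_le_one le_rfl
    obtain ⟨ε, hε, hε2⟩ := refractive_pass hγ b hend
      (by rw [mul_one]; exact Or.inl (hexTri_top h b k ha.1 hlt))
      (fun s hs => by have := exit_hexVec h (b := b) (k := k) ha hs; rwa [e1] at this)
    set δ := min ε ((1 - tau (slope θ h) b a) / 2) with hδ
    have hδ0 : 0 < δ := lt_min hε (by linarith)
    have hδ1 : δ ≤ (1 - tau (slope θ h) b a) / 2 := min_le_right _ _
    obtain ⟨-, e2⟩ := hε2 δ ⟨hδ0.le, min_le_left _ _⟩
    rw [slide_triVec, mul_one, add_assoc, show sg b + sg b * δ = sg b * (1 + δ) by ring] at e2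
    have tri : ∀ s ∈ Icc 1 (2 - tau (slope θ h) b a),
        γ (t₀ + sg b * s) = mkX (triVec h b k a (sg b * s)) := fun s hs =>
      tri_chord h hγ ha.1 hlt (t₀ := t₀) (s₀ := 1 + δ) ⟨by linarith, by linarith⟩ e2 hs
    constructor
    · intro s hs hs2
      rcases le_or_gt s 1 with h3 | h3
      · rw [vec_of_le_one h hs h3]; exact chord s hs h3
      · rw [vec_of_one_lt h hlt.le h3]; exact tri s ⟨h3.le, hs2⟩
    · have hA : ¬ baseA (slope θ h) b a ≤ bet (slope θ h) (!b) := by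
        rw [baseA, if_pos hlt.le, hbn]; linarith
      have hE : hexEnd (slope θ h) (!b) (baseA (slope θ h) b a) = 1 - tau (slope θ h) b a := by
        rw [hexEnd, if_neg hA, t2]
      have := hex_enter h hγ (b := b) (k := baseK (slope θ h) b k a) ha'
        (tri _ ⟨by linarith, le_rfl⟩) (by
          rw [hE, baseK, if_pos hlt.le, baseA, if_pos hlt.le, sg_not, neg_mul]
          exact Or.inr (hexTri_next h b k ha.1 hlt))
        (fun s hs => exit_triVec_outward h ha.1 hlt hs)
      rw [hE] at this
      rw [← this]; congr 1; ring
  -- the line leaves the hexagon through a slanted edge, passes a triangle and enters the next hexagon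
  -- through the edge at height `-1`, respectively `1`
  · have hn := not_le.2 hlt
    have e1 : hexEnd (slope θ h) b a = tau (slope θ h) b a := if_neg hn
    rw [e1] at chord
    rw [reach, if_neg hn, if_neg hn]
    refine ⟨fun s hs hs2 => by rw [vec_of_bet_lt h hs hlt]; exact chord s hs hs2, ?_⟩
    have hA : baseA (slope θ h) b a = a - bet (slope θ h) b := if_neg hn
    have hK : baseK (slope θ h) b k a = pv b k := if_neg hn
    rw [hA] at t2 ha' ⊢
    rw [hK]
    have hlt' : a - bet (slope θ h) b < bet (slope θ h) (!b) := by linarith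
    have hend := chord _ t0.le le_rfl
    obtain ⟨ε, hε, hε2⟩ := refractive_pass hγ b hend (Or.inl (hexTri_prev h b k ha.2 hlt))
      (fun s hs => by have := exit_hexVec h (b := b) (k := k) ha hs; rwa [e1] at this)
    set s := min ε (tau (slope θ h) b a / 2) with hs
    have hs0 : 0 < s := lt_min hε (by linarith)
    have hs1 : s ≤ tau (slope θ h) b a / 2 := min_le_right _ _
    obtain ⟨-, e2⟩ := hε2 s ⟨hs0.le, min_le_left _ _⟩
    have e3 : sg (!b) * (1 + tau (slope θ h) b a) + sg b * s =
        sg (!b) * (1 + tau (slope θ h) b a - s) := by rw [sg_not]; ring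
    rw [slide_triVec, e3] at e2
    have tri := tri_chord h hγ ha'.1 hlt' (t₀ := t₀ + sg b * (1 + 2 * tau (slope θ h) b a))
      (s₀ := 1 + tau (slope θ h) b a - s) (k := pv b k) ⟨by linarith, by linarith⟩
      (by rw [← e2, sg_not]; congr 1; ring) (s := 1) ⟨le_rfl, by linarith⟩
    have hE : hexEnd (slope θ h) (!b) (a - bet (slope θ h) b) = 1 := if_pos hlt'.le
    rw [mul_one] at tri
    have := hex_enter h hγ (b := b) (k := pv b k) ha' tri
      (by rw [hE, mul_one]; exact Or.inr (hexTri_top h (!b) _ ha'.1 hlt'))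
      (fun s hs => by
        have := exit_triVec_inward h (k := pv b k) ha'.1 hlt' hs
        rwa [Bool.not_not] at this)
    rw [hE] at this
    rw [← this, sg_not]; congr 1; ring

end

/-! ### The description of the refractive flow -/

lemma corners_finite (τ : Tile) : τ.corners.Finite := by
  rcases tile_cases τ with ⟨c, rfl⟩ | ⟨b, c, rfl⟩
  · rw [corners_hex (0, c), hexCorners]; exact (Set.toFinite _).image _
  · rw [corners_tri, triCorners]; exact (Set.toFinite _).image _

lemma region_bounded (τ : Tile) : Bornology.IsBounded τ.region :=
  ((corners_finite τ).isCompact_convexHull (𝕜 := ℝ)).isBounded.subset sdiff_subset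

section

variable {θ : ℝ} (h : θ ∈ Icc (Real.pi / 3) (2 * Real.pi / 3)) {γ : ℝ → X}

/-- A trajectory cannot stay in the triangles for ever, since it cannot pass from one triangle
to another and would have to follow one line for all time. -/
lemma exists_hex (hγ : FollowsLines (lineX θ) γ) (hθ : climb θ ≠ 0) :
    ∃ t c z, ∃ d : Circle, z ∈ (Tile.hex c).region ∧ γ t = mkX (Tile.hex c, z, d) := by
  by_contra hno
  push Not at hno
  have hnh : ∀ t q, q.2.1 ∈ q.1.region → γ t = mkX q → ∀ c, q.1 ≠ Tile.hex c := by
    rintro t ⟨τ, z, d⟩ hq e c hc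
    dsimp only at hc hq
    subst hc
    exact hno t c z d hq e
  obtain ⟨ε, hε, ⟨q, h1⟩, -⟩ := hγ 0
  obtain ⟨h2, h3⟩ := h1 0 ⟨le_rfl, hε.le⟩
  have key := fun t' => refractive_onLine hγ (q := q) (t := 0) isPreconnected_univ 0 ?_ (mem_univ _)
    h2 (by simpa using h3) (t' := t') (by simp)
    -- the line is unbounded, the tile is bounded
  · obtain ⟨R, hR⟩ := (region_bounded q.1).exists_norm_le
    have hlarge := hR _ (key ((R + ‖q.2.1‖ + 1) / climb θ)).1
    rw [slide, div_mul_cancel₀ _ hθ] at hlarge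
    have h4 := norm_sub_le (q.2.1 + ((R + ‖q.2.1‖ + 1 : ℝ) : ℂ) * q.2.2) q.2.1
    rw [add_sub_cancel_left, norm_mul, Circle.norm_coe, mul_one, Complex.norm_real] at h4
    dsimp only at hlarge
    have := le_abs_self (R + ‖q.2.1‖ + 1)
    rw [Real.norm_eq_abs] at h4
    linarith
  · rintro t - e q' hr
    have e' := e.trans hr.mkX_eq
    rcases hr with hr | hr
    · obtain ⟨b, k, x, -, e1, -⟩ := id hr
      exact hnh _ _ hr.mem.1 e _ e1
    · obtain ⟨b, k, x, -, e1, -⟩ := id hr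
      exact hnh _ _ hr.mem.1 e' _ e1

lemma cross_hexVec (k : Idx) (a σ : ℝ) :
    cross ((hexVec h k a σ).2.1 - ctr k.2) (hexDir θ k.1) = a * Real.sin θ := by
  have e : (starRingEnd ℂ) (v k.1 * ray (slope θ h) a σ) * (dir θ * v k.1) =
      (starRingEnd ℂ) (ray (slope θ h) a σ) * dir θ := by
    rw [map_mul]
    linear_combination ((starRingEnd ℂ) (ray (slope θ h) a σ) * dir θ) * v_mul_conj k.1
  have hs := sin_pos_of_mem h
  rw [hexVec, fr, add_sub_cancel_left, cross_eq, coe_hexDir, e, dir_eq_pt h, ray, pt_conj, pt_mul,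
    pt_im, climb]
  field_simp
  ring

lemma cross_v_turn_hexDir_self (b : Bool) (i : Fin 3) :
    cross (v (turn b i)) (hexDir θ i) = -(Real.sin θ * bet (slope θ h) b) := by
  have e : (starRingEnd ℂ) (v (turn b i)) * (dir θ * v i) = dir θ * pt (-(1 / 2)) (sg b) := by
    rw [v_turn, map_mul, pt_conj, neg_neg]
    linear_combination (dir θ * pt (-(1 / 2)) (sg b)) * v_mul_conj i
  have hs := sin_pos_of_mem h
  rw [cross_eq, coe_hexDir, e, dir_eq_pt h, pt_mul, pt_im, bet, climb]
  field_simp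
  ring

/-- A trajectory cannot run along an edge of a hexagon, since it would run into a vertex. -/
lemma refractive_not_edge (hγ : FollowsLines (lineX θ) γ) {k : Idx} {σ t : ℝ}
    (hm : (hexVec h k 1 σ).2.1 ∈ (hexVec h k 1 σ).1.region) (h0 : γ t = mkX (hexVec h k 1 σ)) :
    False := by
  obtain ⟨b, s, hs, rfl⟩ := exists_sg σ
  have e0 := bet_nonneg (slope θ h) b
  have e1 := bet_le_one (slope θ h) b
  rw [hexVec_mem_iff h hs] at hm
  obtain ⟨⟨h1, h2⟩, h3, h4⟩ := hm
  rw [abs_le] at h2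
  rw [abs_lt] at h3
  have hs0 : 0 < s := by
    rcases hs.lt_or_eq with h5 | h5
    · exact h5
    · rw [← h5] at h3; linarith [h3.2]
  have hb : bet (slope θ h) b = 1 := by
    have : s * (1 - bet (slope θ h) b) ≤ 0 := by linarith [h2.2]
    nlinarith
  have hs1 : s < 1 := by
    refine lt_of_le_of_ne h1 fun h5 => ?_
    have := abs_lt.1 (h4 h5)
    rw [h5, hb] at this; linarith [this.2]
  have hcont : Continuous fun u => sg b * u := continuous_const.mul continuous_id
  have := refractive_onLine hγ (q := hexVec h k 1 0) (O := (fun u => sg b * u) '' Ioo 0 1)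
    (isPreconnected_Ioo.image _ hcont.continuousOn) (t - sg b * s) ?_
    (mem_image_of_mem _ ⟨hs0, hs1⟩) ?_ ?_ (t' := 0) ?_
  · rw [slide_hexVec_zero] at this
    have h5 := this.1
    rw [← mul_zero (sg b), hexVec_mem_iff h le_rfl] at h5
    have := abs_lt.1 h5.2.1
    linarith [this.2]
  · rintro _ ⟨u, hu, rfl⟩ - q hr
    rw [slide_hexVec_zero] at hr
    rcases hr with ⟨b', ⟨j, c⟩, x, hx, f1, f2, f3, f4, f5, f6⟩ | hr
    · obtain ⟨i, c'⟩ := k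
      obtain rfl : c' = c := Tile.hex.inj f1
      replace f3 : fr (i, c') (pt (1 + slope θ h * (sg b * u)) (sg b * u)) =
        fr (j, c') (pt x (sg b')) := f3
      rw [show (slope θ h : ℝ) * (sg b * u) = (slope θ h * sg b) * u by ring, slope_mul_sg, hb] at f3
      rw [abs_lt] at hx
      have hu0 := hu.1
      have hu1 := hu.2
      rcases eq_or_turn i j with rfl | ⟨β, rfl⟩
      · obtain ⟨h6, h7⟩ := pt_inj.1 (fr_injective _ f3)
        cases b <;> cases b' <;> simp at h7 <;> linarith
      · rw [fr_turn] at f3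
        obtain ⟨h6, h7⟩ := pt_inj.1 (fr_injective _ f3)
        have hβ : β = !b := by
          cases β <;> cases b' <;> cases b <;> simp at h6 h7 ⊢ <;> linarith
        apply f5
        show cross (v (turn β i)) (hexDir θ i) = 0
        rw [cross_v_turn_hexDir_self h, hβ, bet_not, hb]; ring
    · obtain ⟨b', k', -, -, -, f1, -⟩ := hr
      exact triTile_ne_hex _ _ _ f1.symm
  · rw [slide_hexVec_zero, hexVec_mem_iff h hs]
    exact ⟨⟨h1, abs_le.2 h2⟩, abs_lt.2 h3, h4⟩
  · rw [slide_hexVec_zero, sub_add_cancel, h0]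
  · have := image_closure_subset_closure_image hcont (mem_image_of_mem (fun u => sg b * u)
      (show (0 : ℝ) ∈ closure (Ioo 0 1) by rw [closure_Ioo (by norm_num)]; norm_num))
    simpa using this

/-- A trajectory that meets a chord of a hexagon meets the axis of the frame. -/
lemma hex_axis (hγ : FollowsLines (lineX θ) γ) {k : Idx} {a σ t : ℝ} (ha : a ∈ Ioo (0 : ℝ) 1)
    (hm : (hexVec h k a σ).2.1 ∈ (hexVec h k a σ).1.region) (h0 : γ t = mkX (hexVec h k a σ)) :
    ∃ t₀, γ t₀ = mkX (hexVec h k a 0) := by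
  obtain ⟨b, s, hs, rfl⟩ := exists_sg σ
  have p1 := hexEnd_pos (κ := slope θ h) (b := true) ha
  have p2 := hexEnd_pos (κ := slope θ h) (b := false) ha
  rw [hexVec_mem h ha hs] at hm
  rcases hm.1.lt_or_eq with h1 | h1
  · refine ⟨_, (hex_chord h hγ (t₀ := t - sg b * s) (σ₀ := sg b * s) ha ?_ ?_ (σ := 0)
      ⟨by linarith, p1.le⟩).2⟩
    · cases b <;> simp <;> constructor <;> linarith
    · rwa [sub_add_cancel]
  · -- at an end of the chord, the trajectory comes from the inside or leaves to the inside
    subst h1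
    have hlt : ∃ p, Refracted p (hexVec h k a (sg b * hexEnd (slope θ h) b a)) ∧
        ∀ s > 0, (slide θ p (sg (!b) * s)).2.1 ∉ (slide θ p (sg (!b) * s)).1.region := by
      rcases le_or_gt a (bet (slope θ h) b) with h2 | h2
      · have e : hexEnd (slope θ h) b a = 1 := if_pos h2
        have h3 := hm.2 e
        rw [e, mul_one]
        exact ⟨_, Or.inr (hexTri_top h b k ha.1 h3), fun s hs => exit_triVec_inward h ha.1 h3 hs⟩
      · have e : hexEnd (slope θ h) b a = tau (slope θ h) b a := if_neg (not_le.2 h2)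
        have hbn := bet_not (slope θ h) b
        have ha1 := ha.2
        have e2 := tau_baseA ha h2.ne'
        rw [baseA, if_neg (not_le.2 h2)] at e2
        rw [e]
        refine ⟨_, Or.inr (hexTri_prev h b k ha.2 h2), fun s hs => ?_⟩
        have := exit_triVec_outward h (b := !b) (k := pv b k) (a := a - bet (slope θ h) b)
          (by linarith) (by linarith) hs
        rwa [e2, show 2 - (1 - tau (slope θ h) b a) = 1 + tau (slope θ h) b a by ring] at this
    obtain ⟨p, hr, hexit⟩ := hlt
    have := hex_enter h hγ (b := !b) ha (h0.trans hr.mkX_eq.symm) (by rwa [Bool.not_not]) hexit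
    exact ⟨_, this⟩

/-- A trajectory of `T_{θ,+}` meets an axis. By the conditions on the direction and on the orientation
around the center, its vectors in a hexagon lie on lines `hexVec` with `a > 0`. -/
lemma trajectory_start (hγ : FollowsLines (lineX θ) γ)
    (hplus : ∀ (t : ℝ) (c : ℤ × ℤ) (z : ℂ) (d : Circle) (h : z ∈ (Tile.hex c).region),
      γ t = Quot.mk GlueX ⟨(Tile.hex c, z, d), h⟩ →
        (∃ i, (d : ℂ) = dir θ * v i) ∧ 0 < cross (z - ctr c) d) :
    ∃ t₀ k a, a ∈ Ioo (0 : ℝ) 1 ∧ γ t₀ = mkX (hexVec h k a 0) := by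
  obtain ⟨t, c, z, d, hz, e⟩ := exists_hex hγ (climb_pos h).ne'
  obtain ⟨⟨i, hd⟩, hc⟩ := hplus t c z d hz (by rw [e, mkX_of_mem (p := (Tile.hex c, z, d)) hz])
  obtain rfl : d = hexDir θ i := Circle.ext hd
  obtain ⟨a, σ, rfl⟩ : ∃ a σ, z = fr (i, c) (ray (slope θ h) a σ) :=
    ⟨_, _, by rw [ray_place_height, fr_unfr]⟩
  have hc' : 0 < a * Real.sin θ := by rw [← cross_hexVec h (i, c) a σ]; exact hc
  have ha : 0 < a := pos_of_mul_pos_left hc' (sin_pos_of_mem h).le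
  have hm : (hexVec h (i, c) a σ).2.1 ∈ (hexVec h (i, c) a σ).1.region := hz
  have ha1 : a ≤ 1 := by
    obtain ⟨b, s, hs, rfl⟩ := exists_sg σ
    have h1 := (abs_le.1 ((hexVec_mem_iff h hs).1 hm).1.2).2
    have := mul_nonneg hs (sub_nonneg.2 (bet_le_one (slope θ h) b))
    linarith
  rcases ha1.lt_or_eq with ha1 | rfl
  · obtain ⟨t₀, h0⟩ := hex_axis h hγ ⟨ha, ha1⟩ hm e
    exact ⟨t₀, _, _, ⟨ha, ha1⟩, h0⟩
  · exact (refractive_not_edge h hγ hm e).elim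

/-- From each of its points on, and up to each of its points, a refracted line is for a while a line
in one tile. -/
lemma vec_line (b : Bool) (k : Idx) {a : ℝ} (ha : a ∈ Ioo (0 : ℝ) 1)
    (hne : ∀ b, a ≠ bet (slope θ h) b) (w : ℝ) :
    ∃ δ > 0, ∃ q, ∀ s ∈ Icc (0 : ℝ) δ, w + s ≤ reach (slope θ h) b a →
      -(w + s) ≤ reach (slope θ h) (!b) a →
      (slide θ q (sg b * s)).2.1 ∈ (slide θ q (sg b * s)).1.region ∧
      mkX (vec h k a (sg b * (w + s))) = mkX (slide θ q (sg b * s)) := by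
  have tri : ∀ b s, 1 ≤ s → s ≤ reach (slope θ h) b a →
      (triVec h b k a (sg b * s)).2.1 ∈ (triVec h b k a (sg b * s)).1.region ∧
      mkX (vec h k a (sg b * s)) = mkX (triVec h b k a (sg b * s)) := by
    intro b s h1 h2
    have hlt : a < bet (slope θ h) b := by
      by_contra hn
      have hn' := lt_of_le_of_ne (not_lt.1 hn) (hne b).symm
      rw [reach, if_neg (not_le.2 hn')] at h2
      have := tau_lt_one ha (hne b)
      linarith
    rw [reach, if_pos hlt.le] at h2
    exact ⟨(triVec_mem_of_lt h ha.1 hlt).2 ⟨h1, h2⟩, mkX_vec_of_one_le h ha.1 hlt h1⟩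
  rcases le_or_gt 1 w with h1 | h1
  · refine ⟨1, one_pos, triVec h b k a (sg b * w), fun s hs h2 _ => ?_⟩
    rw [slide_triVec, ← mul_add]
    exact tri b _ (by linarith [hs.1]) h2
  rcases le_or_gt (-1) w with h2 | h2
  · refine ⟨1 - w, by linarith, hexVec h k a (sg b * w), fun s hs h3 h4 => ?_⟩
    rw [slide_hexVec, ← mul_add]
    obtain ⟨b', s', hs', e⟩ := exists_sg (sg b * (w + s))
    have hs1 : s' ≤ 1 := by
      have := hs.1
      have := hs.2
      cases b <;> cases b' <;> simp at e <;> linarith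
    have hs2 : s' ≤ reach (slope θ h) b' a := by
      have := reach_pos (κ := slope θ h) (b := b) ha
      have := reach_pos (κ := slope θ h) (b := !b) ha
      cases b <;> cases b' <;> simp at * <;> linarith
    have hm := vec_mem h (k := k) ha (hne b') hs' hs2
    rw [e]
    rw [vec_of_le_one h hs' hs1] at hm ⊢
    exact ⟨hm, rfl⟩
  · refine ⟨-1 - w, by linarith, triVec h (!b) k a (sg b * w), fun s hs _ h3 => ?_⟩
    rw [slide_triVec, ← mul_add]
    have e : sg b * (w + s) = sg (!b) * (-(w + s)) := by rw [sg_not]; ring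
    rw [e]
    exact tri (!b) _ (by linarith [hs.2]) h3

end

lemma returnMap_symm_apply (κ : Slope) (z : Sec κ) :
    (returnMap κ).symm z = baseMap κ false z := rfl

lemma chartX_C_zero {θ : ℝ} (h : θ ∈ Icc (Real.pi / 3) (2 * Real.pi / 3)) (z : Sec (slope θ h)) :
    (chartX h).C z 0 = mkX (hexVec h z.1 z.2 0) := by
  have := vec_of_le_one h (b := true) (k := z.1) (a := z.2) le_rfl zero_le_one
  rw [mul_zero] at this
  show mkX (vec h z.1 z.2 0) = _
  rw [this]

lemma chartX_start {θ : ℝ} (h : θ ∈ Icc (Real.pi / 3) (2 * Real.pi / 3)) {γ : ℝ → X}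
    (hγ : FollowsLines (lineX θ) γ)
    (hplus : ∀ (t : ℝ) (c : ℤ × ℤ) (z : ℂ) (d : Circle) (h : z ∈ (Tile.hex c).region),
      γ t = Quot.mk GlueX ⟨(Tile.hex c, z, d), h⟩ →
      (∃ i, (d : ℂ) = dir θ * v i) ∧ 0 < cross (z - ctr c) d) :
    ∃ t₀ z, γ t₀ = (chartX h).C z 0 := by
  obtain ⟨t₀, k, a, ha, h0⟩ := trajectory_start h hγ hplus
  have hB : a ∈ Bset (slope θ h) := by
    refine mem_Bset_of_step (Q := fun k a => a ∈ Ioo (0 : ℝ) 1 ∧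
      ∃ t₀, γ t₀ = mkX (hexVec h k a 0)) ?_ (k := k) ⟨ha, t₀, h0⟩
    rintro k a ⟨ha, t, ht⟩
    exact ⟨ha, fun b => ⟨baseA_mem_Ioo ha (hex_ne_bet h hγ ha ht b), _,
      (refractive_step h hγ ha ht b).2⟩⟩
  refine ⟨t₀, (k, ⟨a, hB⟩), ?_⟩
  rw [chartX_C_zero]
  exact h0

lemma chartX_step {θ : ℝ} (h : θ ∈ Icc (Real.pi / 3) (2 * Real.pi / 3)) {γ : ℝ → X}
    (hγ : FollowsLines (lineX θ) γ) (t₀ : ℝ) (z : Sec (slope θ h))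
    (h0 : γ t₀ = (chartX h).C z 0) :
    (∀ σ, -(chartX h).lo z ≤ σ → σ ≤ (chartX h).hi z → γ (t₀ + σ) = (chartX h).C z σ) ∧
    γ (t₀ + (chartX h).roof z) = (chartX h).C (returnMap (slope θ h) z) 0 ∧
    γ (t₀ - (chartX h).roof ((returnMap (slope θ h)).symm z)) =
      (chartX h).C ((returnMap (slope θ h)).symm z) 0 := by
  rw [chartX_C_zero] at h0
  refine ⟨fun σ h1 h2 => ?_, ?_, ?_⟩
  · obtain ⟨b, s, hs, rfl⟩ := exists_sg σ
    refine (refractive_step h hγ (sec_mem z) h0 b).1 s hs ?_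
    have h1 : -reach (slope θ h) false z.2 ≤ sg b * s := h1
    have h2 : sg b * s ≤ reach (slope θ h) true z.2 := h2
    cases b <;> simp at h1 h2 <;> linarith
  · have := (refractive_step h hγ (sec_mem z) h0 true).2
    rw [sg_true, one_mul] at this
    rw [chartX_C_zero]
    exact this
  · have := (refractive_step h hγ (sec_mem z) h0 false).2
    have e : (chartX h).roof ((returnMap (slope θ h)).symm z) =
        reach (slope θ h) true (baseA (slope θ h) false z.2) + reach (slope θ h) false z.2 := by
      rw [SuspensionChart.roof, Homeomorph.apply_symm_apply]
      rfl
    rw [chartX_C_zero, e, returnMap_symm_apply]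
    rw [sg_false] at this
    rw [sub_eq_add_neg, add_comm (reach _ true _), ← neg_one_mul]
    exact this

/-- The suspension flow describes the trajectories of the flow `T_{θ,+}`. -/
theorem chartX_describes {θ : ℝ} (h : θ ∈ Icc (Real.pi / 3) (2 * Real.pi / 3)) :
    (chartX h).Describes fun γ => IsRefractiveTrajectoryPlus θ fun t => γ (t / climb θ) := by
  have hH := climb_pos h
  constructor
  · rintro γ ⟨hγ, hplus⟩
    refine chartX_start h ((isRefractiveTrajectory_iff h _).1 hγ) fun t c z d hz e =>
      hplus (t * climb θ) c z d hz ?_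
    show γ (t * climb θ / climb θ) = _
    rw [mul_div_cancel_right₀ _ hH.ne']
    exact e
  · rintro γ t₀ z ⟨hγ, -⟩ h0
    exact chartX_step h ((isRefractiveTrajectory_iff h _).1 hγ) t₀ z h0
  · intro γ hγ
    constructor
    · rw [isRefractiveTrajectory_iff h]
      intro t
      obtain ⟨⟨z, σ, ε, hε, h1, h2, h3⟩, ⟨z', σ', ε', hε', h1', h2', h3'⟩⟩ := hγ t
      obtain ⟨δ, hδ, q, hq⟩ := vec_line h true z.1 (sec_mem z) (ne_bet z.2.2) σ
      obtain ⟨δ', hδ', q', hq'⟩ := vec_line h false z'.1 (sec_mem z') (ne_bet z'.2.2) (-σ')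
      have h1 : -reach (slope θ h) false z.2 ≤ σ := h1
      have h2 : σ + ε ≤ reach (slope θ h) true z.2 := h2
      have h1' : -reach (slope θ h) false z'.2 ≤ σ' - ε' := h1'
      have h2' : σ' ≤ reach (slope θ h) true z'.2 := h2'
      refine ⟨min (min ε δ) (min ε' δ'), lt_min (lt_min hε hδ) (lt_min hε' hδ'),
        ⟨q, fun s hs => ?_⟩, ⟨q', fun s hs => ?_⟩⟩
      · have a1 := hs.2.trans ((min_le_left _ _).trans (min_le_left _ _))
        have a2 := hs.2.trans ((min_le_left _ _).trans (min_le_right _ _))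
        have a0 := hs.1
        have := hq s ⟨a0, a2⟩ (by linarith) (by rw [Bool.not_true]; linarith)
        rw [sg_true, one_mul, one_mul] at this
        exact ⟨this.1, (h3 s ⟨a0, a1⟩).trans this.2⟩
      · have a1 := hs.2.trans ((min_le_right _ _).trans (min_le_left _ _))
        have a2 := hs.2.trans ((min_le_right _ _).trans (min_le_right _ _))
        have a0 := hs.1
        have := hq' s ⟨a0, a2⟩ (by linarith) (by rw [Bool.not_false]; linarith)
        rw [sg_false, neg_one_mul, neg_one_mul, show -(-σ' + s) = σ' - s by ring] at this
        exact ⟨this.1, (h3' s ⟨a0, a1⟩).trans this.2⟩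
    · intro t c w d hw e
      obtain ⟨⟨z, σ, ε, hε, h1, h2, h3⟩, -⟩ := hγ (t / climb θ)
      have h1 : -reach (slope θ h) false z.2 ≤ σ := h1
      have h2 : σ + ε ≤ reach (slope θ h) true z.2 := h2
      have e0 := h3 0 ⟨le_rfl, hε.le⟩
      rw [add_zero, add_zero] at e0
      have e1 : mkX (vec h z.1 z.2 σ) = mkX (Tile.hex c, w, d) := by
        rw [mkX_of_mem (p := (Tile.hex c, w, d)) hw]
        exact e0.symm.trans e
      have hv : ∃ k a σ', a ∈ Ioo (0 : ℝ) 1 ∧ OnVec h k a σ' (Tile.hex c, w, d) := by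
        rcases exists_vec_of_mkX_eq h h1 (by linarith) hw e1 with hv | ⟨b, -, e2⟩
        · exact ⟨_, _, _, sec_mem z, hv⟩
        · rw [e2]
          exact ⟨_, _, _, sec_mem (baseMap _ b z), onVec_vec h _ _ _⟩
      obtain ⟨k, a, σ', ha, e2 | ⟨b, e2⟩⟩ := hv
      · have e3 := cross_hexVec h k a σ'
        rw [← e2] at e3
        have hd : d = hexDir θ k.1 := congrArg (fun q => q.2.2) e2
        have hc : c = k.2 := Tile.hex.inj (congrArg (fun q => q.1) e2)
        rw [hd, hc]
        exact ⟨⟨k.1, rfl⟩, by rw [e3]; exact mul_pos ha.1 (sin_pos_of_mem h)⟩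
      · exact (triTile_ne_hex _ _ _ (congrArg (fun q => q.1) e2).symm).elim

/-! ### Counting visits to a cross-section -/

lemma encard_union_ennreal {α : Type*} {s t : Set α} (h : Disjoint s t) :
    ((s ∪ t).encard : ℝ≥0∞) = s.encard + t.encard := by
  rw [encard_union_eq h, ENat.toENNReal_add]

/-- If the fibres over `Z` of a Borel set are uniformly separated, then the number of points in the
fibre is a measurable function. The set is cut into slabs which meet each fibre at most once; by the
Lusin–Souslin theorem, they have measurable projections. -/
lemma measurable_encard_fibre {Z : Type*} [MeasurableSpace Z] [StandardBorelSpace Z]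
    {G : Set (Z × ℝ)} (hG : MeasurableSet G) {w : ℝ} (hw : 0 < w)
    (hsep : ∀ z s s', (z, s) ∈ G → (z, s') ∈ G → s < s' → w ≤ s' - s) :
    Measurable fun z => ({s | (z, s) ∈ G}.encard : ℝ≥0∞) := by
  let slab : ℤ → Set (Z × ℝ) := fun j => G ∩ {p | ⌊p.2 / w⌋ = j}
  have hslab : ∀ j, MeasurableSet (slab j) := fun j =>
    hG.inter (measurableSet_eq_fun (Int.measurable_floor.comp (measurable_snd.div_const w))
      measurable_const)
  have hle : ∀ z s s', (z, s) ∈ G → (z, s') ∈ G → ⌊s / w⌋ = ⌊s' / w⌋ → s' ≤ s := by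
    intro z s s' hs hs' e
    by_contra! h
    have h1 := hsep z s s' hs hs' h
    have h2 := Int.floor_le (s / w)
    have h3 := Int.lt_floor_add_one (s' / w)
    rw [e, le_div_iff₀ hw] at h2
    rw [div_lt_iff₀ hw] at h3
    linarith
  have hinj : ∀ j, InjOn Prod.fst (slab j) := by
    rintro j ⟨z, s⟩ ⟨hs, e⟩ ⟨z', s'⟩ ⟨hs', e'⟩ (rfl : z = z')
    have e : ⌊s / w⌋ = j := e
    have e' : ⌊s' / w⌋ = j := e'
    rw [le_antisymm (hle z s' s hs' hs (e'.trans e.symm)) (hle z s s' hs hs' (e.trans e'.symm))]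
  have hproj : ∀ j, MeasurableSet (Prod.fst '' slab j) := fun j =>
    (hslab j).image_of_measurable_injOn measurable_fst (hinj j)
  have key : (fun z => ({s | (z, s) ∈ G}.encard : ℝ≥0∞)) =
      fun z => ∑' j, (Prod.fst '' slab j).indicator (fun _ => (1 : ℝ≥0∞)) z := by
    funext z
    -- the points of the fibre correspond to the slabs which meet it
    have e : {s | (z, s) ∈ G}.encard = {j | z ∈ Prod.fst '' slab j}.encard := by
      have : {j | z ∈ Prod.fst '' slab j} = (fun s : ℝ => ⌊s / w⌋) '' {s | (z, s) ∈ G} := by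
        ext j
        constructor
        · rintro ⟨⟨z', s⟩, ⟨hs, e⟩, rfl⟩
          exact ⟨s, hs, e⟩
        · rintro ⟨s, hs, e⟩
          exact ⟨(z, s), ⟨hs, e⟩, rfl⟩
      rw [this, InjOn.encard_image]
      intro s hs s' hs' e
      exact le_antisymm (hle z s' s hs' hs e.symm) (hle z s s' hs hs' e)
    rw [e, ← ENNReal.tsum_set_one, tsum_subtype _ fun _ => (1 : ℝ≥0∞)]
    rfl
  rw [key]
  exact Measurable.tsum fun j => measurable_const.indicator (hproj j)

namespace SuspensionChart

variable {Z : Type*} [TopologicalSpace Z] {f : Z ≃ₜ Z} {M : Type*} [TopologicalSpace M]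
  (D : SuspensionChart f M)

/-- The number of visits to `A` of the trajectory of `z`, up to its first return. -/
def visits (A : Set M) (z : Z) : ℝ≥0∞ := {s : ℝ | (0 ≤ s ∧ s < 1) ∧ D.orbit z s ∈ A}.encard

/-- The number of points of `A` on the part of the trajectory `C z` which is singled out by `P`. -/
def hits (P : Set (Z × ℝ)) (A : Set M) (z : Z) : ℝ≥0∞ := {σ : ℝ | (z, σ) ∈ P ∧ D.C z σ ∈ A}.encard

/-- A choice of one representative for each point: of the two times `hi z` along `C z` and
`-lo (f z)` along `C (f z)`, which belong to the same point, just one is chosen. -/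
structure IsFundamental (P : Set (Z × ℝ)) : Prop where
  mem_Icc : ∀ z σ, (z, σ) ∈ P → -D.lo z ≤ σ ∧ σ ≤ D.hi z
  of_mem_Ioo : ∀ z σ, -D.lo z < σ → σ < D.hi z → (z, σ) ∈ P
  hi_mem_iff : ∀ z, (z, D.hi z) ∈ P ↔ (f z, -D.lo (f z)) ∉ P

lemma hits_eq_add {P P' P'' : Set (Z × ℝ)} (h : P = P' ∪ P'') (hd : Disjoint P' P'') (A : Set M)
    (z : Z) : D.hits P A z = D.hits P' A z + D.hits P'' A z := by
  rw [hits, hits, hits, ← encard_union_ennreal]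
  · congr 2
    ext σ
    simp only [h, mem_ofPred_eq, mem_union]
    tauto
  · refine disjoint_left.2 fun σ h1 h2 => ?_
    exact disjoint_left.1 hd h1.1 h2.1

/-- The visits up to the first return happen at nonnegative times along `C z` and at
negative times along `C (f z)`. -/
lemma visits_eq {P : Set (Z × ℝ)} (hP : D.IsFundamental P) (A : Set M) (z : Z) :
    D.visits A z = D.hits (P ∩ {p | 0 ≤ p.2}) A z + D.hits (P ∩ {p | p.2 < 0}) A (f z) := by
  have hr := D.roof_pos z
  have hro : D.roof z = D.hi z + D.lo (f z) := rfl
  have hhi := D.hi_pos z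
  have hlo := D.lo_pos (f z)
  have horb : ∀ s, 0 ≤ s → s < 1 → D.orbit z s = D.loop z s := by
    intro s h0 h1
    have := D.orbit_eq_loop z 0 (s := s) (by simpa using h0) (by simpa using h1.le)
    rw [Int.cast_zero, sub_zero] at this
    exact this
  have hinj : Function.Injective fun s : ℝ => s * D.roof z := mul_left_injective₀ hr.ne'
  have hinj' : Function.Injective fun s : ℝ => s * D.roof z - D.roof z := fun s s' e =>
    hinj (sub_left_injective e)
  have e1 : D.hits (P ∩ {p | 0 ≤ p.2}) A z =
      {s : ℝ | 0 ≤ s ∧ (z, s * D.roof z) ∈ P ∧ D.C z (s * D.roof z) ∈ A}.encard := by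
    rw [hits, ← hinj.encard_image {s : ℝ | 0 ≤ s ∧ (z, s * D.roof z) ∈ P ∧ _}]
    congr 2
    ext σ
    constructor
    · rintro ⟨⟨h1, h2⟩, h3⟩
      have e : σ / D.roof z * D.roof z = σ := div_mul_cancel₀ _ hr.ne'
      refine ⟨σ / D.roof z, ⟨div_nonneg h2 hr.le, ?_, ?_⟩, e⟩ <;> rw [e]
      exacts [h1, h3]
    · rintro ⟨s, ⟨h1, h2, h3⟩, rfl⟩
      exact ⟨⟨h2, mul_nonneg h1 hr.le⟩, h3⟩
  have e2 : D.hits (P ∩ {p | p.2 < 0}) A (f z) =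
      {s : ℝ | s < 1 ∧ (f z, s * D.roof z - D.roof z) ∈ P ∧
        D.C (f z) (s * D.roof z - D.roof z) ∈ A}.encard := by
    rw [hits, ← hinj'.encard_image {s : ℝ | s < 1 ∧ (f z, s * D.roof z - D.roof z) ∈ P ∧ _}]
    congr 2
    ext σ
    constructor
    · rintro ⟨⟨h1, h2⟩, h3⟩
      have h2 : σ < 0 := h2
      have e : (σ + D.roof z) / D.roof z * D.roof z - D.roof z = σ := by
        rw [div_mul_cancel₀ _ hr.ne']; ring
      refine ⟨(σ + D.roof z) / D.roof z, ⟨?_, ?_, ?_⟩, e⟩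
      · rw [div_lt_one hr]; linarith
      · rw [e]; exact h1
      · rw [e]; exact h3
    · rintro ⟨s, ⟨h1, h2, h3⟩, rfl⟩
      refine ⟨⟨h2, ?_⟩, h3⟩
      show s * D.roof z - D.roof z < 0
      have := mul_lt_mul_of_pos_right h1 hr
      linarith
  rw [e1, e2, visits, ← encard_union_ennreal]
  · congr 2
    ext s
    simp only [mem_ofPred_eq, mem_union]
    constructor
    · rintro ⟨⟨h0, h1⟩, h2⟩
      rw [horb s h0 h1] at h2
      have a0 := mul_nonneg h0 hr.le
      have a1 := mul_lt_mul_of_pos_right h1 hr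
      rcases lt_trichotomy (s * D.roof z) (D.hi z) with c | c | c
      · rw [D.loop_of_le c.le] at h2
        exact Or.inl ⟨h0, hP.of_mem_Ioo _ _ (by have := D.lo_pos z; linarith) c, h2⟩
      · by_cases hm : (z, D.hi z) ∈ P
        · rw [D.loop_of_le c.le] at h2
          exact Or.inl ⟨h0, by rw [c]; exact hm, h2⟩
        · rw [D.loop_of_ge c.ge] at h2
          rw [hP.hi_mem_iff, not_not] at hm
          refine Or.inr ⟨h1, ?_, h2⟩
          rw [show s * D.roof z - D.roof z = -D.lo (f z) by linarith]
          exact hm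
      · rw [D.loop_of_ge c.le] at h2
        refine Or.inr ⟨h1, hP.of_mem_Ioo _ _ (by linarith) ?_, h2⟩
        have := D.hi_pos (f z)
        linarith
    · rintro (⟨h0, h1, h2⟩ | ⟨h0, h1, h2⟩)
      · have c := (hP.mem_Icc _ _ h1).2
        have h3 : s < 1 := by
          by_contra! h
          have := mul_le_mul_of_nonneg_right h hr.le
          linarith
        rw [horb s h0 h3, D.loop_of_le c]
        exact ⟨⟨h0, h3⟩, h2⟩
      · have c := (hP.mem_Icc _ _ h1).1
        have h3 : 0 ≤ s := by
          by_contra! h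
          have := mul_neg_of_neg_of_pos h hr
          linarith
        rw [horb s h3 h0, D.loop_of_ge (by linarith)]
        exact ⟨⟨h3, h0⟩, h2⟩
  · refine disjoint_left.2 ?_
    rintro s ⟨-, h1, -⟩ ⟨-, h2, -⟩
    have c := (hP.mem_Icc _ _ h1).2
    have c' := (hP.mem_Icc _ _ h2).1
    have c2 : s * D.roof z = D.hi z := by linarith
    rw [c2] at h1 h2
    refine (hP.hi_mem_iff z).1 h1 ?_
    rw [show -D.lo (f z) = D.hi z - D.roof z by linarith]
    exact h2

lemma norm_lt_and_sub_le (z : Z) {σ σ' : ℝ} (h : σ < σ') :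
    D.norm z σ < D.norm z σ' ∧ D.norm z σ' - D.norm z σ ≤ σ' - σ := by
  have aux : ∀ (r x y : ℝ), 1 ≤ r → x ≤ y → (x < y → x / r < y / r) ∧ y / r - x / r ≤ y - x := by
    intro r x y hr hxy
    have hr0 : 0 < r := by linarith
    refine ⟨fun h => div_lt_div_of_pos_right h hr0, ?_⟩
    rw [← sub_div]
    exact div_le_self (by linarith) hr
  have h1 : 1 ≤ D.roof z := D.one_le_roof z
  have h2 : 1 ≤ D.roof (f.symm z) := D.one_le_roof _
  unfold norm
  split_ifs with c c' c'
  · exact ⟨(aux _ _ _ h1 h.le).1 h, (aux _ _ _ h1 h.le).2⟩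
  · linarith
  · push Not at c
    have a := aux _ _ _ h2 c.le
    have b := aux _ _ _ h1 c'
    have a1 := a.1 c
    have a2 := a.2
    have b2 := b.2
    have : 0 ≤ σ' / D.roof z := div_nonneg c' (by linarith)
    rw [zero_div] at a1 a2 b2
    constructor <;> linarith
  · exact ⟨(aux _ _ _ h2 h.le).1 h, (aux _ _ _ h2 h.le).2⟩

/-- The number of visits to a Borel set with uniformly separated visits is measurable. -/
lemma measurable_hits [MeasurableSpace Z] [StandardBorelSpace Z] [BorelSpace (Z × ℝ)]
    {P : Set (Z × ℝ)} (hP : MeasurableSet P) (hPD : ∀ z σ, (z, σ) ∈ P → -D.lo z ≤ σ ∧ σ ≤ D.hi z)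
    {A : Set M} (hA : MeasurableSet {p : Z × ℝ | D.orbit p.1 p.2 ∈ A}) {w : ℝ} (hw : 0 < w)
    (hsep : ∀ z s s', D.orbit z s ∈ A → D.orbit z s' ∈ A → s < s' → w ≤ s' - s) :
    Measurable (D.hits P A) := by
  have e : D.hits P A = fun z => ({σ | (z, σ) ∈ P ∩
      (fun p : Z × ℝ => (p.1, D.norm p.1 p.2)) ⁻¹' {p | D.orbit p.1 p.2 ∈ A}}.encard : ℝ≥0∞) := by
    funext z
    rw [hits]
    congr 2
    ext σ
    refine and_congr_right fun h => ?_
    have := hPD z σ h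
    show _ ↔ D.orbit z (D.norm z σ) ∈ A
    rw [D.orbit_norm this.1 this.2]
  rw [e]
  refine measurable_encard_fibre (hP.inter (hA.preimage ?_)) hw ?_
  · exact (continuous_fst.prodMk D.norm_cont).measurable
  · rintro z s s' ⟨-, h1⟩ ⟨-, h2⟩ h
    have := D.norm_lt_and_sub_le z h
    exact (hsep z _ _ h1 h2 this.1).trans this.2

/-- The visits to a cross-section are separated in the normalized time. -/
lemma Describes.separated {D : SuspensionChart f M} {H : ℝ} (hH : 0 < H) {T : (ℝ → M) → Prop}
    (hD : D.Describes fun γ => T fun t => γ (t / H)) {A : Set M} (hA : IsCrossSection T A) :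
    ∃ w > 0, ∀ z s s', D.orbit z s ∈ A → D.orbit z s' ∈ A → s < s' → w ≤ s' - s := by
  obtain ⟨ε, hε, hA⟩ := hA
  refine ⟨ε / (3 * H), by positivity, fun z s s' h h' hlt => ?_⟩
  have e : ∀ u, D.orbit z ((D.clockIso z).symm (H * D.clock z u / H - 0)) = D.orbit z u := by
    intro u
    rw [mul_div_cancel_left₀ _ hH.ne', sub_zero]
    congr 1
    exact (D.clockIso z).symm_apply_apply u
  have h1 := hA _ (hD.traj_clock hH z 0) (H * D.clock z s) (H * D.clock z s')
    (by rw [e]; exact h) (by rw [e]; exact h')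
    (mul_lt_mul_of_pos_left (D.clock_strictMono z hlt) hH)
  have h2 := (D.clock_bounds z hlt.le).2
  rw [div_le_iff₀ (by positivity)]
  nlinarith

end SuspensionChart

/-! ### The measure on the section and its invariance -/

lemma measurableSet_Bset (κ : Slope) : MeasurableSet (Bset κ) := by
  have : Bset κ = (Ioi 0 ∩ Iio 1) ∩ ⋂ (n : ℤ), ⋂ (m : ℤ), {a : ℝ | a + n * bet κ true = m}ᶜ := by
    ext a
    simp only [Bset, mem_ofPred_eq, mem_inter_iff, mem_Ioi, mem_Iio, mem_iInter, mem_compl_iff,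
      and_assoc]
  rw [this]
  refine (measurableSet_Ioi.inter measurableSet_Iio).inter
    (MeasurableSet.iInter fun n => MeasurableSet.iInter fun m => MeasurableSet.compl ?_)
  exact measurableSet_eq_fun (measurable_id.add_const _) measurable_const

instance (κ : Slope) : StandardBorelSpace (Bset κ) := (measurableSet_Bset κ).standardBorel

instance (κ : Slope) : StandardBorelSpace (Sec κ) := inferInstance
instance (κ : Slope) : BorelSpace (Sec κ × ℝ) := inferInstance

/-- A function on the section, on one of the short diagonals, extended by zero. -/
def spread {κ : Slope} (F : Sec κ → ℝ≥0∞) (k : Idx) : ℝ → ℝ≥0∞ :=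
  Function.extend Subtype.val (fun a => F (k, a)) 0

lemma spread_of_mem {κ : Slope} (F : Sec κ → ℝ≥0∞) (k : Idx) {a : ℝ} (ha : a ∈ Bset κ) :
    spread F k a = F (k, ⟨a, ha⟩) :=
  Subtype.val_injective.extend_apply _ _ (⟨a, ha⟩ : Bset κ)

lemma spread_of_notMem {κ : Slope} (F : Sec κ → ℝ≥0∞) (k : Idx) {a : ℝ} (ha : a ∉ Bset κ) :
    spread F k a = 0 :=
  Function.extend_apply' _ _ _ fun ⟨b, hb⟩ => ha (hb ▸ b.2)

/-- The integral over the section, with respect to the Lebesgue measure on the short diagonals. -/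
def total {κ : Slope} (F : Sec κ → ℝ≥0∞) : ℝ≥0∞ := ∑' k, ∫⁻ a : ℝ, spread F k a

lemma total_add {κ : Slope} {F : Sec κ → ℝ≥0∞} (hF : Measurable F) (G : Sec κ → ℝ≥0∞) :
    total (fun z => F z + G z) = total F + total G := by
  rw [total, total, total, ← ENNReal.tsum_add]
  refine tsum_congr fun k => ?_
  rw [← lintegral_add_left]
  · refine lintegral_congr fun a => ?_
    by_cases ha : a ∈ Bset κ
    · simp only [spread_of_mem _ _ ha]
    · simp only [spread_of_notMem _ _ ha, add_zero]
  · exact (MeasurableEmbedding.subtype_coe (measurableSet_Bset κ)).measurable_extend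
      (hF.comp measurable_prodMk_left) measurable_const

lemma lintegral_spread_split {κ : Slope} (F : Sec κ → ℝ≥0∞) (k : Idx) {c : ℝ} (h0 : 0 ≤ c)
    (h1 : c ≤ 1) : ∫⁻ a, spread F k a =
      (∫⁻ a in Ioc 0 c, spread F k a) + ∫⁻ a in Ioc c 1, spread F k a := by
  rw [← lintegral_union measurableSet_Ioc (Ioc_disjoint_Ioc_of_le le_rfl),
    Ioc_union_Ioc_eq_Ioc h0 h1, ← lintegral_indicator measurableSet_Ioc]
  refine lintegral_congr fun a => ?_
  by_cases ha : a ∈ Bset κ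
  · rw [indicator_of_mem (show a ∈ Ioc (0 : ℝ) 1 from ⟨ha.1, ha.2.1.le⟩)]
  · rw [spread_of_notMem _ _ ha]
    symm
    exact indicator_apply_eq_zero.2 fun _ => spread_of_notMem _ _ ha

lemma mem_Bset_of_baseA_mem {κ : Slope} {b : Bool} {a : ℝ} (ha : a ∈ Ioc (0 : ℝ) 1)
    (h : baseA κ b a ∈ Bset κ) : a ∈ Bset κ := by
  have hn := bet_not κ b
  have e : baseA κ (!b) (baseA κ b a) = a := by
    by_cases hc : a ≤ bet κ b
    · have : ¬ (a + 1 - bet κ b ≤ bet κ (!b)) := by rw [hn]; linarith [ha.1]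
      rw [show baseA κ b a = a + 1 - bet κ b from if_pos hc, baseA, if_neg this, hn]; ring
    · have : a - bet κ b ≤ bet κ (!b) := by rw [hn]; linarith [ha.2]
      rw [show baseA κ b a = a - bet κ b from if_neg hc, baseA, if_pos this, hn]; ring
  rw [← e]
  exact baseA_mem _ h

lemma spread_comp {κ : Slope} (F : Sec κ → ℝ≥0∞) (k : Idx) {a : ℝ} (ha : a ∈ Ioc (0 : ℝ) 1) :
    spread (fun z => F (returnMap κ z)) k a =
      spread F (baseK κ true k a) (baseA κ true a) := by
  by_cases h : a ∈ Bset κ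
  · rw [spread_of_mem _ _ h, spread_of_mem _ _ (baseA_mem true h)]
    rfl
  · rw [spread_of_notMem _ _ h, spread_of_notMem _ _ fun h' => h (mem_Bset_of_baseA_mem ha h')]

lemma setLIntegral_Ioc_comp_add (g : ℝ → ℝ≥0∞) (p q c : ℝ) :
    ∫⁻ a in Ioc p q, g (a + c) = ∫⁻ a in Ioc (p + c) (q + c), g a := by
  have := (measurePreserving_add_right volume c).setLIntegral_comp_preimage_emb
    (measurableEmbedding_addRight c) g (Ioc (p + c) (q + c))
  rw [← this]
  simp

/-- The equivalence of the rhombi given by the gluing of the edges. -/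
def nxEquiv (b : Bool) : Idx ≃ Idx where
  toFun := nx b
  invFun := pv (!b)
  left_inv := pv_not_nx b
  right_inv k := by have := nx_not_pv (!b) k; rwa [Bool.not_not] at this

/-- The return map preserves the measure on the section: it is an exchange of intervals. -/
lemma total_comp_returnMap {κ : Slope} (F : Sec κ → ℝ≥0∞) :
    total (fun z => F (returnMap κ z)) = total F := by
  set β := bet κ true
  have h0 : 0 ≤ β := bet_nonneg κ true
  have h1 : β ≤ 1 := bet_le_one κ true
  have e1 : ∀ k, ∫⁻ a, spread (fun z => F (returnMap κ z)) k a =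
      (∫⁻ a in Ioc (1 - β) 1, spread F (nx true k) a) +
        ∫⁻ a in Ioc 0 (1 - β), spread F (pv true k) a := by
    intro k
    rw [lintegral_spread_split _ k h0 h1]
    congr 1
    · have : ∀ a ∈ Ioc 0 β, spread (fun z => F (returnMap κ z)) k a =
          spread F (nx true k) (a + (1 - β)) := by
        intro a ha
        rw [spread_comp F k ⟨ha.1, ha.2.trans h1⟩, baseK, baseA, if_pos ha.2, if_pos ha.2,
          add_sub_assoc]
      rw [setLIntegral_congr_fun measurableSet_Ioc this, setLIntegral_Ioc_comp_add]
      ring_nf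
    · have : ∀ a ∈ Ioc β 1, spread (fun z => F (returnMap κ z)) k a =
          spread F (pv true k) (a + -β) := by
        intro a ha
        rw [spread_comp F k ⟨h0.trans_lt ha.1, ha.2⟩, baseK, baseA, if_neg (not_le.2 ha.1),
          if_neg (not_le.2 ha.1), sub_eq_add_neg]
      rw [setLIntegral_congr_fun measurableSet_Ioc this, setLIntegral_Ioc_comp_add]
      ring_nf
  have e2 : ∑' k, ∫⁻ a in Ioc (1 - β) 1, spread F (nx true k) a =
      ∑' k, ∫⁻ a in Ioc (1 - β) 1, spread F k a :=
    (nxEquiv true).tsum_eq fun k => ∫⁻ a in Ioc (1 - β) 1, spread F k a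
  have e3 : ∑' k, ∫⁻ a in Ioc 0 (1 - β), spread F (pv true k) a =
      ∑' k, ∫⁻ a in Ioc 0 (1 - β), spread F k a :=
    (nxEquiv false).symm.tsum_eq fun k => ∫⁻ a in Ioc 0 (1 - β), spread F k a
  rw [total, total, tsum_congr e1, ENNReal.tsum_add, e2, e3, ← ENNReal.tsum_add]
  refine tsum_congr fun k => ?_
  rw [lintegral_spread_split F k (sub_nonneg.2 h1) (sub_le_self 1 h0), add_comm]

/-- The measure of a cross-section, counted by the hits in a set of representatives, is the integral
of the number of visits. -/
lemma total_hits {κ : Slope} {M : Type*} [TopologicalSpace M] (D : SuspensionChart (returnMap κ) M)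
    {P : Set (Sec κ × ℝ)} (hP : D.IsFundamental P) (hPm : MeasurableSet P)
    {A : Set M} (hA : MeasurableSet {p : Sec κ × ℝ | D.orbit p.1 p.2 ∈ A}) {w : ℝ} (hw : 0 < w)
    (hsep : ∀ z s s', D.orbit z s ∈ A → D.orbit z s' ∈ A → s < s' → w ≤ s' - s) :
    total (D.hits P A) = total (D.visits A) := by
  have hm : MeasurableSet {p : Sec κ × ℝ | 0 ≤ p.2} := measurableSet_le measurable_const measurable_snd
  have hd : Disjoint (P ∩ {p | 0 ≤ p.2}) (P ∩ {p | p.2 < 0}) := by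
    refine disjoint_left.2 fun p h1 h2 => ?_
    have h1 : 0 ≤ p.2 := h1.2
    have h2 : p.2 < 0 := h2.2
    linarith
  have hu : P = P ∩ {p | 0 ≤ p.2} ∪ P ∩ {p | p.2 < 0} := by
    rw [← inter_union_distrib_left]
    exact (inter_eq_left.2 fun p _ => le_or_gt 0 p.2).symm
  have hplus : Measurable (D.hits (P ∩ {p | 0 ≤ p.2}) A) :=
    D.measurable_hits (hPm.inter hm) (fun z σ h => hP.mem_Icc z σ h.1) hA hw hsep
  rw [funext fun z => D.hits_eq_add hu hd A z, total_add hplus,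
    ← total_comp_returnMap (D.hits (P ∩ {p | p.2 < 0}) A), ← total_add hplus]
  congr 1
  funext z
  exact (D.visits_eq hP A z).symm

/-! ### The transverse measure on the surface -/

lemma lintegral_affine (g : ℝ → ℝ≥0∞) (p : ℝ) {c : ℝ} (hc : 0 < c) :
    ∫⁻ y, g y = ENNReal.ofReal c * ∫⁻ a, g (p - a * c) := by
  have h1 : ∫⁻ y, g y = ∫⁻ y, g (y + p) :=
    ((measurePreserving_add_right volume p).lintegral_comp_emb
      (measurableEmbedding_addRight p) g).symm
  rw [h1]
  conv_lhs => rw [← Real.smul_map_volume_mul_right (neg_ne_zero.2 hc.ne')]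
  rw [lintegral_smul_measure, abs_neg, abs_of_pos hc, smul_eq_mul,
    (measurableEmbedding_mulRight₀ (neg_ne_zero.2 hc.ne')).lintegral_map]
  congr 1
  refine lintegral_congr fun a => ?_
  congr 1
  ring

lemma cross_dir_ray {θ : ℝ} (h : θ ∈ Icc (Real.pi / 3) (2 * Real.pi / 3)) (a σ : ℝ) :
    cross (dir θ) (ray (slope θ h) a σ) = -(a * Real.sin θ) := by
  have hs := sin_pos_of_mem h
  have h3 := half_sqrt_pos
  rw [dir_eq_pt h, cross, ray]
  simp only [pt_re, pt_im, climb]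
  field_simp
  ring

/-- The representatives of the points of `S` that are not on the upper edges of the rhombi. -/
def belowTop (κ : Slope) : Set (Sec κ × ℝ) :=
  {p | -tau κ false p.1.2 ≤ p.2 ∧ p.2 < tau κ true p.1.2}

lemma belowTop_isFundamental (κ : Slope) : (chartS κ).IsFundamental (belowTop κ) where
  mem_Icc _ _ h := ⟨h.1, h.2.le⟩
  of_mem_Ioo _ _ h h' := ⟨h.le, h'⟩
  hi_mem_iff z := by
    have p1 : 0 < tau κ true (returnMap κ z).2 := tau_pos (sec_mem _)
    have p2 : 0 < tau κ false (returnMap κ z).2 := tau_pos (sec_mem _)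
    refine iff_of_false (fun h => lt_irrefl _ h.2) (not_not.2 ⟨le_rfl, ?_⟩)
    show -tau κ false (returnMap κ z).2 < _
    linarith

lemma measurableSet_belowTop (κ : Slope) : MeasurableSet (belowTop κ) :=
  (measurableSet_le ((tau_continuous κ false).measurable.comp measurable_fst).neg
    measurable_snd).inter
    (measurableSet_lt measurable_snd ((tau_continuous κ true).measurable.comp measurable_fst))

lemma mem_segment_pt {x y x' y' : ℝ} {z : ℂ} : z ∈ segment ℝ (pt x y) (pt x' y') ↔
    ∃ t ∈ Icc (0 : ℝ) 1, z = pt (x + t * (x' - x)) (y + t * (y' - y)) := by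
  rw [segment_eq_image_lineMap]
  constructor
  · rintro ⟨t, ht, rfl⟩
    refine ⟨t, ht, ?_⟩
    rw [AffineMap.lineMap_apply, vsub_eq_sub, vadd_eq_add, pt_sub, pt_smul, pt_add, pt_inj]
    constructor <;> ring
  · rintro ⟨t, ht, rfl⟩
    refine ⟨t, ht, ?_⟩
    rw [AffineMap.lineMap_apply, vsub_eq_sub, vadd_eq_add, pt_sub, pt_smul, pt_add, pt_inj]
    constructor <;> ring

/-- The upper edges of the rhombus are the upper ends of the trajectories. -/
lemma ray_mem_upper_iff {κ : Slope} {a σ : ℝ} (ha : a ∈ Ioo (0 : ℝ) 1) (h : σ ≤ tau κ true a) :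
    (ray κ a σ ∉ segment ℝ (v 0) (-v 2) ∧ ray κ a σ ∉ segment ℝ (-v 2) 0) ↔ σ < tau κ true a := by
  have h1 : σ ≤ 1 := h.trans (tau_le_one a)
  have hp := tau_pos (κ := κ) (b := true) ha
  have hk : (κ : ℝ) = 1 / 2 - bet κ true := by simp [bet]
  rw [v_zero, v_two, pt_neg, zero_eq_pt, mem_segment_pt, mem_segment_pt, lt_tau_iff ha h1, ray, hk]
  have h2 := (le_tau_iff ha h1).1 h
  constructor
  · rintro ⟨n1, n2⟩
    have h0 : σ < 0 ∨ 0 ≤ σ := lt_or_ge _ _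
    rcases h0 with h0 | h0
    · exact (lt_tau_iff ha h1).1 (h0.trans hp)
    · refine ⟨lt_of_le_of_ne h2.1 fun e => n2 ⟨1 - σ, ⟨by linarith, by linarith⟩, ?_⟩,
        lt_of_le_of_ne h2.2 fun e => n1 ⟨σ, ⟨h0, h1⟩, ?_⟩⟩
      · rw [pt_inj]; constructor <;> linarith
      · rw [pt_inj]; constructor <;> linarith
  · rintro ⟨n1, n2⟩
    constructor
    · rintro ⟨t, -, e⟩
      rw [pt_inj] at e
      obtain ⟨e1, e2⟩ := e
      obtain rfl : σ = t := by linarith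
      linarith
    · rintro ⟨t, -, e⟩
      rw [pt_inj] at e
      obtain ⟨e1, e2⟩ := e
      obtain rfl : σ = 1 - t := by linarith
      linarith

lemma mem_Bset_of_mkS_mem {κ : Slope} {k : Idx} {a σ : ℝ} (hw : ray κ a σ ∈ rhombus)
    (h : mkS k (ray κ a σ) ∈ (chartS κ).dom) : a ∈ Bset κ := by
  obtain ⟨z, σ', ⟨h0, h1⟩, e⟩ := (chartS κ).mem_dom_iff.1 h
  obtain ⟨z', σ'', -, -, e'⟩ := (exists_ray_of_mkS_eq h0 h1 hw e.symm).2
  rw [(ray_inj.1 e').1]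
  exact z'.2.2

/-- The transverse measure on `S` in terms of the section. -/
lemma transverseS_eq {θ : ℝ} (h : θ ∈ Icc (Real.pi / 3) (2 * Real.pi / 3)) {A : Set S}
    (hA : A ⊆ (chartS (slope θ h)).dom) :
    transverseS θ A =
      ENNReal.ofReal (Real.sin θ) * total ((chartS (slope θ h)).hits (belowTop _) A) := by
  have hs := sin_pos_of_mem h
  rw [transverseS, total, ← ENNReal.tsum_mul_left]
  refine tsum_congr fun k => ?_
  rw [lintegral_affine _ 0 hs]
  congr 1
  refine lintegral_congr fun a => ?_
  have hmk : ∀ w, (∃ hw : w ∈ rhombus, Quot.mk GlueS ⟨(k, w), hw⟩ ∈ A) ↔ w ∈ rhombus ∧ mkS k w ∈ A := by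
    intro w
    constructor
    · rintro ⟨hw, hm⟩
      exact ⟨hw, by rw [mkS_of_mem hw]; exact hm⟩
    · rintro ⟨hw, hm⟩
      exact ⟨hw, by rw [mkS_of_mem hw] at hm; exact hm⟩
  simp only [hmk]
  have e : {w : ℂ | w ∉ segment ℝ (v 0) (-v 2) ∧ w ∉ segment ℝ (-v 2) 0 ∧
      cross (dir θ) w = 0 - a * Real.sin θ ∧ w ∈ rhombus ∧ mkS k w ∈ A} =
      ray (slope θ h) a '' {σ | (ray (slope θ h) a σ ∉ segment ℝ (v 0) (-v 2) ∧
        ray (slope θ h) a σ ∉ segment ℝ (-v 2) 0) ∧ ray (slope θ h) a σ ∈ rhombus ∧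
        mkS k (ray (slope θ h) a σ) ∈ A} := by
    ext w
    constructor
    · rintro ⟨h1, h2, h3, h4⟩
      have e := ray_place_height (slope θ h) w
      rw [← e, cross_dir_ray] at h3
      have : place (slope θ h) w = a := mul_right_cancel₀ hs.ne' (by linarith)
      rw [this] at e
      refine ⟨height w, ?_, e⟩
      simp only [mem_ofPred_eq, e]
      exact ⟨⟨h1, h2⟩, h4⟩
    · rintro ⟨σ, ⟨⟨h1, h2⟩, h4⟩, rfl⟩
      exact ⟨h1, h2, by rw [cross_dir_ray, zero_sub], h4⟩
  rw [e, Function.Injective.encard_image fun σ σ' e => (ray_inj.1 e).2]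
  by_cases ha : a ∈ Bset (slope θ h)
  · rw [spread_of_mem _ _ ha, SuspensionChart.hits]
    have ha' : a ∈ Ioo (0 : ℝ) 1 := ⟨ha.1, ha.2.1⟩
    congr 2
    ext σ
    constructor
    · rintro ⟨h1, h2, h3⟩
      have h4 := mem_of_ray_mem ha' h2
      exact ⟨⟨h4.1, (ray_mem_upper_iff ha' h4.2).1 h1⟩, h3⟩
    · rintro ⟨⟨h1, h2⟩, h3⟩
      have h2 : σ < tau (slope θ h) true a := h2
      exact ⟨(ray_mem_upper_iff ha' h2.le).2 h2, ray_mem_of_mem ha' (ne_bet ha) h1 h2.le, h3⟩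
  · rw [spread_of_notMem _ _ ha]
    have : {σ | (ray (slope θ h) a σ ∉ segment ℝ (v 0) (-v 2) ∧
        ray (slope θ h) a σ ∉ segment ℝ (-v 2) 0) ∧ ray (slope θ h) a σ ∈ rhombus ∧
        mkS k (ray (slope θ h) a σ) ∈ A} = ∅ := by
      refine eq_empty_of_forall_notMem fun σ hσ => ha ?_
      exact mem_Bset_of_mkS_mem hσ.2.1 (hA hσ.2.2)
    rw [this]
    simp

/-! ### The transverse measure of the refractive flow -/

section

variable {θ : ℝ} (h : θ ∈ Icc (Real.pi / 3) (2 * Real.pi / 3))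

/-- The lines of vectors `hexVec` and `triVec b`, indexed together. -/
def strand : Option Bool → Idx → ℝ → ℝ → Tile × ℂ × Circle
  | none => hexVec h
  | some b => triVec h b

/-- The tile and the direction of a line of vectors. -/
def strandType (θ : ℝ) : Option Bool × Idx → Tile × Circle
  | (none, k) => (Tile.hex k.2, hexDir θ k.1)
  | (some b, k) => (triTile b k, triDir θ k.1)

lemma strandType_injective (θ : ℝ) : Function.Injective (strandType θ) := by
  rintro ⟨_ | b, k⟩ ⟨_ | b', k'⟩ e <;> simp only [strandType, Prod.mk.injEq] at e
  · rw [Prod.ext (hexDir_injective θ e.2) (Tile.hex.inj e.1)]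
  · exact (triTile_ne_hex _ _ _ e.1.symm).elim
  · exact (triTile_ne_hex _ _ _ e.1).elim
  · obtain ⟨rfl, e1⟩ := triTile_eq_iff.1 e.1
    rw [← triDir_injective θ e.2, triFrame_self] at e1
    rw [e1]

lemma strand_eq (o : Option Bool) (k : Idx) (a σ : ℝ) : strand h o k a σ =
    ((strandType θ (o, k)).1, (strand h o k a σ).2.1, (strandType θ (o, k)).2) := by
  cases o <;> rfl

lemma strand_injective (o : Option Bool) (k : Idx) (a : ℝ) :
    Function.Injective fun σ => (strand h o k a σ).2.1 := by
  intro σ σ' e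
  cases o
  · exact (ray_inj.1 (fr_injective k e)).2
  · exact (pt_inj.1 (fr_injective k e)).2

lemma exists_strand (o : Option Bool) (k : Idx) (z : ℂ) :
    ∃ a σ, (strand h o k a σ).2.1 = z := by
  obtain ⟨x, y, rfl⟩ := exists_fr k z
  rcases o with _ | b
  · refine ⟨x - slope θ h * y, y, ?_⟩
    show fr k (pt (x - slope θ h * y + slope θ h * y) y) = _
    rw [sub_add_cancel]
  · refine ⟨x - slope θ h * (2 * sg b - y), y, ?_⟩
    show fr k (pt (x - slope θ h * (2 * sg b - y) + slope θ h * (2 * sg b - y)) y) = _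
    rw [sub_add_cancel]

lemma onVec_strand (o : Option Bool) (k : Idx) (a σ : ℝ) : OnVec h k a σ (strand h o k a σ) := by
  rcases o with _ | b
  exacts [Or.inl rfl, Or.inr ⟨b, rfl⟩]

lemma OnVec.exists_strand {k : Idx} {a σ : ℝ} {q : Tile × ℂ × Circle} (hq : OnVec h k a σ q) :
    ∃ o, q = strand h o k a σ := by
  rcases hq with e | ⟨b, e⟩
  exacts [⟨none, e⟩, ⟨some b, e⟩]

lemma cross_fr (k : Idx) (u w : ℂ) :
    cross (u * v k.1) (fr k w) = cross (u * v k.1) (ctr k.2) + cross u w := by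
  simp only [cross_eq, fr, mul_add, Complex.add_im, map_mul]
  congr 2
  linear_combination ((starRingEnd ℂ) u * w) * v_mul_conj k.1

/-- The distances of the lines of vectors from the origin. -/
lemma cross_strand (o : Option Bool) (k : Idx) : ∃ p, ∀ a σ,
    cross (strandType θ (o, k)).2 (strand h o k a σ).2.1 = p - a * Real.sin θ := by
  have hs := sin_pos_of_mem h
  rcases o with _ | b
  · refine ⟨cross (dir θ * v k.1) (ctr k.2), fun a σ => ?_⟩
    show cross (dir θ * v k.1) (fr k _) = _
    rw [cross_fr, cross_dir_ray]
    ring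
  · refine ⟨cross (-(starRingEnd ℂ) (dir θ) * v k.1) (ctr k.2) -
      2 * slope θ h * sg b * Real.sin θ, fun a σ => ?_⟩
    show cross (-(starRingEnd ℂ) (dir θ) * v k.1) (fr k _) = _
    have e : cross (-(starRingEnd ℂ) (dir θ)) (pt (a + slope θ h * (2 * sg b - σ)) σ) =
        -((a + 2 * slope θ h * sg b) * Real.sin θ) := by
      have h3 := half_sqrt_pos
      rw [dir_eq_pt h, pt_conj, pt_neg, cross]
      simp only [pt_re, pt_im, climb]
      field_simp
      ring
    rw [cross_fr, e]
    ring

/-- A vector whose class lies on the flow `T_{θ,+}` lies on one of the lines of vectors through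
the section. -/
lemma exists_onVec_of_mkX_mem {q : Tile × ℂ × Circle} (hq : q.2.1 ∈ q.1.region)
    (hm : mkX q ∈ (chartX h).dom) : ∃ z : Sec (slope θ h), ∃ σ, OnVec h z.1 z.2 σ q := by
  obtain ⟨z, σ, ⟨h0, h1⟩, e⟩ := (chartX h).mem_dom_iff.1 hm
  rcases exists_vec_of_mkX_eq h h0 h1 hq e.symm with hv | ⟨b, -, rfl⟩
  · exact ⟨z, σ, hv⟩
  · exact ⟨_, _, onVec_vec h _ _ _⟩

/-- The number of points of `A` on a line of vectors, as they are counted by the transverse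
measure. -/
def strandHits (A : Set X) (o : Option Bool) (z : Sec (slope θ h)) : ℝ≥0∞ :=
  {σ | (strand h o z.1 z.2 σ).2.1 ∈ (strandType θ (o, z.1)).1.own ∧
    (strand h o z.1 z.2 σ).2.1 ∈ (strandType θ (o, z.1)).1.region ∧
    mkX (strand h o z.1 z.2 σ) ∈ A}.encard

lemma lintegral_strand {A : Set X} (hA : A ⊆ (chartX h).dom) (o : Option Bool) (k : Idx) :
    (∫⁻ y : ℝ, ({z : ℂ | z ∈ (strandType θ (o, k)).1.own ∧ cross (strandType θ (o, k)).2 z = y ∧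
      ∃ hz : z ∈ (strandType θ (o, k)).1.region, Quot.mk GlueX
        ⟨((strandType θ (o, k)).1, z, (strandType θ (o, k)).2), hz⟩ ∈ A}.encard : ℝ≥0∞)) =
      ENNReal.ofReal (Real.sin θ) * ∫⁻ a, spread (strandHits h A o) k a := by
  have hs := sin_pos_of_mem h
  obtain ⟨p, hp⟩ := cross_strand h o k
  rw [lintegral_affine _ p hs]
  congr 1
  refine lintegral_congr fun a => ?_
  have e : {z : ℂ | z ∈ (strandType θ (o, k)).1.own ∧
      cross (strandType θ (o, k)).2 z = p - a * Real.sin θ ∧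
      ∃ hz : z ∈ (strandType θ (o, k)).1.region, Quot.mk GlueX
        ⟨((strandType θ (o, k)).1, z, (strandType θ (o, k)).2), hz⟩ ∈ A} =
      (fun σ => (strand h o k a σ).2.1) '' {σ |
        (strand h o k a σ).2.1 ∈ (strandType θ (o, k)).1.own ∧
        (strand h o k a σ).2.1 ∈ (strandType θ (o, k)).1.region ∧ mkX (strand h o k a σ) ∈ A} := by
    have hmk : ∀ a σ, (strand h o k a σ).2.1 ∈ (strandType θ (o, k)).1.region →
        ∀ hz, mkX (strand h o k a σ) = Quot.mk GlueX
          ⟨((strandType θ (o, k)).1, (strand h o k a σ).2.1, (strandType θ (o, k)).2), hz⟩ := by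
      intro a σ hm hz
      conv_lhs => rw [strand_eq]
      exact mkX_of_mem hz
    ext z
    constructor
    · rintro ⟨h1, h2, h3, h4⟩
      obtain ⟨a', σ, rfl⟩ := exists_strand h o k z
      rw [hp] at h2
      obtain rfl : a' = a := mul_right_cancel₀ hs.ne' (by linarith)
      exact ⟨σ, ⟨h1, h3, by rw [hmk _ _ h3]; exact h4⟩, rfl⟩
    · rintro ⟨σ, ⟨h1, h3, h4⟩, rfl⟩
      exact ⟨h1, hp a σ, h3, by rw [← hmk _ _ h3]; exact h4⟩
  rw [e, (strand_injective h o k a).encard_image]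
  by_cases ha : a ∈ Bset (slope θ h)
  · rw [spread_of_mem _ _ ha]
    rfl
  · rw [spread_of_notMem _ _ ha]
    rw [ENat.toENNReal_eq_zero, encard_eq_zero]
    refine eq_empty_of_forall_notMem fun σ hσ => ha ?_
    have hr : (strand h o k a σ).2.1 ∈ (strand h o k a σ).1.region := by
      rw [strand_eq]; exact hσ.2.1
    obtain ⟨z, σ', hv⟩ := exists_onVec_of_mkX_mem h hr (hA hσ.2.2)
    rw [((onVec_strand h o k a σ).unique h hv).2.1]
    exact z.2.2

/-- The transverse measure of the refractive flow in terms of the section. -/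
lemma transverseX_eq {A : Set X} (hA : A ⊆ (chartX h).dom) :
    transverseX A = ENNReal.ofReal (Real.sin θ) * (total (strandHits h A none) +
      (total (strandHits h A (some true)) + total (strandHits h A (some false)))) := by
  let G : Tile × Circle → ℝ≥0∞ := fun q => ∫⁻ y : ℝ,
    ({z : ℂ | z ∈ q.1.own ∧ cross q.2 z = y ∧
      ∃ hz : z ∈ q.1.region, Quot.mk GlueX ⟨(q.1, z, q.2), hz⟩ ∈ A}.encard : ℝ≥0∞)
  have e1 : transverseX A = ∑' q, G q := ENNReal.tsum_prod.symm
  have e2 : Function.support G ⊆ range (strandType θ) := by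
    intro q hq
    by_contra hn
    refine hq ?_
    have : ∀ y, {z : ℂ | z ∈ q.1.own ∧ cross q.2 z = y ∧
        ∃ hz : z ∈ q.1.region, Quot.mk GlueX ⟨(q.1, z, q.2), hz⟩ ∈ A} = ∅ := by
      intro y
      refine eq_empty_of_forall_notMem ?_
      rintro z ⟨-, -, hz, hm⟩
      have hz' : (q.1, z, q.2).2.1 ∈ (q.1, z, q.2).1.region := hz
      obtain ⟨z', σ, hv⟩ := exists_onVec_of_mkX_mem h hz' (by rw [mkX_of_mem hz']; exact hA hm)
      obtain ⟨o, ho⟩ := hv.exists_strand h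
      rw [strand_eq] at ho
      refine hn ⟨(o, z'.1), Prod.ext ?_ ?_⟩
      · exact (congrArg (fun q => q.1) ho).symm
      · exact (congrArg (fun q => q.2.2) ho).symm
    show ∫⁻ y, _ = 0
    simp [this]
  have e3 : ∀ o, ∑' k, G (strandType θ (o, k)) =
      ENNReal.ofReal (Real.sin θ) * total (strandHits h A o) := by
    intro o
    rw [total, ← ENNReal.tsum_mul_left]
    exact tsum_congr fun k => lintegral_strand h hA o k
  have e4 : ∑' q, G (strandType θ q) = ∑' o, ∑' k, G (strandType θ (o, k)) :=
    ENNReal.tsum_prod (f := fun o k => G (strandType θ (o, k)))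
  rw [e1, ← (strandType_injective θ).tsum_eq e2, e4, tsum_fintype, Fintype.sum_option, Fintype.sum_bool, e3, e3, e3, ← mul_add, ← mul_add]

/-- Along the lines of vectors in the triangles, the points in the interior are those
which are not ends. -/
lemma triVec_mem_own {b : Bool} {k : Idx} {a s : ℝ} (ha : 0 < a) :
    (triVec h b k a (sg b * s)).2.1 ∈ (triTile b k).own ↔
      1 < s ∧ a < (2 - s) * bet (slope θ h) b := by
  have e0 := bet_nonneg (slope θ h) b
  have e1 := bet_le_one (slope θ h) b
  have hown : (triTile b k).own = interior (triTile b k).region := by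
    cases b <;> rfl
  rw [hown]
  constructor
  · intro hm
    have hc : Continuous fun s : ℝ => (triVec h b k a (sg b * s)).2.1 :=
      (fr_continuous k).comp (continuous_pt.comp
        (f := fun s : ℝ => (a + slope θ h * (2 * sg b - sg b * s), sg b * s)) (by fun_prop))
    obtain ⟨δ, hδ, hball⟩ := Metric.isOpen_iff.1 (isOpen_interior.preimage hc) s hm
    have near : ∀ s', |s' - s| < δ → 1 ≤ s' ∧ a ≤ (2 - s') * bet (slope θ h) b := by
      intro s' hs'
      have : (triVec h b k a (sg b * s')).2.1 ∈ (triVec h b k a (sg b * s')).1.region :=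
        interior_subset (hball (show dist s' s < δ from hs'))
      rw [triVec_mem h ha] at this
      exact ⟨this.1, this.2.1⟩
    have n1 := (near (s - δ / 2) (by rw [abs_lt]; constructor <;> linarith)).1
    have n2 := (near (s + δ / 2) (by rw [abs_lt]; constructor <;> linarith)).2
    have hb : 0 < bet (slope θ h) b := by
      refine lt_of_le_of_ne e0 fun e => ?_
      rw [← e, mul_zero] at n2
      linarith
    refine ⟨by linarith, ?_⟩
    nlinarith
  · rintro ⟨h1, h2⟩
    rw [mem_interior]
    refine ⟨{z | 1 < sg b * height (unfr k z) ∧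
      |(unfr k z).re| < 1 - sg b * height (unfr k z) / 2}, ?_, ?_, ?_⟩
    · rintro z ⟨h3, h4⟩
      obtain ⟨x, y, rfl⟩ := exists_fr k z
      rw [unfr_fr, height_pt] at h3 h4
      have e : y = sg b * (sg b * y) := by rw [← mul_assoc, sg_mul_self, one_mul]
      rw [e, mem_tri_region]
      refine ⟨⟨h3.le, h4.le⟩, ?_, fun h5 => (h3.ne' h5).elim⟩
      have := abs_nonneg (pt x y).re
      linarith
    · have hh := height_continuous.comp (unfr_continuous k)
      exact (isOpen_lt continuous_const (continuous_const.mul hh)).inter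
        (isOpen_lt (Complex.continuous_re.comp (unfr_continuous k)).abs
          (continuous_const.sub ((continuous_const.mul hh).div_const 2)))
    · have hs2 : 0 < 2 - s := by
        by_contra! hn
        have := mul_nonpos_of_nonpos_of_nonneg hn e0
        linarith
      have e : a + (slope θ h : ℝ) * (2 * sg b - sg b * s) =
          a + (2 - s) * (1 / 2 - bet (slope θ h) b) := by
        rw [← slope_mul_sg]; ring
      show 1 < sg b * height (unfr k (fr k (pt _ _))) ∧ |(unfr k (fr k (pt _ _))).re| <
        1 - sg b * height (unfr k (fr k (pt _ _))) / 2
      rw [unfr_fr, height_pt, pt_re, ← mul_assoc, sg_mul_self, one_mul, e, abs_lt]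
      refine ⟨h1, ?_, ?_⟩ <;> nlinarith

/-- The representatives of the vectors of the flow `T_{θ,+}` for which the edges belong to the
hexagons: a line of vectors contains its end if this end lies in the hexagon. -/
def ownedByHexagons (κ : Slope) : Set (Sec κ × ℝ) :=
  {p | ∀ b, sg b * p.2 < reach κ b p.1.2 ∨ (sg b * p.2 = reach κ b p.1.2 ∧ bet κ b < p.1.2)}

lemma mem_ownedByHexagons {κ : Slope} {z : Sec κ} {b : Bool} {s : ℝ} (hs : 0 ≤ s) :
    (z, sg b * s) ∈ ownedByHexagons κ ↔
      s < reach κ b z.2 ∨ (s = reach κ b z.2 ∧ bet κ b < z.2) := by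
  have hb : sg b * (sg b * s) = s := by rw [← mul_assoc, sg_mul_self, one_mul]
  constructor
  · intro hm
    have := hm b
    rwa [hb] at this
  · intro hm b'
    show sg b' * (sg b * s) < _ ∨ sg b' * (sg b * s) = _ ∧ _
    by_cases hbb : b' = b
    · subst hbb; rwa [hb]
    · left
      have := reach_pos (κ := κ) (b := b') (sec_mem z)
      have : sg b' * (sg b * s) = -s := by
        cases b <;> cases b' <;> simp at hbb ⊢
      rw [this]
      linarith

lemma ownedByHexagons_isFundamental : (chartX h).IsFundamental (ownedByHexagons (slope θ h)) where
  mem_Icc z σ hm := by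
    have h1 := hm true
    have h2 := hm false
    simp only [sg_true, sg_false, one_mul, neg_one_mul] at h1 h2
    have h1' : σ ≤ reach (slope θ h) true z.2 := h1.elim le_of_lt fun e => e.1.le
    have h2' : -σ ≤ reach (slope θ h) false z.2 := h2.elim le_of_lt fun e => e.1.le
    exact ⟨neg_le.1 h2', h1'⟩
  of_mem_Ioo z σ h1 h2 := by
    have h1 : -reach (slope θ h) false z.2 < σ := h1
    have h2 : σ < reach (slope θ h) true z.2 := h2
    intro b
    left
    cases b
    · rw [sg_false, neg_one_mul]; exact neg_lt.1 h1
    · rw [sg_true, one_mul]; exact h2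
  hi_mem_iff z := by
    let z' := returnMap (slope θ h) z
    have ha := sec_mem z
    have hn := bet_not (slope θ h) true
    have e1 : (z, reach (slope θ h) true z.2) ∈ ownedByHexagons (slope θ h) ↔
        bet (slope θ h) true < z.2 := by
      have := mem_ownedByHexagons (b := true) (z := z) (reach_pos (κ := slope θ h) (b := true) ha).le
      rw [sg_true, one_mul] at this
      rw [this]
      simp
    have e2 : (z', -reach (slope θ h) false z'.2) ∈ ownedByHexagons (slope θ h) ↔
        bet (slope θ h) false < z'.2 := by
      have := mem_ownedByHexagons (b := false) (z := z')
        (reach_pos (κ := slope θ h) (b := false) (sec_mem z')).le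
      rw [sg_false, neg_one_mul] at this
      rw [this]
      simp
    show (z, reach (slope θ h) true z.2) ∈ ownedByHexagons (slope θ h) ↔
      (z', -reach (slope θ h) false z'.2) ∉ ownedByHexagons (slope θ h)
    rw [e1, e2]
    have e3 : (z'.2 : ℝ) = baseA (slope θ h) true z.2 := rfl
    rw [e3, baseA, show bet (slope θ h) false = 1 - bet (slope θ h) true from hn]
    split_ifs with hc
    · exact iff_of_false (not_lt.2 hc) (not_not.2 (by linarith [ha.1]))
    · exact iff_of_true (not_le.1 hc) (by linarith [ha.2])

lemma measurableSet_ownedByHexagons (κ : Slope) : MeasurableSet (ownedByHexagons κ) := by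
  have hr : ∀ b, Measurable fun p : Sec κ × ℝ => reach κ b p.1.2 := fun b =>
    (reach_continuous κ b).measurable.comp measurable_fst
  have ha : Measurable fun p : Sec κ × ℝ => (p.1.2 : ℝ) :=
    (continuous_place κ).measurable.comp measurable_fst
  have : ownedByHexagons κ = ⋂ b, ({p | sg b * p.2 < reach κ b p.1.2} ∪
      ({p | sg b * p.2 = reach κ b p.1.2} ∩ {p | bet κ b < p.1.2})) := by
    ext p
    rw [mem_iInter]
    rfl
  rw [this]
  refine MeasurableSet.iInter fun b => (measurableSet_lt (measurable_snd.const_mul _) (hr b)).union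
    ((measurableSet_eq_fun (measurable_snd.const_mul _) (hr b)).inter
      (measurableSet_lt measurable_const ha))

/-- The representatives in the hexagons. -/
lemma strandHits_none (A : Set X) (z : Sec (slope θ h)) : strandHits h A none z =
    (chartX h).hits (ownedByHexagons _ ∩ {p | |p.2| ≤ 1}) A z := by
  rw [strandHits, SuspensionChart.hits]
  congr 2
  ext σ
  obtain ⟨b, s, hs, rfl⟩ := exists_sg σ
  have ha := sec_mem z
  have hne := ne_bet z.2.2 b
  have htau := tau_lt_one ha hne
  have habs : |sg b * s| = s := by cases b <;> simp [abs_of_nonneg hs]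
  have hmem := hexVec_mem h (b := b) (k := z.1) ha hs
  have key : (hexVec h z.1 z.2 (sg b * s)).2.1 ∈ (Tile.hex z.1.2).region ↔
      (z, sg b * s) ∈ ownedByHexagons (slope θ h) ∧ s ≤ 1 := by
    refine hmem.trans ?_
    rw [mem_ownedByHexagons hs, hexEnd, reach]
    rcases lt_or_gt_of_ne hne with hlt | hlt
    · rw [if_pos hlt.le, if_pos hlt.le]
      constructor
      · rintro ⟨h1, -⟩
        exact ⟨Or.inl (by linarith), h1⟩
      · rintro ⟨-, h1⟩
        exact ⟨h1, fun _ => hlt⟩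
    · rw [if_neg (not_le.2 hlt), if_neg (not_le.2 hlt)]
      constructor
      · rintro ⟨h1, -⟩
        exact ⟨h1.lt_or_eq.imp_right fun e => ⟨e, hlt⟩, by linarith⟩
      · rintro ⟨h1, -⟩
        have : s ≤ tau (slope θ h) b z.2 := h1.elim le_of_lt fun e => e.1.le
        exact ⟨this, fun e => by linarith⟩
  show (_ ∈ (Tile.hex z.1.2).region ∧ _ ∈ (Tile.hex z.1.2).region ∧ mkX (hexVec h _ _ _) ∈ A) ↔
    ((_ ∈ ownedByHexagons _ ∧ |sg b * s| ≤ 1) ∧ mkX (vec h z.1 z.2 (sg b * s)) ∈ A)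
  rw [habs, ← key]
  constructor
  · rintro ⟨-, h1, h2⟩
    rw [vec_of_le_one h hs (key.1 h1).2]
    exact ⟨h1, h2⟩
  · rintro ⟨h1, h2⟩
    rw [vec_of_le_one h hs (key.1 h1).2] at h2
    exact ⟨h1, h1, h2⟩

/-- The representatives in the triangles. -/
lemma strandHits_some (A : Set X) (b : Bool) (z : Sec (slope θ h)) : strandHits h A (some b) z =
    (chartX h).hits (ownedByHexagons _ ∩ {p | 1 < sg b * p.2}) A z := by
  rw [strandHits, SuspensionChart.hits]
  congr 2
  ext σ
  obtain ⟨s, rfl⟩ : ∃ s, σ = sg b * s :=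
    ⟨sg b * σ, by rw [← mul_assoc, sg_mul_self, one_mul]⟩
  have ha := sec_mem z
  have hne := ne_bet z.2.2 b
  have hb : sg b * (sg b * s) = s := by rw [← mul_assoc, sg_mul_self, one_mul]
  have key : (triVec h b z.1 z.2 (sg b * s)).2.1 ∈ (triTile b z.1).own ↔
      (z, sg b * s) ∈ ownedByHexagons (slope θ h) ∧ 1 < s := by
    rw [triVec_mem_own h ha.1, and_comm]
    refine and_congr_left fun h1 => ?_
    rw [mem_ownedByHexagons (by linarith), reach]
    have e0 := bet_nonneg (slope θ h) b
    rcases lt_or_gt_of_ne hne with hlt | hlt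
    · rw [if_pos hlt.le, tau_of_le hlt.le, or_iff_left fun h2 => by linarith [h2.2],
        lt_sub_comm, div_lt_iff₀ (ha.1.trans hlt)]
    · rw [if_neg (not_le.2 hlt)]
      have := tau_lt_one ha hne
      refine iff_of_false (fun h2 => ?_) fun h2 => ?_
      · nlinarith
      · rcases h2 with h2 | h2 <;> linarith
  have hvec : 1 < s → (z, sg b * s) ∈ ownedByHexagons (slope θ h) →
      vec h z.1 z.2 (sg b * s) = triVec h b z.1 z.2 (sg b * s) := by
    intro h1 h2
    refine vec_of_one_lt h ?_ h1
    by_contra hn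
    have h3 := ((triVec_mem_own h ha.1).1 (key.2 ⟨h2, h1⟩)).2
    have e0 := bet_nonneg (slope θ h) b
    nlinarith
  show (_ ∈ (triTile b z.1).own ∧ _ ∈ (triTile b z.1).region ∧ mkX (triVec h b _ _ _) ∈ A) ↔
    ((_ ∈ ownedByHexagons _ ∧ 1 < sg b * (sg b * s)) ∧ mkX (vec h z.1 z.2 (sg b * s)) ∈ A)
  rw [hb, ← key]
  have hsub : (triTile b z.1).own ⊆ (triTile b z.1).region := by
    cases b <;> exact interior_subset
  constructor
  · rintro ⟨h1, -, h2⟩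
    rw [hvec (key.1 h1).2 (key.1 h1).1]
    exact ⟨h1, h2⟩
  · rintro ⟨h1, h2⟩
    rw [hvec (key.1 h1).2 (key.1 h1).1] at h2
    exact ⟨h1, hsub h1, h2⟩

/-- The transverse measure of a cross-section of the refractive flow, by the hits in a set of
representatives. -/
lemma transverseX_eq_hits {A : Set X} (hA : A ⊆ (chartX h).dom)
    (hAm : MeasurableSet {p : Sec (slope θ h) × ℝ | (chartX h).orbit p.1 p.2 ∈ A}) {w : ℝ}
    (hw : 0 < w) (hsep : ∀ z s s', (chartX h).orbit z s ∈ A → (chartX h).orbit z s' ∈ A →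
      s < s' → w ≤ s' - s) :
    transverseX A =
      ENNReal.ofReal (Real.sin θ) * total ((chartX h).hits (ownedByHexagons _) A) := by
  have hP := ownedByHexagons_isFundamental h
  have hPm := measurableSet_ownedByHexagons (slope θ h)
  have m0 : MeasurableSet {p : Sec (slope θ h) × ℝ | |p.2| ≤ 1} :=
    (isClosed_le continuous_snd.abs continuous_const).measurableSet
  have m1 : ∀ b, MeasurableSet {p : Sec (slope θ h) × ℝ | 1 < sg b * p.2} := fun b =>
    measurableSet_lt measurable_const (measurable_snd.const_mul _)
  have meas : ∀ Q, MeasurableSet Q →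
      Measurable ((chartX h).hits (ownedByHexagons (slope θ h) ∩ Q) A) := fun Q hQ =>
    (chartX h).measurable_hits (hPm.inter hQ) (fun z σ hm => hP.mem_Icc z σ hm.1) hAm hw hsep
  have hu : ownedByHexagons (slope θ h) = ownedByHexagons (slope θ h) ∩ {p | |p.2| ≤ 1} ∪
      (ownedByHexagons (slope θ h) ∩ {p | 1 < sg true * p.2} ∪
        ownedByHexagons (slope θ h) ∩ {p | 1 < sg false * p.2}) := by
    ext p
    simp only [mem_union, mem_inter_iff, mem_ofPred_eq, sg_true, sg_false, one_mul, neg_one_mul]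
    rw [← and_or_left, ← and_or_left, ← lt_abs]
    exact (and_iff_left (le_or_gt _ _)).symm
  have hd1 : Disjoint (ownedByHexagons (slope θ h) ∩ {p | 1 < sg true * p.2})
      (ownedByHexagons (slope θ h) ∩ {p | 1 < sg false * p.2}) := by
    refine disjoint_left.2 fun p h1 h2 => ?_
    have h1 : 1 < sg true * p.2 := h1.2
    have h2 : 1 < sg false * p.2 := h2.2
    rw [sg_true] at h1
    rw [sg_false] at h2
    linarith
  have hd0 : Disjoint (ownedByHexagons (slope θ h) ∩ {p | |p.2| ≤ 1})
      (ownedByHexagons (slope θ h) ∩ {p | 1 < sg true * p.2} ∪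
        ownedByHexagons (slope θ h) ∩ {p | 1 < sg false * p.2}) := by
    refine disjoint_left.2 fun p h1 h2 => ?_
    have h1 : |p.2| ≤ 1 := h1.2
    rw [abs_le] at h1
    rcases h2 with ⟨-, h2⟩ | ⟨-, h2⟩
    · have h2 : 1 < sg true * p.2 := h2
      rw [sg_true] at h2; linarith
    · have h2 : 1 < sg false * p.2 := h2
      rw [sg_false] at h2; linarith
  rw [transverseX_eq h hA, funext (strandHits_none h A), funext (strandHits_some h A true),
    funext (strandHits_some h A false), ← total_add (meas _ (m1 true)),
    ← funext fun z => (chartX h).hits_eq_add rfl hd1 A z, ← total_add (meas _ m0),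
    ← funext fun z => (chartX h).hits_eq_add hu hd0 A z]

end

/-! ### The orbit equivalence -/

section

variable {θ : ℝ} (h : θ ∈ Icc (Real.pi / 3) (2 * Real.pi / 3))

lemma domS_eq : domS θ = (chartS (slope θ h)).dom := (chartS_describes h).dom_eq (climb_pos h)

lemma domX_eq : domX θ = (chartX h).dom := (chartX_describes h).dom_eq (climb_pos h)

/-- A map which matches the section points and the normalized times of the two suspension flows
preserves the transverse measure: both measures are the integral of the number of visits. -/
lemma transverse_eq {A : Set S} {B : Set X} (hA : A ⊆ domS θ) (hB : B ⊆ domX θ)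
    (hAB : ∀ z s, (chartX h).orbit z s ∈ B ↔ (chartS (slope θ h)).orbit z s ∈ A)
    (hAm : MeasurableSet {p : Sec (slope θ h) × ℝ | (chartS (slope θ h)).orbit p.1 p.2 ∈ A})
    (hcs : IsCrossSection (IsStraightTrajectory θ) A) : transverseX B = transverseS θ A := by
  obtain ⟨w, hw, hsep⟩ := (chartS_describes h).separated (climb_pos h) hcs
  rw [domS_eq h] at hA
  rw [domX_eq h] at hB
  have hBm : MeasurableSet {p : Sec (slope θ h) × ℝ | (chartX h).orbit p.1 p.2 ∈ B} := by
    simpa only [hAB] using hAm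
  have hsepB : ∀ z s s', (chartX h).orbit z s ∈ B → (chartX h).orbit z s' ∈ B → s < s' →
      w ≤ s' - s := by
    simpa only [hAB] using hsep
  have hv : (chartX h).visits B = (chartS (slope θ h)).visits A := by
    funext z
    simp only [SuspensionChart.visits, hAB]
  rw [transverseX_eq_hits h hB hBm hw hsepB, transverseS_eq h hA,
    total_hits _ (ownedByHexagons_isFundamental h) (measurableSet_ownedByHexagons _) hBm hw hsepB,
    total_hits _ (belowTop_isFundamental _) (measurableSet_belowTop _) hAm hw hsep, hv]

end

end Trihex

end

theorem theorem3p4 (θ : ℝ) (hθ₁ : Real.pi / 3 ≤ θ) (hθ₂ : θ ≤ 2 * Real.pi / 3) :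
    ∃ x : Trihex.domS θ ≃ₜ Trihex.domX θ,
      -- trajectories are carried onto trajectories, with their orientation
      (∀ γ : ℝ → Trihex.domS θ, Trihex.IsStraightTrajectory θ (fun s => (γ s : Trihex.S)) →
        ∃ γX : ℝ → Trihex.domX θ,
          Trihex.IsRefractiveTrajectoryPlus θ (fun t => (γX t : Trihex.X)) ∧
          ∃ φ : ℝ ≃o ℝ, ∀ s, x (γ s) = γX (φ s)) ∧
      -- the Lebesgue transverse measure is carried to the Lebesgue transverse measure
      (∀ A : Set (Trihex.domS θ), @MeasurableSet _ (borel (Trihex.domS θ)) A →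
        Trihex.IsCrossSection (Trihex.IsStraightTrajectory θ) (Subtype.val '' A) →
        Trihex.transverseX (Subtype.val '' (x '' A)) =
          Trihex.transverseS θ (Subtype.val '' A)) ∧
      -- the restrictions to the trajectories are bilipschitz with one constant
      (∃ L : ℝ, 1 ≤ L ∧
        ∀ γ : ℝ → Trihex.domS θ, Trihex.IsStraightTrajectory θ (fun s => (γ s : Trihex.S)) →
          ∀ s t : ℝ,
            L⁻¹ * Trihex.orbitDist (Trihex.IsStraightTrajectory θ) (γ s : Trihex.S) (γ t) ≤
              Trihex.orbitDist (Trihex.IsRefractiveTrajectoryPlus θ)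
                (x (γ s) : Trihex.X) (x (γ t)) ∧
            Trihex.orbitDist (Trihex.IsRefractiveTrajectoryPlus θ)
                (x (γ s) : Trihex.X) (x (γ t)) ≤
              L * Trihex.orbitDist (Trihex.IsStraightTrajectory θ) (γ s : Trihex.S) (γ t)) := by
  have h : θ ∈ Set.Icc (Real.pi / 3) (2 * Real.pi / 3) := ⟨hθ₁, hθ₂⟩
  obtain ⟨x, hx, htraj, hlip⟩ := Trihex.SuspensionChart.exists_orbit_equivalence
    (Trihex.chartS (Trihex.slope θ h)) (Trihex.chartX h) (Trihex.climb_pos h)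
    (T := Trihex.IsStraightTrajectory θ) (T' := Trihex.IsRefractiveTrajectoryPlus θ)
    (Trihex.chartS_describes h) (Trihex.chartX_describes h) (Trihex.domS_eq h) (Trihex.domX_eq h)
  refine ⟨x, htraj, fun A hA hcs => ?_, 3, by norm_num, hlip⟩
  have mem : ∀ z s, (Trihex.chartS (Trihex.slope θ h)).orbit z s ∈ Trihex.domS θ := fun z s => by
    rw [Trihex.domS_eq h]
    exact ⟨(z, s), rfl⟩
  refine Trihex.transverse_eq h (Subtype.coe_image_subset _ _) (Subtype.coe_image_subset _ _)
    (fun z s => ?_) ?_ hcs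
  · have e := hx ⟨_, mem z s⟩ z s rfl
    constructor
    · rintro ⟨_, ⟨a, ha, rfl⟩, e'⟩
      have : x a = x ⟨_, mem z s⟩ := Subtype.ext (e'.trans e.symm)
      exact ⟨a, ha, congrArg Subtype.val (x.injective this)⟩
    · rintro ⟨a, ha, e'⟩
      exact ⟨x a, ⟨a, ha, rfl⟩, hx a z s e'⟩
  · have hc : Continuous fun p : Trihex.Sec (Trihex.slope θ h) × ℝ =>
        (⟨_, mem p.1 p.2⟩ : Trihex.domS θ) :=
      (Trihex.chartS (Trihex.slope θ h)).orbit_continuous.subtype_mk _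
    let _ : MeasurableSpace (Trihex.domS θ) := borel _
    have : BorelSpace (Trihex.domS θ) := ⟨rfl⟩
    convert hA.preimage hc.measurable using 1
    ext p
    constructor
    · rintro ⟨a, ha, e⟩
      have : a = ⟨_, mem p.1 p.2⟩ := Subtype.ext e
      rwa [this] at ha
    · exact fun hp => ⟨_, hp, rfl⟩
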